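/- Work over $\mathbb{C}$. For $0\le k\le n$ let $\mathrm{Gr}(k,n)$ be the Grassmannian scheme of $k$-dimensional subspaces of $\mathbb{C}^n$, with tautological exact sequence $0\to\mathcal{U}\to\mathcal{O}^{\oplus n}\to\mathcal{Q}\to 0$, where $\mathcal{U}$ has rank $k$ and $\mathcal{Q}$ has rank $n-k$. The zero locus of a global section of a vector bundle is taken with its natural scheme structure, and $\mathcal{Q}\boxtimes\mathcal{U}^\vee$ on $\mathrm{Gr}(k,n-1)\times\mathrm{Gr}(k,n)$ denotes the tensor product of the pull-back of $\mathcal{Q}$ from $\mathrm{Gr}(k,n-1)$ and of the pull-back of $\mathcal{U}^\vee$ from $\mathrm{Gr}(k,n)$. Let $1\le k\le n-1$. There are non-empty Zariski open subsets \[A\subseteq H^0(\mathrm{Gr}(k,n-1)\times\mathrm{Gr}(k,n),\,\mathcal{Q}\boxtimes\mathcal{U}^\vee),\qquad B\subseteq H^0(\mathrm{Gr}(k,n),\mathcal{Q})\] such that, writing $\mathscr{Z}(s)$ and $\mathscr{Z}(t)$ for the zero loci of sections: 1. for every $t\in B$, $\mathscr{Z}(t)\subset\mathrm{Gr}(k,n)$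 is isomorphic to $\mathrm{Gr}(k-1,n-1)$ over $\mathbb{C}$; 2. for every $s\in A$ and every $t\in B$, the blow-up $\mathrm{Bl}_{\mathscr{Z}(t)}\mathrm{Gr}(k,n)$ is isomorphic to $\mathscr{Z}(s)$ over $\mathbb{C}$; 3. for every $s\in A$ there is $t\in B$ such that the projection $\mathscr{Z}(s)\to\mathrm{Gr}(k,n)$ is itself the blow-up of $\mathrm{Gr}(k,n)$ along $\mathscr{Z}(t)$. Here the blow-up of $X$ along a closed subscheme $Z$ is the morphism to $X$ that is universal among the morphisms $T\to X$ for which the inverse image of $Z$ is an effective Cartier divisor on $T$. -/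

import Mathlib

open CategoryTheory CategoryTheory.Limits AlgebraicGeometry

noncomputable section

namespace GrBlow

/-- The coordinate ring of the standard affine chart of `Gr(k, n)` indexed by `σ`: polynomials in
the entries `x i j`, with `j` not in the range of `σ`. -/
abbrev ChartRing {k n : ℕ} (σ : Fin k ↪o Fin n) : Type :=
  MvPolynomial (Fin k × {j : Fin n // j ∉ Set.range σ}) ℂ

open Classical in
/-- The universal `k × n` matrix on the chart `σ`: its columns indexed by `σ` form the identity
matrix, the other entries are the coordinates. -/
def chartMatrix {k n : ℕ} (σ : Fin k ↪o Fin n) : Matrix (Fin k) (Fin n) (ChartRing σ) :=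
  fun i j => if h : j ∈ Set.range σ then (if σ i = j then 1 else 0) else MvPolynomial.X (i, ⟨j, h⟩)

lemma chartMatrix_submatrix {k n : ℕ} (σ : Fin k ↪o Fin n) :
    (chartMatrix σ).submatrix id σ = 1 := by
  ext i j : 2
  simp [chartMatrix, Matrix.one_apply]

/-- The homomorphism from the coordinate ring of the chart `σ` to `B` with a given value of the
universal matrix (only the columns outside of `σ` matter). -/
def chartEval {k n : ℕ} (σ : Fin k ↪o Fin n) {B : Type} [CommRing B] (c : ℂ →+* B)
    (M : Matrix (Fin k) (Fin n) B) : ChartRing σ →+* B :=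
  MvPolynomial.eval₂Hom c (fun p => M p.1 p.2)

lemma chartEval_C {k n : ℕ} (σ : Fin k ↪o Fin n) {B : Type} [CommRing B] (c : ℂ →+* B)
    (M : Matrix (Fin k) (Fin n) B) : (chartEval σ c M).comp MvPolynomial.C = c := by
  ext; simp [chartEval]

lemma chartEval_matrix {k n : ℕ} (σ : Fin k ↪o Fin n) {B : Type} [CommRing B] (c : ℂ →+* B)
    (M : Matrix (Fin k) (Fin n) B) (hM : M.submatrix id σ = 1) :
    (chartMatrix σ).map (chartEval σ c M) = M := by
  ext i j
  by_cases h : j ∈ Set.range σ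
  · obtain ⟨j, rfl⟩ := h
    have := congr_fun (congr_fun hM i) j
    simp only [Matrix.submatrix_apply, id] at this
    rw [this]
    by_cases hij : i = j <;> simp [chartMatrix, Matrix.one_apply, hij]
  · simp [chartMatrix, h, chartEval]

lemma chartRing_hom_ext {k n : ℕ} {σ : Fin k ↪o Fin n} {B : Type} [CommRing B]
    {f g : ChartRing σ →+* B} (hC : f.comp MvPolynomial.C = g.comp MvPolynomial.C)
    (h : (chartMatrix σ).map f = (chartMatrix σ).map g) : f = g := by
  refine MvPolynomial.ringHom_ext (fun r => congr($hC r)) ?_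
  rintro ⟨i, j, hj⟩
  have := congr_fun (congr_fun h i) j
  simpa [chartMatrix, hj] using this

/-- The minor of the universal matrix on the chart `σ` with columns `τ`. -/
def minor {k n : ℕ} (σ τ : Fin k ↪o Fin n) : ChartRing σ :=
  ((chartMatrix σ).submatrix id τ).det

lemma map_minor {k n : ℕ} (σ τ : Fin k ↪o Fin n) {B : Type} [CommRing B]
    (f : ChartRing σ →+* B) :
    f (minor σ τ) = (((chartMatrix σ).map f).submatrix id τ).det := by
  rw [minor, RingHom.map_det]; rfl

/-- The coordinate ring of the overlap of the charts `σ` and `τ`, as an open subset of `σ`. -/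
abbrev OverlapRing {k n : ℕ} (σ τ : Fin k ↪o Fin n) : Type := Localization.Away (minor σ τ)

/-- The universal matrix of the chart `σ` on the overlap with `τ`. -/
def overlapMatrix {k n : ℕ} (σ τ : Fin k ↪o Fin n) :
    Matrix (Fin k) (Fin n) (OverlapRing σ τ) :=
  (chartMatrix σ).map (algebraMap (ChartRing σ) (OverlapRing σ τ))

/-- Normalizing a `k × n` matrix to have the identity in the columns `τ`. -/
def normalize {k n : ℕ} (τ : Fin k ↪o Fin n) {B : Type} [CommRing B]
    (M : Matrix (Fin k) (Fin n) B) : Matrix (Fin k) (Fin n) B :=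
  (M.submatrix id τ)⁻¹ * M

lemma submatrix_mul' {k n : ℕ} (τ : Fin k ↪o Fin n) {B : Type} [CommRing B]
    (N : Matrix (Fin k) (Fin k) B) (M : Matrix (Fin k) (Fin n) B) :
    (N * M).submatrix id τ = N * M.submatrix id τ := rfl

lemma normalize_submatrix {k n : ℕ} (τ : Fin k ↪o Fin n) {B : Type} [CommRing B]
    (M : Matrix (Fin k) (Fin n) B) (hM : IsUnit (M.submatrix id τ).det) :
    (normalize τ M).submatrix id τ = 1 := by
  rw [normalize, submatrix_mul', Matrix.nonsing_inv_mul _ hM]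

lemma isUnit_normalize {k n : ℕ} (τ σ : Fin k ↪o Fin n) {B : Type} [CommRing B]
    (M : Matrix (Fin k) (Fin n) B) (hM : IsUnit (M.submatrix id τ).det)
    (hM' : IsUnit (M.submatrix id σ).det) :
    IsUnit ((normalize τ M).submatrix id σ).det := by
  rw [normalize, submatrix_mul', Matrix.det_mul]
  exact ((Matrix.isUnit_nonsing_inv_det_iff).2 hM).mul hM'

lemma normalize_normalize {k n : ℕ} (τ σ : Fin k ↪o Fin n) {B : Type} [CommRing B]
    (M : Matrix (Fin k) (Fin n) B) (hM : IsUnit (M.submatrix id τ).det) :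
    normalize σ (normalize τ M) = normalize σ M := by
  have h2 : IsUnit (M.submatrix id τ)⁻¹.det := (Matrix.isUnit_nonsing_inv_det_iff).2 hM
  simp only [normalize, submatrix_mul', Matrix.mul_inv_rev]
  rw [Matrix.mul_assoc, ← Matrix.mul_assoc _ _ M, Matrix.nonsing_inv_mul _ h2, Matrix.one_mul]

lemma normalize_of_eq_one {k n : ℕ} (τ : Fin k ↪o Fin n) {B : Type} [CommRing B]
    (M : Matrix (Fin k) (Fin n) B) (hM : M.submatrix id τ = 1) : normalize τ M = M := by
  simp [normalize, hM]

lemma map_normalize {k n : ℕ} (τ : Fin k ↪o Fin n) {B B' : Type} [CommRing B] [CommRing B']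
    (f : B →+* B') (M : Matrix (Fin k) (Fin n) B) (hM : IsUnit (M.submatrix id τ).det) :
    (normalize τ M).map f = normalize τ (M.map f) := by
  have h' : IsUnit (((M.map f).submatrix id τ)).det := by
    have := hM.map f
    rwa [RingHom.map_det] at this
  have h1 : ((M.submatrix id τ)⁻¹).map f * (M.map f).submatrix id τ = 1 := by
    rw [Matrix.submatrix_map, ← Matrix.map_mul, Matrix.nonsing_inv_mul _ hM]
    simp
  rw [normalize, Matrix.map_mul, normalize, Matrix.inv_eq_left_inv h1]

lemma isUnit_overlap {k n : ℕ} (σ τ : Fin k ↪o Fin n) :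
    IsUnit ((overlapMatrix σ τ).submatrix id τ).det := by
  rw [overlapMatrix, ← map_minor]
  exact IsLocalization.Away.algebraMap_isUnit (minor σ τ)

lemma isUnit_overlap' {k n : ℕ} (σ τ : Fin k ↪o Fin n) :
    IsUnit ((overlapMatrix σ τ).submatrix id σ).det := by
  have : (overlapMatrix σ τ).submatrix id σ = 1 := by
    rw [overlapMatrix, Matrix.submatrix_map, chartMatrix_submatrix]; simp
  simp [this]

/-- The change of charts: the universal matrix of the chart `τ` is the one of `σ`, normalized to
have the identity in the columns `τ`. -/
def changeHom {k n : ℕ} (σ τ : Fin k ↪o Fin n) : ChartRing τ →+* OverlapRing σ τ :=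
  chartEval τ ((algebraMap (ChartRing σ) (OverlapRing σ τ)).comp MvPolynomial.C)
    (normalize τ (overlapMatrix σ τ))

lemma changeHom_C {k n : ℕ} (σ τ : Fin k ↪o Fin n) :
    (changeHom σ τ).comp MvPolynomial.C =
      (algebraMap (ChartRing σ) (OverlapRing σ τ)).comp MvPolynomial.C :=
  chartEval_C _ _ _

lemma changeHom_matrix {k n : ℕ} (σ τ : Fin k ↪o Fin n) :
    (chartMatrix τ).map (changeHom σ τ) = normalize τ (overlapMatrix σ τ) :=
  chartEval_matrix _ _ _ (normalize_submatrix _ _ (isUnit_overlap σ τ))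

lemma isUnit_changeHom {k n : ℕ} (σ τ : Fin k ↪o Fin n) :
    IsUnit (changeHom σ τ (minor τ σ)) := by
  rw [map_minor, changeHom_matrix]
  exact isUnit_normalize _ _ _ (isUnit_overlap σ τ) (isUnit_overlap' σ τ)

/-- The change of charts as a homomorphism between the coordinate rings of the overlap. -/
def overlapHom {k n : ℕ} (σ τ : Fin k ↪o Fin n) : OverlapRing τ σ →+* OverlapRing σ τ :=
  IsLocalization.Away.lift (minor τ σ) (isUnit_changeHom σ τ)

lemma overlapHom_comp {k n : ℕ} (σ τ : Fin k ↪o Fin n) :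
    (overlapHom σ τ).comp (algebraMap (ChartRing τ) (OverlapRing τ σ)) = changeHom σ τ :=
  IsLocalization.Away.lift_comp _ _

/-- For a `k × n` matrix `M` with the identity in the columns `σ`: the `n × n` matrix of the
projection (acting on row vectors) along the row space of `M` onto the span of the standard basis
vectors `e j`, with `j` not in the range of `σ`. -/
def projMatrix {k n : ℕ} (σ : Fin k ↪o Fin n) {B : Type} [CommRing B]
    (M : Matrix (Fin k) (Fin n) B) : Matrix (Fin n) (Fin n) B :=
  1 - (1 : Matrix (Fin n) (Fin n) B).submatrix id σ * M

lemma projMatrix_apply_of_mem {k n : ℕ} (σ : Fin k ↪o Fin n) {B : Type} [CommRing B]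
    (M : Matrix (Fin k) (Fin n) B) (hM : M.submatrix id σ = 1) (l j : Fin n)
    (h : j ∈ Set.range σ) : projMatrix σ M l j = 0 := by
  obtain ⟨j, rfl⟩ := h
  have : ∀ i, M i (σ j) = (1 : Matrix _ _ _) i j := fun i => congr_fun (congr_fun hM i) j
  simp [projMatrix, Matrix.mul_apply, this, Matrix.one_apply]

lemma projMatrix_apply_of_notMem {k n : ℕ} (σ : Fin k ↪o Fin n) {B : Type} [CommRing B]
    (M : Matrix (Fin k) (Fin n) B) (l j : Fin n)
    (h : l ∉ Set.range σ) : projMatrix σ M l j = (1 : Matrix (Fin n) (Fin n) B) l j := by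
  have : ∀ i, l ≠ σ i := fun i hi => h ⟨i, hi.symm⟩
  simp [projMatrix, Matrix.mul_apply, Matrix.one_apply, this]

lemma mul_projMatrix {k n : ℕ} (σ : Fin k ↪o Fin n) {B : Type} [CommRing B]
    (M : Matrix (Fin k) (Fin n) B) (hM : M.submatrix id σ = 1) : M * projMatrix σ M = 0 := by
  have : M * (1 : Matrix (Fin n) (Fin n) B).submatrix id σ = 1 := by
    rw [← hM]
    ext i j
    simp [Matrix.mul_apply, Matrix.one_apply]
  rw [projMatrix, Matrix.mul_sub, ← Matrix.mul_assoc, this]; simp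

lemma projMatrix_mul {k n : ℕ} (σ τ : Fin k ↪o Fin n) {B : Type} [CommRing B]
    (M N : Matrix (Fin k) (Fin n) B) (hM : M.submatrix id σ = 1)
    (h : N = N.submatrix id σ * M) : projMatrix τ N * projMatrix σ M = projMatrix σ M := by
  have h0 : N * projMatrix σ M = 0 := by
    rw [h, Matrix.mul_assoc, mul_projMatrix σ M hM, Matrix.mul_zero]
  rw [projMatrix, Matrix.sub_mul, Matrix.mul_assoc, h0]; simp

lemma map_projMatrix {k n : ℕ} (σ : Fin k ↪o Fin n) {B B' : Type} [CommRing B] [CommRing B']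
    (f : B →+* B') (M : Matrix (Fin k) (Fin n) B) :
    (projMatrix σ M).map f = projMatrix σ (M.map f) := by
  ext l j
  simp [projMatrix, Matrix.mul_apply, Matrix.one_apply, apply_ite f]

lemma projMatrix_block {k n : ℕ} (σ τ ρ : Fin k ↪o Fin n) {B : Type} [CommRing B]
    (M N : Matrix (Fin k) (Fin n) B) (hM : M.submatrix id σ = 1) (hN : N.submatrix id τ = 1)
    (h : N = N.submatrix id σ * M) [Fintype {j : Fin n // j ∉ Set.range τ}] :
    ((projMatrix τ N).submatrix Subtype.val Subtype.val :
        Matrix {j : Fin n // j ∉ Set.range ρ} {j : Fin n // j ∉ Set.range τ} B) *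
      ((projMatrix σ M).submatrix Subtype.val Subtype.val :
        Matrix {j : Fin n // j ∉ Set.range τ} {j : Fin n // j ∉ Set.range σ} B) =
      ((projMatrix σ M).submatrix Subtype.val Subtype.val :
        Matrix {j : Fin n // j ∉ Set.range ρ} {j : Fin n // j ∉ Set.range σ} B) := by
  classical
  ext l j
  have h1 := congr_fun (congr_fun (projMatrix_mul σ τ M N hM h) l.1) j.1
  rw [Matrix.mul_apply] at h1
  rw [Matrix.mul_apply, Matrix.submatrix_apply, ← h1,
    ← Fintype.sum_subtype_add_sum_subtype (fun j => j ∉ Set.range τ)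
      (fun x => projMatrix τ N l.1 x * projMatrix σ M x j.1)]
  have h2 : ∑ x : {x : Fin n // ¬ x ∉ Set.range τ},
      projMatrix τ N l.1 x * projMatrix σ M x j.1 = 0 :=
    Finset.sum_eq_zero fun x _ => by
      rw [projMatrix_apply_of_mem τ N hN _ _ (not_not.1 x.2), zero_mul]
  rw [h2, add_zero]
  exact Finset.sum_congr (by ext; simp) fun _ _ => rfl

/-- The standard affine chart. -/
abbrev chart {k n : ℕ} (σ : Fin k ↪o Fin n) : Scheme.{0} := Spec (.of (ChartRing σ))

/-- The overlap of two charts. -/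
abbrev overlap {k n : ℕ} (σ τ : Fin k ↪o Fin n) : Scheme.{0} := Spec (.of (OverlapRing σ τ))

/-- The inclusion of the overlap into the first chart. -/
abbrev overlapι {k n : ℕ} (σ τ : Fin k ↪o Fin n) : overlap σ τ ⟶ chart σ :=
  Spec.map (CommRingCat.ofHom (algebraMap (ChartRing σ) (OverlapRing σ τ)))

/-- The transition between the two incarnations of the overlap. -/
abbrev overlapT {k n : ℕ} (σ τ : Fin k ↪o Fin n) : overlap σ τ ⟶ overlap τ σ :=
  Spec.map (CommRingCat.ofHom (overlapHom σ τ))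

/-- The ring homomorphism corresponding to a morphism to an affine scheme. -/
def pt {T : Scheme.{0}} {R : Type} [CommRing R] (u : T ⟶ Spec (.of R)) : R →+* Γ(T, ⊤) :=
  ((Scheme.ΓSpecIso (.of R)).inv ≫ u.appTop).hom

lemma pt_injective {T : Scheme.{0}} {R : Type} [CommRing R] {u v : T ⟶ Spec (.of R)}
    (h : pt u = pt v) : u = v := by
  refine ext_of_isAffine ?_
  have := CommRingCat.hom_ext h
  rwa [cancel_epi] at this

lemma pt_comp_map {T : Scheme.{0}} {R S : Type} [CommRing R] [CommRing S]
    (u : T ⟶ Spec (.of S)) (φ : R →+* S) :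
    pt (u ≫ Spec.map (CommRingCat.ofHom φ)) = (pt u).comp φ := by
  have h := Scheme.ΓSpecIso_inv_naturality (CommRingCat.ofHom φ)
  have h' : (Scheme.ΓSpecIso (.of R)).inv ≫ (u ≫ Spec.map (CommRingCat.ofHom φ)).appTop =
      CommRingCat.ofHom φ ≫ (Scheme.ΓSpecIso (.of S)).inv ≫ u.appTop := by
    rw [Scheme.Hom.comp_appTop, ← Category.assoc, ← h, Category.assoc]
  exact congr($(h').hom)

lemma pt_comp {T T' : Scheme.{0}} {R : Type} [CommRing R] (w : T' ⟶ T)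
    (u : T ⟶ Spec (.of R)) : pt (w ≫ u) = w.appTop.hom.comp (pt u) := by
  simp only [pt, Scheme.Hom.comp_appTop]; rfl

/-- The morphism to an affine scheme given by a ring homomorphism. -/
def toSpec {T : Scheme.{0}} {R : Type} [CommRing R] (φ : R →+* Γ(T, ⊤)) : T ⟶ Spec (.of R) :=
  T.toSpecΓ ≫ Spec.map (CommRingCat.ofHom φ)

lemma pt_toSpec {T : Scheme.{0}} {R : Type} [CommRing R] (φ : R →+* Γ(T, ⊤)) :
    pt (toSpec φ) = φ := by
  have h : pt (R := Γ(T, ⊤)) T.toSpecΓ = RingHom.id _ := by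
    have : (Scheme.ΓSpecIso Γ(T, ⊤)).inv ≫ T.toSpecΓ.appTop = 𝟙 _ := by
      rw [Scheme.toSpecΓ_appTop, Iso.inv_hom_id]
    exact congr($(this).hom)
  rw [toSpec]
  exact (pt_comp_map (R := R) (S := Γ(T, ⊤)) T.toSpecΓ φ).trans (by rw [h]; rfl)

lemma pt_overlapT {k n : ℕ} (σ τ : Fin k ↪o Fin n) {T : Scheme.{0}} (w : T ⟶ overlap σ τ) :
    (chartMatrix τ).map (pt (w ≫ overlapT σ τ ≫ overlapι τ σ)) =
        normalize τ ((chartMatrix σ).map (pt (w ≫ overlapι σ τ))) ∧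
      (pt (w ≫ overlapT σ τ ≫ overlapι τ σ)).comp MvPolynomial.C =
        (pt (w ≫ overlapι σ τ)).comp MvPolynomial.C := by
  rw [← Category.assoc, pt_comp_map, pt_comp_map, pt_comp_map, RingHom.comp_assoc,
    overlapHom_comp]
  constructor
  · rw [RingHom.coe_comp, ← Matrix.map_map, changeHom_matrix,
      map_normalize _ _ _ (isUnit_overlap σ τ)]
    rfl
  · rw [RingHom.comp_assoc, changeHom_C, RingHom.comp_assoc]

lemma isUnit_pt {k n : ℕ} (σ τ : Fin k ↪o Fin n) {T : Scheme.{0}} (w : T ⟶ overlap σ τ) :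
    IsUnit (((chartMatrix σ).map (pt (w ≫ overlapι σ τ))).submatrix id τ).det := by
  rw [← map_minor, pt_comp_map]
  exact (IsLocalization.Away.algebraMap_isUnit (minor σ τ)).map (pt w)

/-- A morphism to the chart `σ` with invertible `τ`-minor factors through the overlap. -/
def overlapLift {k n : ℕ} (σ τ : Fin k ↪o Fin n) {T : Scheme.{0}} (u : T ⟶ chart σ)
    (h : IsUnit (((chartMatrix σ).map (pt u)).submatrix id τ).det) : T ⟶ overlap σ τ :=
  toSpec (IsLocalization.Away.lift (minor σ τ) (g := pt u) (by rwa [map_minor]))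

lemma overlapLift_comp {k n : ℕ} (σ τ : Fin k ↪o Fin n) {T : Scheme.{0}} (u : T ⟶ chart σ)
    (h : IsUnit (((chartMatrix σ).map (pt u)).submatrix id τ).det) :
    overlapLift σ τ u h ≫ overlapι σ τ = u := by
  apply pt_injective
  rw [pt_comp_map, overlapLift, pt_toSpec, IsLocalization.Away.lift_comp]

lemma isUnit_triple {k n : ℕ} (σ τ ρ : Fin k ↪o Fin n) :
    IsUnit (((chartMatrix τ).map (pt (pullback.fst (overlapι σ τ) (overlapι σ ρ) ≫
      overlapT σ τ ≫ overlapι τ σ))).submatrix id ρ).det := by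
  rw [(pt_overlapT σ τ _).1]
  refine isUnit_normalize _ _ _ (isUnit_pt σ τ _) ?_
  rw [pullback.condition]
  exact isUnit_pt σ ρ _

/-- The transition on triple overlaps. -/
def tripleT {k n : ℕ} (σ τ ρ : Fin k ↪o Fin n) :
    pullback (overlapι σ τ) (overlapι σ ρ) ⟶ pullback (overlapι τ ρ) (overlapι τ σ) :=
  pullback.lift (overlapLift τ ρ _ (isUnit_triple σ τ ρ)) (pullback.fst _ _ ≫ overlapT σ τ)
    (by rw [overlapLift_comp, Category.assoc])

lemma tripleT_comp {k n : ℕ} (σ τ ρ : Fin k ↪o Fin n) {T : Scheme.{0}}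
    (w : T ⟶ pullback (overlapι σ τ) (overlapι σ ρ)) :
    (chartMatrix τ).map (pt ((w ≫ tripleT σ τ ρ) ≫ pullback.fst _ _ ≫ overlapι τ ρ)) =
        normalize τ ((chartMatrix σ).map (pt (w ≫ pullback.fst _ _ ≫ overlapι σ τ))) ∧
      (pt ((w ≫ tripleT σ τ ρ) ≫ pullback.fst _ _ ≫ overlapι τ ρ)).comp MvPolynomial.C =
        (pt (w ≫ pullback.fst _ _ ≫ overlapι σ τ)).comp MvPolynomial.C := by
  have h : (w ≫ tripleT σ τ ρ) ≫ pullback.fst _ _ ≫ overlapι τ ρ =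
      (w ≫ pullback.fst _ _) ≫ overlapT σ τ ≫ overlapι τ σ := by
    rw [pullback.condition, tripleT, Category.assoc, pullback.lift_snd_assoc]
    simp only [Category.assoc]
  rw [h]
  have := pt_overlapT σ τ (w ≫ pullback.fst (overlapι σ τ) (overlapι σ ρ))
  simpa only [Category.assoc] using this

lemma tripleT_cocycle {k n : ℕ} (σ τ ρ : Fin k ↪o Fin n) :
    tripleT σ τ ρ ≫ tripleT τ ρ σ ≫ tripleT ρ σ τ = 𝟙 _ := by
  have h1 := tripleT_comp σ τ ρ (𝟙 _)
  have h2 := tripleT_comp τ ρ σ (𝟙 _ ≫ tripleT σ τ ρ)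
  have h3 := tripleT_comp ρ σ τ ((𝟙 _ ≫ tripleT σ τ ρ) ≫ tripleT τ ρ σ)
  have u1 := isUnit_pt σ τ (𝟙 _ ≫ pullback.fst (overlapι σ τ) (overlapι σ ρ))
  have u2 : IsUnit (((chartMatrix σ).map (pt (𝟙 _ ≫ pullback.fst (overlapι σ τ) (overlapι σ ρ) ≫
      overlapι σ τ))).submatrix id ρ).det := by
    rw [pullback.condition]
    exact isUnit_pt σ ρ (𝟙 _ ≫ pullback.snd (overlapι σ τ) (overlapι σ ρ))
  rw [← cancel_mono (pullback.fst (overlapι σ τ) (overlapι σ ρ) ≫ overlapι σ τ)]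
  apply pt_injective
  simp only [Category.assoc, Category.id_comp] at h1 h2 h3 u1 u2 ⊢
  refine chartRing_hom_ext (h3.2.trans (h2.2.trans h1.2)) ?_
  rw [h3.1, h2.1, h1.1, normalize_normalize τ ρ _ u1, normalize_normalize ρ σ _ u2,
    normalize_of_eq_one]
  rw [Matrix.submatrix_map, chartMatrix_submatrix]; simp

lemma minor_self {k n : ℕ} (σ : Fin k ↪o Fin n) : minor σ σ = 1 := by
  rw [minor, chartMatrix_submatrix, Matrix.det_one]

instance {k n : ℕ} (σ : Fin k ↪o Fin n) : IsIso (overlapι σ σ) := by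
  have : IsUnit (minor σ σ) := by simp [minor_self]
  have h : Function.Bijective (algebraMap (ChartRing σ) (OverlapRing σ σ)) :=
    (IsLocalization.atUnit (ChartRing σ) (OverlapRing σ σ) (minor σ σ) this).bijective
  have : IsIso (CommRingCat.ofHom (algebraMap (ChartRing σ) (OverlapRing σ σ))) :=
    (ConcreteCategory.isIso_iff_bijective _).2 h
  infer_instance

lemma overlapT_self {k n : ℕ} (σ : Fin k ↪o Fin n) : overlapT σ σ = 𝟙 _ := by
  rw [← cancel_mono (overlapι σ σ)]
  apply pt_injective
  have := pt_overlapT σ σ (𝟙 _)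
  simp only [Category.id_comp] at this ⊢
  refine chartRing_hom_ext this.2 (this.1.trans (normalize_of_eq_one _ _ ?_))
  rw [Matrix.submatrix_map, chartMatrix_submatrix]; simp

/-- The gluing datum of the standard charts of the Grassmannian. -/
def grGlueData (k n : ℕ) : Scheme.GlueData.{0} where
  J := Fin k ↪o Fin n
  U := chart
  V p := overlap p.1 p.2
  f := overlapι
  t := overlapT
  t_id := overlapT_self
  t' := tripleT
  t_fac σ τ ρ := pullback.lift_snd _ _ _
  cocycle := tripleT_cocycle
  f_open _ _ := inferInstance


/-! ### Schemes over `ℂ`, vector bundles, sections, zero loci, blow-ups -/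

/-- Schemes over `ℂ`. -/
abbrev CScheme : Type 1 := Over (Spec (CommRingCat.of ℂ))

/-- Restriction of regular functions to a smaller open subset. -/
def res {X : Scheme.{0}} {V W : X.Opens} (h : V ≤ W) : Γ(X, W) →+* Γ(X, V) :=
  (X.presheaf.map (homOfLE h).op).hom

lemma res_res {X : Scheme.{0}} {U V W : X.Opens} (h : U ≤ V) (h' : V ≤ W) (a : Γ(X, W)) :
    res h (res h' a) = res (h.trans h') a := by
  change (X.presheaf.map (homOfLE h').op ≫ X.presheaf.map (homOfLE h).op).hom a = _
  rw [← Functor.map_comp]; rfl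

lemma res_comp {X : Scheme.{0}} {U V W : X.Opens} (h : U ≤ V) (h' : V ≤ W) :
    (res h).comp (res h') = res (X := X) (h.trans h') :=
  RingHom.ext (res_res h h')

lemma res_self {X : Scheme.{0}} {U : X.Opens} (a : Γ(X, U)) : res le_rfl a = a := by
  change (X.presheaf.map (𝟙 _)).hom a = a
  rw [X.presheaf.map_id]; rfl

lemma appLE_res {X Y : Scheme.{0}} (f : X ⟶ Y) {V V' : Y.Opens} {W W' : X.Opens} (hW : W ≤ W')
    (h : W' ≤ f ⁻¹ᵁ V) (h' : W ≤ f ⁻¹ᵁ V') (hV : V' ≤ V) :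
    (res hW).comp (f.appLE V W' h).hom = (f.appLE V' W h').hom.comp (res hV) := by
  change (f.appLE V W' h ≫ X.presheaf.map (homOfLE hW).op).hom =
    (Y.presheaf.map (homOfLE hV).op ≫ f.appLE V' W h').hom
  rw [Scheme.Hom.appLE_map, Scheme.Hom.map_appLE]

/-- An (algebraic) vector bundle on `X`, given by a trivializing open cover and transition
matrices. The bundle is trivial over `U i` with fibre the free module on `fib i`, and the
coordinates of a section in the trivializations `i` and `j` satisfy `s i = g i j * s j`. -/
structure VectorBundle (X : Scheme.{0}) where
  ι : Type
  U : ι → X.Opens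
  cover : ⨆ i, U i = ⊤
  fib : ι → Type
  [fintype : ∀ i, Fintype (fib i)]
  [decEq : ∀ i, DecidableEq (fib i)]
  g : ∀ i j, Matrix (fib i) (fib j) Γ(X, U i ⊓ U j)
  g_self : ∀ i, g i i = 1
  cocycle : ∀ (i j k : ι) (W : X.Opens) (hi : W ≤ U i) (hj : W ≤ U j) (hk : W ≤ U k),
    (g i j).map (res (le_inf hi hj)) * (g j k).map (res (le_inf hj hk)) =
      (g i k).map (res (le_inf hi hk))

attribute [instance] VectorBundle.fintype VectorBundle.decEq

namespace VectorBundle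

open scoped Matrix in
/-- The dual bundle: the transition matrices are the inverse transposes. -/
def dual {X : Scheme.{0}} (E : VectorBundle X) : VectorBundle X where
  ι := E.ι
  U := E.U
  cover := E.cover
  fib := E.fib
  g i j := ((E.g j i).map (res (le_inf inf_le_right inf_le_left)))ᵀ
  g_self i := by
    rw [E.g_self]
    simp
  cocycle i j k W hi hj hk := by
    have h := congr_arg Matrix.transpose (E.cocycle k j i W hk hj hi)
    rw [Matrix.transpose_mul] at h
    simpa only [Matrix.transpose_map, Matrix.map_map, ← RingHom.coe_comp, res_comp] using h

lemma kronecker_map {m n p q A B : Type} [CommRing A] [CommRing B] (f : A →+* B)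
    (M : Matrix m n A) (N : Matrix p q A) :
    (Matrix.kronecker M N).map f = Matrix.kronecker (M.map f) (N.map f) := by
  ext; simp [Matrix.kronecker]

/-- The tensor product of two vector bundles: the transition matrices are the Kronecker products. -/
def tensor {X : Scheme.{0}} (E F : VectorBundle X) : VectorBundle X where
  ι := E.ι × F.ι
  U p := E.U p.1 ⊓ F.U p.2
  cover := by
    rw [iSup_prod]
    simp only [← inf_iSup_eq, F.cover, inf_top_eq, E.cover]
  fib p := E.fib p.1 × F.fib p.2
  g p q := Matrix.kronecker
    ((E.g p.1 q.1).map (res (inf_le_inf inf_le_left inf_le_left)))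
    ((F.g p.2 q.2).map (res (inf_le_inf inf_le_right inf_le_right)))
  g_self p := by
    rw [E.g_self, F.g_self]
    simp
  cocycle p q r W hp hq hr := by
    simp only [kronecker_map, Matrix.map_map, ← RingHom.coe_comp, res_comp]
    exact (Matrix.mul_kronecker_mul _ _ _ _).symm.trans <| congr_arg₂ Matrix.kronecker
      (E.cocycle p.1 q.1 r.1 W (hp.trans inf_le_left) (hq.trans inf_le_left)
        (hr.trans inf_le_left))
      (F.cocycle p.2 q.2 r.2 W (hp.trans inf_le_right) (hq.trans inf_le_right)
        (hr.trans inf_le_right))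

/-- The pull-back of a vector bundle along a morphism. -/
def pullback {X Y : Scheme.{0}} (f : X ⟶ Y) (E : VectorBundle Y) : VectorBundle X where
  ι := E.ι
  U i := f ⁻¹ᵁ E.U i
  cover := by
    rw [← Scheme.Hom.preimage_iSup, E.cover]; rfl
  fib := E.fib
  g i j := (E.g i j).map
    (f.appLE (E.U i ⊓ E.U j) (f ⁻¹ᵁ E.U i ⊓ f ⁻¹ᵁ E.U j) f.preimage_inf.ge).hom
  g_self i := by
    rw [E.g_self]
    exact Matrix.map_one _ (map_zero _) (map_one _)
  cocycle i j k W hi hj hk := by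
    have h := E.cocycle i j k (E.U i ⊓ E.U j ⊓ E.U k) (inf_le_left.trans inf_le_left)
      (inf_le_left.trans inf_le_right) inf_le_right
    have hW : W ≤ f ⁻¹ᵁ (E.U i ⊓ E.U j ⊓ E.U k) := le_inf (le_inf hi hj) hk
    have key : ∀ (V : Y.Opens) (hV : E.U i ⊓ E.U j ⊓ E.U k ≤ V) (V' : X.Opens)
        (hV' : V' ≤ f ⁻¹ᵁ V) (hWV : W ≤ V'),
        (res hWV).comp (f.appLE V V' hV').hom = (f.appLE _ W hW).hom.comp (res hV) :=
      fun V hV V' hV' hWV => appLE_res f hWV hV' hW hV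
    have h2 := congr_arg
      (fun M : Matrix _ _ _ => M.map (f.appLE (E.U i ⊓ E.U j ⊓ E.U k) W hW).hom) h
    simp only [Matrix.map_mul, Matrix.map_map, ← RingHom.coe_comp] at h2 ⊢
    rw [key (E.U i ⊓ E.U j) inf_le_left, key (E.U j ⊓ E.U k) (inf_le_inf inf_le_right le_rfl),
      key (E.U i ⊓ E.U k) (inf_le_inf inf_le_left le_rfl)]
    exact h2

end VectorBundle

/-- The vector space structure on regular functions on a scheme over `ℂ`. -/
instance algebraSections (X : CScheme) (U : X.left.Opens) : Algebra ℂ Γ(X.left, U) :=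
  ((res le_top).comp (pt (R := ℂ) X.hom)).toAlgebra

/-- A family of coordinate vectors in the trivializations defines a global section of `E` if it
matches under the transition matrices. -/
def VectorBundle.IsSection {X : Scheme.{0}} (E : VectorBundle X)
    (s : ∀ i, E.fib i → Γ(X, E.U i)) : Prop :=
  ∀ i j, (fun a => res inf_le_left (s i a)) =
    (E.g i j).mulVec (fun b => res inf_le_right (s j b))

/-- The vector space `H⁰(X, E)` of global sections of a vector bundle on a scheme over `ℂ`. -/
def VectorBundle.H0 {X : CScheme} (E : VectorBundle X.left) :
    Submodule ℂ (∀ i, E.fib i → Γ(X.left, E.U i)) where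
  carrier := {s | E.IsSection s}
  zero_mem' i j := by ext a; simp [Matrix.mulVec, dotProduct]
  add_mem' {s t} hs ht i j := by
    have := congr_arg₂ (· + ·) (hs i j) (ht i j)
    simp only [← Matrix.mulVec_add] at this
    simpa only [Pi.add_apply, map_add] using! this
  smul_mem' c s hs i j := by
    have h : ∀ {V W : X.left.Opens} (h : V ≤ W) (a : Γ(X.left, W)), res h (c • a) = c • res h a := by
      intro V W h a
      rw [Algebra.smul_def, Algebra.smul_def, map_mul]
      congr 1
      exact res_res _ _ _
    have := congr_arg (c • ·) (hs i j)
    simp only [← Matrix.mulVec_smul] at this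
    simpa only [Pi.smul_apply, h] using! this

/-- On an open subset `W` of the trivializing open subset `U i`, the ideal generated by the
coordinates of `s`. -/
def VectorBundle.coordIdeal {X : Scheme.{0}} (E : VectorBundle X)
    (s : ∀ i, E.fib i → Γ(X, E.U i)) (i : E.ι) (W : X.Opens) (h : W ≤ E.U i) : Ideal Γ(X, W) :=
  Ideal.span (Set.range fun a => res h (s i a))

lemma VectorBundle.coordIdeal_map {X : Scheme.{0}} (E : VectorBundle X)
    (s : ∀ i, E.fib i → Γ(X, E.U i)) (i : E.ι) {V W : X.Opens} (hV : V ≤ W) (h : W ≤ E.U i) :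
    (E.coordIdeal s i W h).map (res hV) = E.coordIdeal s i V (hV.trans h) := by
  rw [coordIdeal, Ideal.map_span, ← Set.range_comp, coordIdeal]
  simp only [Function.comp_def, res_res]

lemma VectorBundle.coordIdeal_le {X : Scheme.{0}} (E : VectorBundle X)
    {s : ∀ i, E.fib i → Γ(X, E.U i)} (hs : E.IsSection s) (i j : E.ι) {W : X.Opens}
    (hi : W ≤ E.U i) (hj : W ≤ E.U j) : E.coordIdeal s i W hi ≤ E.coordIdeal s j W hj := by
  rw [coordIdeal, Ideal.span_le]
  rintro _ ⟨a, rfl⟩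
  have h := congr_arg (res (le_inf hi hj)) (congr_fun (hs i j) a)
  simp only [Matrix.mulVec, dotProduct, map_sum, map_mul, res_res] at h
  change res hi (s i a) ∈ _
  rw [h]
  exact Ideal.sum_mem _ fun b _ => Ideal.mul_mem_left _ _ (Ideal.subset_span ⟨b, rfl⟩)

/-- Membership in an ideal of functions on an affine open subset is local. -/
lemma exists_pow_mul_mem {X : Scheme.{0}} {W : X.Opens} (hW : IsAffineOpen W) (J : Ideal Γ(X, W))
    (g a : Γ(X, W)) (h : res (X.basicOpen_le g) a ∈ J.map (res (X.basicOpen_le g))) :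
    ∃ N : ℕ, g ^ N * a ∈ J := by
  have := hW.isLocalization_basicOpen g
  obtain ⟨m, ⟨N, rfl⟩, hm⟩ :=
    (IsLocalization.algebraMap_mem_map_algebraMap_iff (.powers g) Γ(X, X.basicOpen g) J a).1 h
  exact ⟨N, hm⟩

lemma mem_of_local {X : Scheme.{0}} {W : X.Opens} (hW : IsAffineOpen W) (J : Ideal Γ(X, W))
    (a : Γ(X, W)) (h : ∀ x ∈ W, ∃ g : Γ(X, W), x ∈ X.basicOpen g ∧
      res (X.basicOpen_le g) a ∈ J.map (res (X.basicOpen_le g))) : a ∈ J := by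
  let S : Set Γ(X, W) := {g | ∃ N : ℕ, g ^ N * a ∈ J}
  have hS : Ideal.span S = ⊤ := by
    rw [← hW.iSup_basicOpen_eq_self_iff]
    refine le_antisymm (iSup_le fun g => X.basicOpen_le _) fun x hx => ?_
    obtain ⟨g, hg, hg'⟩ := h x hx
    exact TopologicalSpace.Opens.mem_iSup.2 ⟨⟨g, exists_pow_mul_mem hW J g a hg'⟩, hg⟩
  refine Submodule.mem_of_span_eq_top_of_smul_pow_mem J S hS a ?_
  rintro ⟨g, N, hN⟩
  exact ⟨N, hN⟩

/-- The ideal, in the functions on an affine open subset `W`, of the zero locus of the section `s`: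
the functions which on every affine open subset inside some trivializing `U i` lie in the ideal
generated by the coordinates of `s`. -/
def VectorBundle.zeroIdealAt {X : Scheme.{0}} (E : VectorBundle X)
    (s : ∀ i, E.fib i → Γ(X, E.U i)) (W : X.Opens) : Ideal Γ(X, W) :=
  ⨅ (i : E.ι) (V : X.affineOpens) (hV : V.1 ≤ W) (hi : V.1 ≤ E.U i),
    (E.coordIdeal s i V.1 hi).comap (res hV)

lemma VectorBundle.mem_zeroIdealAt {X : Scheme.{0}} (E : VectorBundle X)
    (s : ∀ i, E.fib i → Γ(X, E.U i)) (W : X.Opens) (a : Γ(X, W)) :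
    a ∈ E.zeroIdealAt s W ↔ ∀ (i : E.ι) (V : X.affineOpens) (hV : V.1 ≤ W) (hi : V.1 ≤ E.U i),
      res hV a ∈ E.coordIdeal s i V.1 hi := by
  simp [zeroIdealAt]

lemma VectorBundle.mem_zeroIdealAt_of_cover {X : Scheme.{0}} (E : VectorBundle X)
    {s : ∀ i, E.fib i → Γ(X, E.U i)} (hs : E.IsSection s) (W : X.Opens) (a : Γ(X, W))
    (h : ∀ x ∈ W, ∃ (i : E.ι) (V : X.Opens) (hV : V ≤ W) (hi : V ≤ E.U i), x ∈ V ∧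
      res hV a ∈ E.coordIdeal s i V hi) : a ∈ E.zeroIdealAt s W := by
  rw [mem_zeroIdealAt]
  intro i V hV hi
  refine mem_of_local V.2 _ _ fun x hx => ?_
  obtain ⟨j, V', hV', hj, hx', ha⟩ := h x (hV hx)
  obtain ⟨g, hg, hxg⟩ := V.2.exists_basicOpen_le ⟨x, hx'⟩ hx
  refine ⟨g, hxg, ?_⟩
  rw [coordIdeal_map, res_res]
  refine E.coordIdeal_le hs j i (hg.trans hj) _ ?_
  rw [← E.coordIdeal_map s j hg hj]
  have := Ideal.mem_map_of_mem (res hg) ha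
  rwa [res_res] at this

/-- The ideal sheaf of the zero locus of a section of a vector bundle. -/
def VectorBundle.zeroIdeal {X : Scheme.{0}} (E : VectorBundle X)
    {s : ∀ i, E.fib i → Γ(X, E.U i)} (hs : E.IsSection s) : X.IdealSheafData where
  ideal W := E.zeroIdealAt s W.1
  map_ideal_basicOpen W g := by
    have hle : X.basicOpen g ≤ W.1 := X.basicOpen_le g
    change (E.zeroIdealAt s W.1).map (res hle) = E.zeroIdealAt s (X.basicOpen g)
    apply le_antisymm
    · rw [Ideal.map_le_iff_le_comap]
      intro a ha
      rw [mem_zeroIdealAt] at ha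
      rw [Ideal.mem_comap, mem_zeroIdealAt]
      intro i V hV hi
      rw [res_res]
      exact ha i V _ hi
    · intro b hb
      have hloc := W.2.isLocalization_basicOpen g
      obtain ⟨a, ⟨_, n, rfl⟩, rfl⟩ := IsLocalization.exists_mk'_eq (.powers g) b
      refine (IsLocalization.mk'_mem_map_algebraMap_iff (.powers g) _ _ _ _).mpr ?_
      have ha : res hle a ∈ E.zeroIdealAt s (X.basicOpen g) := by
        have := Ideal.mul_mem_left _ (algebraMap Γ(X, W.1) Γ(X, X.basicOpen g) (g ^ n)) hb
        rwa [IsLocalization.mk'_spec' (M := .powers g) _ a ⟨_, n, rfl⟩] at this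
      have hex : ∀ x : W.1, ∃ (i : E.ι) (h : Γ(X, W.1)) (hi : X.basicOpen h ≤ E.U i) (N : ℕ),
          x.1 ∈ X.basicOpen h ∧
          res (X.basicOpen_le h) (g ^ N * a) ∈ E.coordIdeal s i (X.basicOpen h) hi := by
        rintro ⟨x, hx⟩
        have hxt : x ∈ ⨆ i, E.U i := by rw [E.cover]; trivial
        obtain ⟨i, hxi⟩ := TopologicalSpace.Opens.mem_iSup.1 hxt
        obtain ⟨h, hh, hxh⟩ := W.2.exists_basicOpen_le ⟨x, hxi⟩ hx
        have hV := W.2.basicOpen h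
        set g' := res (X.basicOpen_le h) g with hg'
        have hle' : X.basicOpen g' ≤ X.basicOpen g := by
          rw [hg']
          exact (X.basicOpen_res g (homOfLE (X.basicOpen_le h)).op).le.trans inf_le_right
        obtain ⟨N, hN⟩ := exists_pow_mul_mem hV (E.coordIdeal s i (X.basicOpen h) hh) g'
          (res (X.basicOpen_le h) a) (by
            rw [coordIdeal_map, res_res]
            have := (E.mem_zeroIdealAt s _ _).1 ha i ⟨X.basicOpen g', hV.basicOpen g'⟩ hle'
              ((X.basicOpen_le g').trans hh)
            rwa [res_res] at this)
        exact ⟨i, h, hh, N, hxh, by rwa [map_mul, map_pow]⟩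
      choose i h hi N hx hmem using hex
      obtain ⟨t, ht⟩ := W.2.isCompact.elim_finite_subcover
        (fun x : W.1 => (X.basicOpen (h x) : Set X)) (fun x => (X.basicOpen (h x)).2)
        (fun x hxW => Set.mem_iUnion.2 ⟨⟨x, hxW⟩, hx ⟨x, hxW⟩⟩)
      refine ⟨g ^ t.sup N, ⟨_, rfl⟩, ?_⟩
      refine E.mem_zeroIdealAt_of_cover hs _ _ fun x hxW => ?_
      obtain ⟨y, hyt, hxy⟩ := Set.mem_iUnion₂.1 (ht hxW)
      refine ⟨i y, X.basicOpen (h y), X.basicOpen_le _, hi y, hxy, ?_⟩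
      have hNy : N y ≤ t.sup N := Finset.le_sup hyt
      obtain ⟨c, hc⟩ := Nat.exists_eq_add_of_le hNy
      have := Ideal.mul_mem_left _ (res (X.basicOpen_le (h y)) (g ^ c)) (hmem y)
      rw [← map_mul, ← mul_assoc, ← pow_add, add_comm c, ← hc] at this
      exact this

/-- Zariski open subsets of a complex vector space: the subsets of the form `{v | f v ≠ 0 for some f in S}`, for a set `S` of polynomial functions. Polynomial functions are the elements of the
algebra of functions generated by the linear forms. -/
def IsZariskiOpen {V : Type} [AddCommGroup V] [Module ℂ V] (D : Set V) : Prop :=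
  ∃ S : Set (V → ℂ),
    S ⊆ Algebra.adjoin ℂ (Set.range fun (l : Module.Dual ℂ V) (v : V) => l v) ∧
    D = {v | ∃ f ∈ S, f v ≠ 0}

/-- The closed subscheme with ideal sheaf `I` is an effective Cartier divisor: locally, `I` is
generated by one nonzerodivisor. -/
def IsEffectiveCartier {X : Scheme.{0}} (I : X.IdealSheafData) : Prop :=
  ∀ x : X, ∃ W : X.affineOpens, x ∈ W.1 ∧
    ∃ f ∈ nonZeroDivisors Γ(X, W.1), I.ideal W = Ideal.span {f}

/-- `π : Y ⟶ X` is the blow-up of `X` along the closed subscheme with ideal sheaf `I`: the inverse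
image of the centre is an effective Cartier divisor, and `π` is universal with this property. -/
structure IsBlowup {X Y : Scheme.{0}} (π : Y ⟶ X) (I : X.IdealSheafData) : Prop where
  isEffectiveCartier : IsEffectiveCartier (I.comap π)
  existsUnique_lift : ∀ (T : Scheme.{0}) (f : T ⟶ X), IsEffectiveCartier (I.comap f) →
    ∃! h : T ⟶ Y, h ≫ π = f

/-! ### The Grassmannian and its tautological bundles -/

lemma isOpenImmersion_grι (k n : ℕ) (σ : Fin k ↪o Fin n) :
    IsOpenImmersion ((grGlueData k n).ι σ) := (grGlueData k n).ι_isOpenImmersion σ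

lemma overlap_C {k n : ℕ} (σ τ : Fin k ↪o Fin n) :
    overlapι σ τ ≫ Spec.map (CommRingCat.ofHom (MvPolynomial.C : ℂ →+* ChartRing σ)) =
      (overlapT σ τ ≫ overlapι τ σ) ≫
        Spec.map (CommRingCat.ofHom (MvPolynomial.C : ℂ →+* ChartRing τ)) := by
  apply pt_injective
  have := (pt_overlapT σ τ (𝟙 _)).2
  rw [pt_comp_map, pt_comp_map]
  simpa only [Category.id_comp] using this.symm

/-- The Grassmannian `Gr(k, n)` of `k`-dimensional subspaces of `ℂⁿ`, as a scheme over `ℂ`: the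
gluing of the standard affine charts, in which a subspace is the row space of a `k × n` matrix with
the identity matrix in the columns `σ`. -/
def Gr (k n : ℕ) : CScheme :=
  Over.mk (Y := (grGlueData k n).glued)
    (Multicoequalizer.desc (grGlueData k n).diagram _
      (fun σ : Fin k ↪o Fin n =>
        Spec.map (CommRingCat.ofHom (MvPolynomial.C : ℂ →+* ChartRing σ)))
      (fun p => overlap_C p.1 p.2))

/-- The inclusion of the standard chart into the Grassmannian. -/
def grι {k n : ℕ} (σ : Fin k ↪o Fin n) : chart σ ⟶ (Gr k n).left := (grGlueData k n).ι σ

instance {k n : ℕ} (σ : Fin k ↪o Fin n) : IsOpenImmersion (grι σ) := isOpenImmersion_grι k n σ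

lemma grι_glue {k n : ℕ} (σ τ : Fin k ↪o Fin n) :
    (overlapT σ τ ≫ overlapι τ σ) ≫ grι τ = overlapι σ τ ≫ grι σ := by
  rw [Category.assoc]
  exact (grGlueData k n).glue_condition σ τ

/-- The standard chart as an open subset of the Grassmannian. -/
abbrev grOpen {k n : ℕ} (σ : Fin k ↪o Fin n) : (Gr k n).left.Opens := grι σ ''ᵁ ⊤

lemma iSup_grOpen (k n : ℕ) : ⨆ σ : Fin k ↪o Fin n, grOpen σ = ⊤ := by
  refine top_le_iff.1 fun x _ => ?_
  obtain ⟨σ, y, hy⟩ := (grGlueData k n).ι_jointly_surjective x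
  exact TopologicalSpace.Opens.mem_iSup.2 ⟨σ, y, trivial, hy⟩

/-- Coordinate functions of a chart as functions on an open subset of the Grassmannian. -/
def grSec {k n : ℕ} (σ : Fin k ↪o Fin n) : ChartRing σ →+* Γ((Gr k n).left, grOpen σ) :=
  ((Scheme.ΓSpecIso (.of (ChartRing σ))).inv ≫ ((grι σ).appIso ⊤).inv).hom

/-- The universal `k × n` matrix on a chart of the Grassmannian: its rows form the standard basis
of the tautological subspace. -/
def grMatrix {k n : ℕ} (σ : Fin k ↪o Fin n) :
    Matrix (Fin k) (Fin n) Γ((Gr k n).left, grOpen σ) :=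
  (chartMatrix σ).map (grSec σ)

lemma grMatrix_submatrix {k n : ℕ} (σ : Fin k ↪o Fin n) : (grMatrix σ).submatrix id σ = 1 := by
  rw [grMatrix, Matrix.submatrix_map, chartMatrix_submatrix]; simp

lemma le_preimage_grOpen {k n : ℕ} (σ : Fin k ↪o Fin n) {T : Scheme.{0}} (w : T ⟶ chart σ) :
    ⊤ ≤ (w ≫ grι σ) ⁻¹ᵁ grOpen σ :=
  fun x _ => ⟨w x, trivial, rfl⟩

lemma appLE_grSec {k n : ℕ} (σ : Fin k ↪o Fin n) {T : Scheme.{0}} (w : T ⟶ chart σ) 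
    {v : T ⟶ (Gr k n).left} (hv : w ≫ grι σ = v) (h : ⊤ ≤ v ⁻¹ᵁ grOpen σ) :
    (v.appLE (grOpen σ) ⊤ h).hom.comp (grSec σ) = pt w := by
  subst hv
  have h2 : (w ≫ grι σ).appLE (grOpen σ) ⊤ h =
      (grι σ).appLE (grι σ ''ᵁ ⊤) ⊤ ((grι σ).preimage_image_eq ⊤).ge ≫
        w.appLE ⊤ ⊤ (w.preimage_top).ge :=
    (Scheme.Hom.appLE_comp_appLE _ _ _ _ _ _ _).symm
  have h3 : w.appLE ⊤ ⊤ (w.preimage_top).ge = w.appTop := Scheme.Hom.appLE_eq_app _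
  have h1 : ((grι σ).appIso ⊤).inv ≫ (w ≫ grι σ).appLE (grOpen σ) ⊤ h = w.appTop := by
    rw [h2, ← Scheme.Hom.appIso_hom', Iso.inv_hom_id_assoc, h3]
  have : ((Scheme.ΓSpecIso (.of (ChartRing σ))).inv ≫ ((grι σ).appIso ⊤).inv) ≫
      (w ≫ grι σ).appLE (grOpen σ) ⊤ h = (Scheme.ΓSpecIso (.of (ChartRing σ))).inv ≫ w.appTop := by
    rw [Category.assoc, h1]
  exact congr($(this).hom)

lemma grOpen_inf_le {k n : ℕ} (σ τ : Fin k ↪o Fin n) :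
    grOpen σ ⊓ grOpen τ ≤ (overlapι σ τ ≫ grι σ).opensRange := by
  rintro x ⟨⟨y, -, hy⟩, ⟨z, -, hz⟩⟩
  obtain ⟨w, hw⟩ := ((grGlueData k n).ι_eq_iff σ τ y z).1 (hy.trans hz.symm)
  exact ⟨w, (congr_arg (grι σ) hw.1).trans hy⟩

/-- On the overlap of two charts the universal matrices have the same row space. -/
lemma grMatrix_rel {k n : ℕ} (σ τ : Fin k ↪o Fin n) (W : (Gr k n).left.Opens)
    (hσ : W ≤ grOpen σ) (hτ : W ≤ grOpen τ) :
    (grMatrix σ).map (res hσ) =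
      ((grMatrix σ).map (res hσ)).submatrix id τ * (grMatrix τ).map (res hτ) := by
  set j := overlapι σ τ ≫ grι σ with hj
  have hj' : (overlapT σ τ ≫ overlapι τ σ) ≫ grι τ = j := grι_glue σ τ
  have h1 : ⊤ ≤ j ⁻¹ᵁ grOpen σ := le_preimage_grOpen σ _
  have h2 : ⊤ ≤ j ⁻¹ᵁ grOpen τ := by rw [← hj']; exact le_preimage_grOpen τ _
  have h3 : ⊤ ≤ j ⁻¹ᵁ (grOpen σ ⊓ grOpen τ) := le_inf h1 h2
  have hiso : IsIso (j.appLE (grOpen σ ⊓ grOpen τ) ⊤ h3) := by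
    have : IsIso (j.app (grOpen σ ⊓ grOpen τ)) := j.isIso_app _ (grOpen_inf_le σ τ)
    rw [Scheme.Hom.appLE]
    have : IsIso ((overlap σ τ).presheaf.map (homOfLE h3).op) := by
      have : IsIso (homOfLE h3) := ⟨homOfLE le_top, rfl, rfl⟩
      infer_instance
    infer_instance
  have hinj : Function.Injective (j.appLE (grOpen σ ⊓ grOpen τ) ⊤ h3).hom :=
    ((ConcreteCategory.isIso_iff_bijective _).1 hiso).1
  have e1 : (j.appLE (grOpen σ ⊓ grOpen τ) ⊤ h3).hom.comp (res inf_le_left) =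
      (j.appLE (grOpen σ) ⊤ h1).hom := by
    have := appLE_res j (le_refl ⊤) h1 h3 inf_le_left
    rw [← this]
    exact RingHom.ext fun a => (res_self (X := overlap σ τ) _).symm
  have e2 : (j.appLE (grOpen σ ⊓ grOpen τ) ⊤ h3).hom.comp (res inf_le_right) =
      (j.appLE (grOpen τ) ⊤ h2).hom := by
    have := appLE_res j (le_refl ⊤) h2 h3 inf_le_right
    rw [← this]
    exact RingHom.ext fun a => (res_self (X := overlap σ τ) _).symm
  have l1 : grOpen σ ⊓ grOpen τ ≤ grOpen σ := inf_le_left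
  have l2 : grOpen σ ⊓ grOpen τ ≤ grOpen τ := inf_le_right
  have main : (grMatrix σ).map (res l1) =
      ((grMatrix σ).map (res l1)).submatrix id τ * (grMatrix τ).map (res l2) := by
    refine Matrix.map_injective hinj ?_
    beta_reduce
    have c1 := appLE_grSec σ (overlapι σ τ) rfl h1
    have c2 := appLE_grSec τ (overlapT σ τ ≫ overlapι τ σ) hj' h2
    have p := (pt_overlapT σ τ (𝟙 _)).1
    have u := isUnit_pt σ τ (𝟙 _)
    simp only [Category.id_comp] at p u
    rw [Matrix.map_mul, ← Matrix.submatrix_map]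
    simp only [grMatrix, Matrix.map_map, ← RingHom.coe_comp]
    rw [← RingHom.comp_assoc, ← RingHom.comp_assoc, e1, e2, c1, c2, p, normalize,
      ← Matrix.mul_assoc, Matrix.mul_nonsing_inv _ u, Matrix.one_mul]
  have := congr_arg (fun M : Matrix _ _ _ => M.map (res (le_inf hσ hτ))) main
  simp only [Matrix.map_mul, ← Matrix.submatrix_map, Matrix.map_map, ← RingHom.coe_comp,
    res_comp] at this
  exact this

/-- The tautological subbundle `𝒰` of rank `k`, with fibre the subspace itself. Over the chart `σ`
it has as basis the rows of the universal matrix, so the coordinates of a vector `u` in the subspace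
are its entries `u (σ i)`. -/
def tautSub (k n : ℕ) : VectorBundle (Gr k n).left where
  ι := Fin k ↪o Fin n
  U := grOpen
  cover := iSup_grOpen k n
  fib _ := Fin k
  g σ τ := Matrix.transpose (((grMatrix τ).submatrix id σ).map (res inf_le_right))
  g_self σ := by
    rw [grMatrix_submatrix]; simp
  cocycle σ τ ρ W hσ hτ hρ := by
    have h := grMatrix_rel ρ τ W hρ hτ
    have h' := congr_arg (fun M : Matrix _ _ _ => Matrix.transpose (M.submatrix id σ)) h
    simp only [submatrix_mul', Matrix.transpose_mul] at h'
    simp only [Matrix.transpose_map, Matrix.map_map, ← RingHom.coe_comp, res_comp]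
    exact h'.symm

open Classical in
/-- The tautological quotient bundle `𝒬 = 𝒪ⁿ / 𝒰` of rank `n - k`. Over the chart `σ` it has as basis
the classes of the standard basis vectors `e j` with `j` not in the range of `σ`; the class of a row
vector `w` has coordinates `(w * projMatrix σ (grMatrix σ)) j`. -/
def tautQuot (k n : ℕ) : VectorBundle (Gr k n).left where
  ι := Fin k ↪o Fin n
  U := grOpen
  cover := iSup_grOpen k n
  fib σ := {j : Fin n // j ∉ Set.range σ}
  g σ τ := Matrix.transpose (((projMatrix σ (grMatrix σ)).submatrix Subtype.val Subtype.val).map (res inf_le_left))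
  g_self σ := by
    ext l j
    simp only [Matrix.transpose_apply, Matrix.map_apply, Matrix.submatrix_apply]
    rw [projMatrix_apply_of_notMem _ _ _ _ j.2]
    by_cases h : l = j
    · subst h; simp
    · have h' : j.1 ≠ l.1 := fun e => h (Subtype.ext e.symm)
      simp [h, h']
  cocycle σ τ ρ W hσ hτ hρ := by
    have hM : ∀ (α : Fin k ↪o Fin n) (hα : W ≤ grOpen α),
        ((grMatrix α).map (res hα)).submatrix id α = 1 := by
      intro α hα
      rw [Matrix.submatrix_map, grMatrix_submatrix]; simp
    have h := congr_arg Matrix.transpose (projMatrix_block σ τ ρ ((grMatrix σ).map (res hσ))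
      ((grMatrix τ).map (res hτ)) (hM σ hσ) (hM τ hτ) (grMatrix_rel τ σ W hτ hσ))
    rw [Matrix.transpose_mul] at h
    simp only [← map_projMatrix, Matrix.submatrix_map] at h
    simp only [Matrix.transpose_map, Matrix.map_map, ← RingHom.coe_comp, res_comp]
    exact h

/-! ### Products and zero loci over `ℂ` -/

/-- The product of two schemes over `ℂ`. -/
def prodC (X Y : CScheme) : CScheme := Over.mk (pullback.fst X.hom Y.hom ≫ X.hom)

/-- The first projection. -/
def fstC (X Y : CScheme) : prodC X Y ⟶ X := Over.homMk (pullback.fst X.hom Y.hom) rfl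

/-- The second projection. -/
def sndC (X Y : CScheme) : prodC X Y ⟶ Y :=
  Over.homMk (pullback.snd X.hom Y.hom) pullback.condition.symm

/-- The external tensor product `E ⊠ F` on `X × Y`. -/
def VectorBundle.box {X Y : CScheme} (E : VectorBundle X.left) (F : VectorBundle Y.left) :
    VectorBundle (prodC X Y).left :=
  (E.pullback (fstC X Y).left).tensor (F.pullback (sndC X Y).left)

/-- The zero locus of a global section, as a closed subscheme. -/
def VectorBundle.zeroLocus {X : CScheme} (E : VectorBundle X.left) (s : E.H0) : CScheme :=
  Over.mk ((E.zeroIdeal s.2).subschemeι ≫ X.hom)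

/-- The inclusion of the zero locus. -/
def VectorBundle.zeroLocusι {X : CScheme} (E : VectorBundle X.left) (s : E.H0) :
    E.zeroLocus s ⟶ X :=
  Over.homMk (E.zeroIdeal s.2).subschemeι rfl

/-- The bundle `𝒬 ⊠ 𝒰^∨` on `Gr(k, m) × Gr(k, n)`. -/
def quotBoxSubDual (k m n : ℕ) : VectorBundle (prodC (Gr k m) (Gr k n)).left :=
  (tautQuot k m).box (tautSub k n).dual

end GrBlow

end

open CategoryTheory CategoryTheory.Limits AlgebraicGeometry

noncomputable section

namespace GrBlow

/-! ### Local arguments on schemes -/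

/-! Subspaces are row spaces of matrices of full rank, and linear maps act on row vectors from the
right. A vector `v` of `ℂⁿ` gives a section of `𝒬`, the class of `v` modulo the subspace, which
vanishes on the subspaces containing `v`. A matrix `φ : ℂⁿ → ℂⁿ⁻¹` gives a section of `𝒬 ⊠ 𝒰^∨`,
which vanishes on the pairs `(V₁, V₂)` with `φ(V₂) ⊆ V₁`. Both descriptions are proved for
`T`-valued points, so they determine the zero loci as schemes (`zeroIdeal_quotSection_le_ker_iff`,
`zeroIdeal_boxSection_le_ker_iff`). For `v ≠ 0` a linear automorphism moves `v` to the first basis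
vector `e₀`, and the subspaces containing `e₀` are the `ℂ ⊕ V` with `V` in the smaller Grassmannian.

If `φ` has full rank, its kernel is a line, and an automorphism turns `φ` into the map forgetting
the first coordinate, with kernel spanned by `e₀`. Away from the subspaces containing `e₀`, the
space `V₁ = φ(V₂)` is forced. Over them the universal property of the blow-up is checked by hand. On
a chart meeting the centre the normalized matrix of `V₂` has first row `(1, r)`, and the entries of
`r` generate the ideal of the centre. If a morphism pulls this ideal back to one generated by a
nonzerodivisor `d`, then `r = d u` with `u` unimodular, and replacing `r` by `u` in `φ(V₂)` gives
the only possible `V₁` (`exists_saturation`, `eq_of_incid_of_saturation`). So lifts exist and are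
unique. Conversely, near the centre the incidence variety is covered by affine spaces over charts of
the first Grassmannian, on which the ideal of the centre is generated by a coordinate function
(`IsIncidenceVariety.exists_chart`); hence the inverse image of the centre is Cartier.

To speak of general sections one needs that vectors and matrices give all sections
(`quotSection_surjective`, `boxSection_surjective`). Along a line `M + t u ⊗ w` in a chart,
comparison with a chart at infinity gives `P(t) = t Q(t⁻¹)` for polynomials `P`, `Q`. So the
coordinates of a section are affine in `t`, with slope in a prescribed direction, and a function on
matrices with this property in all rank one directions has the shape `c j + ∑ l a * x a j`. For the
tensor product one factor is fixed at a time. Then `B` consists of the nonzero sections of `𝒬` and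
`A` of the sections given by matrices of full rank. If `k = n - 1`, the bundle `𝒬` on the first
factor is zero and `A` is everything. -/

lemma hom_ext_of_local {X Y : Scheme.{0}} (f g : X ⟶ Y)
    (h : ∀ x : X, ∃ (S : Scheme.{0}) (j : S ⟶ X), IsOpenImmersion j ∧ x ∈ Set.range j ∧
      j ≫ f = j ≫ g) : f = g := by
  refine Scheme.hom_ext_of_forall f g fun x => ?_
  obtain ⟨S, j, hj, hx, e⟩ := h x
  refine ⟨j.opensRange, hx, ?_⟩
  rw [← cancel_epi j.isoOpensRange.hom]
  simpa using e

/-- Gluing of locally given, locally unique morphisms. -/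
lemma exists_glue {X Y : Scheme.{0}} (P : ∀ S : Scheme.{0}, (S ⟶ X) → (S ⟶ Y) → Prop)
    (hcomp : ∀ (S S' : Scheme.{0}) (w : S' ⟶ S) (j : S ⟶ X) (f : S ⟶ Y), IsOpenImmersion w →
      P S j f → P S' (w ≫ j) (w ≫ f))
    (huniq : ∀ (S : Scheme.{0}) (j : S ⟶ X) (f f' : S ⟶ Y), IsOpenImmersion j →
      P S j f → P S j f' → f = f')
    (hex : ∀ x : X, ∃ (S : Scheme.{0}) (j : S ⟶ X) (f : S ⟶ Y), IsOpenImmersion j ∧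
      x ∈ Set.range j ∧ P S j f) :
    ∃ f : X ⟶ Y, ∀ x : X, ∃ (S : Scheme.{0}) (j : S ⟶ X), IsOpenImmersion j ∧
      x ∈ Set.range j ∧ P S j (j ≫ f) := by
  choose S j f hj hx hP using hex
  let 𝒰 : X.OpenCover := {
    I₀ := X, X := S, f := j,
    mem₀ := by
      rw [Scheme.presieve₀_mem_precoverage_iff]
      exact ⟨fun x => ⟨x, hx x⟩, hj⟩ }
  have hc : ∀ x y, pullback.fst (𝒰.f x) (𝒰.f y) ≫ f x = pullback.snd _ _ ≫ f y := by
    intro x y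
    have : IsOpenImmersion (j x) := hj x
    have : IsOpenImmersion (j y) := hj y
    refine huniq _ (pullback.fst (j x) (j y) ≫ j x) _ _ inferInstance ?_ ?_
    · exact hcomp _ _ _ _ _ inferInstance (hP x)
    · rw [pullback.condition]
      exact hcomp _ _ _ _ _ inferInstance (hP y)
  refine ⟨𝒰.glueMorphisms f hc, fun x => ⟨S x, j x, hj x, hx x, ?_⟩⟩
  have : j x ≫ 𝒰.glueMorphisms f hc = f x := 𝒰.ι_glueMorphisms f hc x
  rw [this]
  exact hP x

lemma res_eq_zero_of_local {X : Scheme.{0}} {V : X.Opens} (a : Γ(X, V))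
    (h : ∀ x ∈ V, ∃ (W : X.Opens) (hW : W ≤ V), x ∈ W ∧ res hW a = 0) : a = 0 := by
  choose! W hW hx ha using h
  refine X.sheaf.eq_of_locally_eq' (fun x : V => W x) V (fun x => homOfLE (hW x x.2))
    (fun x hxV => TopologicalSpace.Opens.mem_iSup.2 ⟨⟨x, hxV⟩, hx x hxV⟩) _ _ fun x => ?_
  exact (ha x x.2).trans (map_zero (res (hW x x.2))).symm

lemma eq_zero_of_local {X : Scheme.{0}} (a : Γ(X, ⊤))
    (h : ∀ x : X, ∃ (S : Scheme.{0}) (j : S ⟶ X), IsOpenImmersion j ∧ x ∈ Set.range j ∧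
      j.appTop.hom a = 0) : a = 0 := by
  refine res_eq_zero_of_local a fun x _ => ?_
  obtain ⟨S, j, hj, hx, e⟩ := h x
  refine ⟨j.opensRange, le_top, hx, ?_⟩
  have h1 : ⊤ ≤ j ⁻¹ᵁ j.opensRange := fun y _ => ⟨y, rfl⟩
  have hiso : IsIso (j.app j.opensRange) := j.isIso_app _ le_rfl
  have hinj : Function.Injective (j.app j.opensRange).hom :=
    ((ConcreteCategory.isIso_iff_bijective _).1 hiso).1
  apply hinj
  have h2 : (j.app j.opensRange).hom (res le_top a) =
      res (X := S) le_top (j.appTop.hom a) := by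
    have := j.naturality (homOfLE (le_top : j.opensRange ≤ ⊤)).op
    exact congr($(this).hom a)
  rw [h2, e, map_zero, map_zero]

/-- A matrix version of `eq_zero_of_local`. -/
lemma matrix_eq_zero_of_local {X : Scheme.{0}} {m n : Type} (M : Matrix m n Γ(X, ⊤))
    (h : ∀ x : X, ∃ (S : Scheme.{0}) (j : S ⟶ X), IsOpenImmersion j ∧ x ∈ Set.range j ∧
      M.map j.appTop.hom = 0) : M = 0 := by
  ext a b
  refine eq_zero_of_local _ fun x => ?_
  obtain ⟨S, j, hj, hx, e⟩ := h x
  exact ⟨S, j, hj, hx, congr_fun (congr_fun e a) b⟩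

/-- Every open neighbourhood of a point contains an affine one. -/
lemma exists_affine_nhd {X : Scheme.{0}} (x : X) (U : X.Opens) (hx : x ∈ U) :
    ∃ (S : Scheme.{0}) (j : S ⟶ X), IsOpenImmersion j ∧ IsAffine S ∧ x ∈ Set.range j ∧
      Set.range j ⊆ U := by
  obtain ⟨W, hW, hxW, hWU⟩ := exists_isAffineOpen_mem_and_subset hx
  exact ⟨W, W.ι, inferInstance, hW, by simpa using hxW, by simpa using hWU⟩

lemma isUnit_appTop_of_le_basicOpen {X S : Scheme.{0}} (j : S ⟶ X)
    (a : Γ(X, ⊤)) (h : Set.range j ⊆ X.basicOpen a) : IsUnit (j.appTop.hom a) := by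
  have h1 : S.basicOpen (j.appTop.hom a) = ⊤ := by
    have := j.preimage_basicOpen a
    refine top_le_iff.1 fun x _ => ?_
    change x ∈ S.basicOpen (j.app ⊤ a)
    rw [← this]
    exact h ⟨x, rfl⟩
  have h2 := RingedSpace.isUnit_res_basicOpen S.toRingedSpace (j.appTop.hom a)
  have h3 : IsIso (homOfLE (S.basicOpen_le (j.appTop.hom a))) :=
    ⟨homOfLE h1.ge, rfl, rfl⟩
  have h4 : IsIso (S.presheaf.map (homOfLE (S.basicOpen_le (j.appTop.hom a))).op) := inferInstance
  exact (isUnit_map_iff (asIso (S.presheaf.map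
    (homOfLE (S.basicOpen_le (j.appTop.hom a))).op)).commRingCatIsoToRingEquiv _).1 h2

/-! ### Minors of matrices with a right inverse -/

/-- Charts are indexed by increasing choices of columns. Any injective choice becomes increasing
after a permutation, which changes minors only by a sign. -/
lemma exists_orderEmb_range {k n : ℕ} (c : Fin k → Fin n) (hc : Function.Injective c) :
    ∃ (σ : Fin k ↪o Fin n) (e : Equiv.Perm (Fin k)), ∀ i, σ i = c (e i) := by
  classical
  have hcard : (Finset.univ.image c).card = k := by
    rw [Finset.card_image_of_injective _ hc]; simp
  let σ := (Finset.univ.image c).orderEmbOfFin hcard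
  have h : ∀ i, ∃ l, c l = σ i := by
    intro i
    obtain ⟨l, -, hl⟩ := Finset.mem_image.1 ((Finset.univ.image c).orderEmbOfFin_mem hcard i)
    exact ⟨l, hl⟩
  choose e he using h
  have hinj : Function.Injective e := fun a b hab => σ.injective (by rw [← he, ← he, hab])
  exact ⟨σ, Equiv.ofBijective e (Finite.injective_iff_bijective.1 hinj), fun i => (he i).symm⟩

/-- A right inverse makes the columns span `K^k`, so a basis can be chosen among them. -/
lemma exists_minor_ne_zero {K : Type} [Field K] {k n : ℕ} (M : Matrix (Fin k) (Fin n) K)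
    (B : Matrix (Fin n) (Fin k) K) (h : M * B = 1) :
    ∃ σ : Fin k ↪o Fin n, (M.submatrix id σ).det ≠ 0 := by
  classical
  have hspan : Submodule.span K (Set.range M.col) = ⊤ := by
    rw [← Matrix.range_mulVecLin, LinearMap.range_eq_top]
    intro v
    exact ⟨B.mulVec v, by simp [h]⟩
  obtain ⟨b, hb, hbs, hbi⟩ := exists_linearIndependent K (Set.range M.col)
  rw [hspan] at hbs
  let e : Module.Basis b K (Fin k → K) :=
    Module.Basis.mk hbi (by rw [Subtype.range_coe, hbs])
  have : Fintype b := FiniteDimensional.fintypeBasisIndex e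
  have hcard : Fintype.card b = k := by
    rw [← Module.finrank_eq_card_basis e]; simp
  let f : Fin k ≃ b := (Fintype.equivFinOfCardEq hcard).symm
  have hc : ∀ i, ∃ l, M.col l = (f i).1 := fun i => hb (f i).2
  choose c hc using hc
  have hcinj : Function.Injective c := fun a a' haa => f.injective
    (Subtype.ext (by rw [← hc, ← hc, haa]))
  obtain ⟨σ, π, hσ⟩ := exists_orderEmb_range c hcinj
  refine ⟨σ, ?_⟩
  have hli : LinearIndependent K (M.submatrix id σ).col := by
    have h1 : (M.submatrix id σ).col = fun i => (f (π i)).1 := by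
      funext i
      rw [← hc, ← hσ]; rfl
    rw [h1]
    exact hbi.comp (fun i => f (π i)) (f.injective.comp π.injective)
  rw [Matrix.linearIndependent_cols_iff_isUnit, Matrix.isUnit_iff_isUnit_det] at hli
  exact hli.ne_zero

/-- A matrix of functions with a right inverse locally has an invertible maximal minor. -/
lemma exists_local_minor {X : Scheme.{0}} {k n : ℕ} (M : Matrix (Fin k) (Fin n) Γ(X, ⊤))
    (B : Matrix (Fin n) (Fin k) Γ(X, ⊤)) (h : M * B = 1) (x : X) :
    ∃ (S : Scheme.{0}) (j : S ⟶ X) (σ : Fin k ↪o Fin n), IsOpenImmersion j ∧ IsAffine S ∧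
      x ∈ Set.range j ∧ IsUnit ((M.map j.appTop.hom).submatrix id σ).det := by
  let ev := (X.evaluation ⊤ x trivial).hom
  have h' : M.map ev * B.map ev = 1 := by
    rw [← Matrix.map_mul, h]; simp
  obtain ⟨σ, hσ⟩ := exists_minor_ne_zero _ _ h'
  rw [Matrix.submatrix_map, ← RingHom.mapMatrix_apply, ← RingHom.map_det] at hσ
  have hx := (X.evaluation_ne_zero_iff_mem_basicOpen (U := ⊤) x trivial _).1 hσ
  obtain ⟨S, j, hj, hS, hxS, hr⟩ := exists_affine_nhd x _ hx
  refine ⟨S, j, σ, hj, hS, hxS, ?_⟩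
  rw [Matrix.submatrix_map, ← RingHom.mapMatrix_apply, ← RingHom.map_det]
  exact isUnit_appTop_of_le_basicOpen j _ hr

/-! ### Morphisms to the Grassmannian as row spaces -/

lemma grι_hom {k n : ℕ} (σ : Fin k ↪o Fin n) :
    grι σ ≫ (Gr k n).hom =
      Spec.map (CommRingCat.ofHom (MvPolynomial.C : ℂ →+* ChartRing σ)) :=
  Multicoequalizer.π_desc _ _ _ _ _

/-- The morphism `f` to the Grassmannian is given by the row space of the matrix `M`, which has
an invertible maximal minor. -/
def IsRowSpace {k n : ℕ} {T : Scheme.{0}} (f : T ⟶ (Gr k n).left)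
    (M : Matrix (Fin k) (Fin n) Γ(T, ⊤)) : Prop :=
  ∃ (σ : Fin k ↪o Fin n) (w : T ⟶ chart σ), w ≫ grι σ = f ∧ IsUnit (M.submatrix id σ).det ∧
    (chartMatrix σ).map (pt w) = normalize σ M

namespace IsRowSpace

variable {k n : ℕ} {T : Scheme.{0}}

lemma pt_C (σ : Fin k ↪o Fin n) (w : T ⟶ chart σ) :
    (pt w).comp MvPolynomial.C = pt (R := ℂ) ((w ≫ grι σ) ≫ (Gr k n).hom) := by
  rw [Category.assoc, grι_hom, pt_comp_map]

lemma comp {S : Scheme.{0}} (j : S ⟶ T) {f : T ⟶ (Gr k n).left}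
    {M : Matrix (Fin k) (Fin n) Γ(T, ⊤)} (h : IsRowSpace f M) :
    IsRowSpace (j ≫ f) (M.map j.appTop.hom) := by
  obtain ⟨σ, w, hw, hu, hM⟩ := h
  refine ⟨σ, j ≫ w, by rw [Category.assoc, hw], ?_, ?_⟩
  · rw [Matrix.submatrix_map, ← RingHom.mapMatrix_apply, ← RingHom.map_det]
    exact hu.map _
  · rw [pt_comp, RingHom.coe_comp, ← Matrix.map_map, hM, map_normalize _ _ _ hu]

lemma exists_of_isUnit (c : T ⟶ Spec (.of ℂ)) (M : Matrix (Fin k) (Fin n) Γ(T, ⊤))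
    (σ : Fin k ↪o Fin n) (hu : IsUnit (M.submatrix id σ).det) :
    ∃ f : T ⟶ (Gr k n).left, IsRowSpace f M ∧ f ≫ (Gr k n).hom = c := by
  let w : T ⟶ chart σ := toSpec (chartEval σ (pt c) (normalize σ M))
  refine ⟨w ≫ grι σ, ⟨σ, w, rfl, hu, ?_⟩, pt_injective ?_⟩
  · rw [pt_toSpec, chartEval_matrix _ _ _ (normalize_submatrix _ _ hu)]
  · rw [← pt_C, pt_toSpec, chartEval_C]

/-- The row space lies in every chart whose minor is invertible. -/
lemma exists_chart {f : T ⟶ (Gr k n).left} {M : Matrix (Fin k) (Fin n) Γ(T, ⊤)}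
    (h : IsRowSpace f M) (τ : Fin k ↪o Fin n) (hu : IsUnit (M.submatrix id τ).det) :
    ∃ w : T ⟶ chart τ, w ≫ grι τ = f ∧ (chartMatrix τ).map (pt w) = normalize τ M := by
  obtain ⟨σ, w, hw, hσ, hM⟩ := h
  have h1 : IsUnit (((chartMatrix σ).map (pt w)).submatrix id τ).det := by
    rw [hM]; exact isUnit_normalize _ _ _ hσ hu
  have hl := overlapLift_comp σ τ w h1
  have hg := grι_glue σ τ
  refine ⟨overlapLift σ τ w h1 ≫ overlapT σ τ ≫ overlapι τ σ, ?_, ?_⟩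
  · rw [← hw, Category.assoc, hg, ← Category.assoc, hl]
  · rw [(pt_overlapT σ τ _).1, hl, hM, normalize_normalize _ _ _ hσ]

/-- Invertibility of `G` need not be assumed: `det G` divides an invertible minor of `M`.
Normalizing in the same columns then gives the same chart coordinates. -/
lemma ext {f g : T ⟶ (Gr k n).left} {M N : Matrix (Fin k) (Fin n) Γ(T, ⊤)}
    (hf : IsRowSpace f M) (hg : IsRowSpace g N) (G : Matrix (Fin k) (Fin k) Γ(T, ⊤))
    (h : M = G * N) (hs : f ≫ (Gr k n).hom = g ≫ (Gr k n).hom) : f = g := by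
  obtain ⟨σ, w, hw, hσ, hM⟩ := hf
  have hGN : M.submatrix id σ = G * N.submatrix id σ := by rw [h, submatrix_mul']
  have hdet : IsUnit (G.det * (N.submatrix id σ).det) := by
    rw [← Matrix.det_mul, ← hGN]; exact hσ
  have hG : IsUnit G.det := isUnit_of_mul_isUnit_left hdet
  have hN : IsUnit (N.submatrix id σ).det := isUnit_of_mul_isUnit_right hdet
  obtain ⟨w', hw', hN'⟩ := hg.exists_chart σ hN
  have : w = w' := by
    apply pt_injective
    refine chartRing_hom_ext ?_ ?_
    · rw [pt_C, pt_C, hw, hw', hs]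
    · rw [hM, hN', normalize, normalize, hGN, Matrix.mul_inv_rev, h, Matrix.mul_assoc,
        ← Matrix.mul_assoc _ G, Matrix.nonsing_inv_mul _ hG, Matrix.one_mul]
  rw [← hw, ← hw', this]

/-- Two matrices with the same row space. -/
lemma eq_mul {f : T ⟶ (Gr k n).left} {M N : Matrix (Fin k) (Fin n) Γ(T, ⊤)}
    (hf : IsRowSpace f M) (hg : IsRowSpace f N) :
    ∃ G : Matrix (Fin k) (Fin k) Γ(T, ⊤), M = G * N := by
  obtain ⟨σ, w, hw, hσ, hM⟩ := hf
  obtain ⟨τ, w', hw', hτ, hN⟩ := hg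
  -- The overlap is the fibre product of the two charts over the Grassmannian, so both presentations
  -- of `f` come from one point of it, where the transition is normalization.
  let l : T ⟶ overlap σ τ := PullbackCone.IsLimit.lift
    ((grGlueData k n).vPullbackConeIsLimit σ τ) w w' (hw.trans hw'.symm)
  have h1 : l ≫ overlapι σ τ = w := PullbackCone.IsLimit.lift_fst _ _ _ _
  have h2 : l ≫ overlapT σ τ ≫ overlapι τ σ = w' := PullbackCone.IsLimit.lift_snd _ _ _ _
  have h3 := (pt_overlapT σ τ l).1
  have h4 := isUnit_pt σ τ l
  rw [h1, hM] at h4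
  rw [h1, h2, hM, hN, normalize_normalize _ _ _ hσ] at h3
  refine ⟨M.submatrix id τ * (N.submatrix id τ)⁻¹, ?_⟩
  have h5 : IsUnit (M.submatrix id τ).det := by
    rw [normalize, submatrix_mul', Matrix.det_mul] at h4
    exact isUnit_of_mul_isUnit_right h4
  have h6 := congr_arg (fun P => M.submatrix id τ * P) h3
  simp only [normalize, ← Matrix.mul_assoc] at h6
  rw [Matrix.mul_nonsing_inv _ h5, Matrix.one_mul] at h6
  exact h6.symm

/-- A right inverse is the chart-free form of full rank; `exists_local_minor` leads back from it to
charts. -/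
lemma exists_rightInv {f : T ⟶ (Gr k n).left} {M : Matrix (Fin k) (Fin n) Γ(T, ⊤)}
    (h : IsRowSpace f M) : ∃ B : Matrix (Fin n) (Fin k) Γ(T, ⊤), M * B = 1 := by
  obtain ⟨σ, w, hw, hσ, hM⟩ := h
  refine ⟨(1 : Matrix (Fin n) (Fin n) Γ(T, ⊤)).submatrix id σ * (M.submatrix id σ)⁻¹, ?_⟩
  have : M * (1 : Matrix (Fin n) (Fin n) Γ(T, ⊤)).submatrix id σ = M.submatrix id σ := by
    ext i j
    simp [Matrix.mul_apply, Matrix.one_apply]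
  rw [← Matrix.mul_assoc, this, Matrix.mul_nonsing_inv _ hσ]

/-- A morphism with values in a chart. -/
lemma of_chart (σ : Fin k ↪o Fin n) (w : T ⟶ chart σ) :
    IsRowSpace (w ≫ grι σ) ((chartMatrix σ).map (pt w)) ∧
      ((chartMatrix σ).map (pt w)).submatrix id σ = 1 := by
  have : ((chartMatrix σ).map (pt w)).submatrix id σ = 1 := by
    rw [Matrix.submatrix_map, chartMatrix_submatrix]; simp
  exact ⟨⟨σ, w, rfl, by simp [this], (normalize_of_eq_one _ _ this).symm⟩, this⟩

/-- Locally, every morphism to the Grassmannian is given by a matrix, normalized on a chart. -/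
lemma exists_local (f : T ⟶ (Gr k n).left) (x : T) (U : T.Opens) (hx : x ∈ U) :
    ∃ (S : Scheme.{0}) (j : S ⟶ T) (σ : Fin k ↪o Fin n) (M : Matrix (Fin k) (Fin n) Γ(S, ⊤)),
      IsOpenImmersion j ∧ IsAffine S ∧ x ∈ Set.range j ∧ Set.range j ⊆ U ∧
      IsRowSpace (j ≫ f) M ∧ M.submatrix id σ = 1 := by
  obtain ⟨(σ : Fin k ↪o Fin n), y, hy⟩ := (grGlueData k n).ι_jointly_surjective (f x)
  have hx' : x ∈ U ⊓ f ⁻¹ᵁ (grι σ).opensRange := ⟨hx, ⟨y, hy⟩⟩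
  obtain ⟨S, j, hj, hS, hxS, hr⟩ := exists_affine_nhd x _ hx'
  have hr' : Set.range (j ≫ f) ⊆ Set.range (grι σ) := by
    rintro _ ⟨s, rfl⟩
    exact (hr ⟨s, rfl⟩ : j s ∈ _).2
  have := of_chart σ (IsOpenImmersion.lift (grι σ) (j ≫ f) hr')
  rw [IsOpenImmersion.lift_fac] at this
  exact ⟨S, j, σ, _, hj, hS, hxS, fun _ h => (hr h).1, this⟩

end IsRowSpace

/-! ### Zero loci and Cartier divisors, locally -/

lemma res_appLE {X T : Scheme.{0}} (f : T ⟶ X) {V : X.Opens} {O O' : T.Opens} (hO : O ≤ f ⁻¹ᵁ V)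
    (h : O' ≤ O) (a : Γ(X, V)) :
    res h ((f.appLE V O hO).hom a) = (f.appLE V O' (h.trans hO)).hom a := by
  have := appLE_res f h hO (h.trans hO) (le_refl V)
  have h2 := congr($this a)
  simp only [RingHom.comp_apply] at h2
  rw [h2, res_self]

lemma appLE_res_apply {X T : Scheme.{0}} (f : T ⟶ X) {V V' : X.Opens} {O : T.Opens}
    (hO : O ≤ f ⁻¹ᵁ V') (h : V' ≤ V) (a : Γ(X, V)) :
    (f.appLE V' O hO).hom (res h a) = (f.appLE V O (hO.trans (f.preimage_mono h))).hom a := by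
  have := appLE_res f le_rfl (hO.trans (f.preimage_mono h)) hO h
  have h2 := congr($this a)
  simp only [RingHom.comp_apply] at h2
  rw [← h2, res_self]

namespace VectorBundle

variable {X T : Scheme.{0}} (E : VectorBundle X) {s : ∀ i, E.fib i → Γ(X, E.U i)}

/-- The condition `E.zeroIdeal hs ≤ f.ker` says that `f` factors through the zero locus. Near each
point the ideal is generated by coordinates of `s`, so it suffices that these pull back to zero. -/
lemma zeroIdeal_le_ker_of_local (hs : E.IsSection s) (f : T ⟶ X)
    (h : ∀ x : T, ∃ (i : E.ι) (O : T.Opens) (hO : O ≤ f ⁻¹ᵁ E.U i), x ∈ O ∧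
      ∀ a, (f.appLE (E.U i) O hO).hom (s i a) = 0) : E.zeroIdeal hs ≤ f.ker := by
  refine Scheme.IdealSheafData.le_ofIdeals_iff.2 fun W a ha => ?_
  change a ∈ E.zeroIdealAt s W.1 at ha
  rw [mem_zeroIdealAt] at ha
  rw [RingHom.mem_ker]
  refine res_eq_zero_of_local _ fun x hx => ?_
  obtain ⟨i, O, hO, hxO, h0⟩ := h x
  obtain ⟨V, hV, hxV, hVU⟩ := exists_isAffineOpen_mem_and_subset
    (show f x ∈ W.1 ⊓ E.U i from ⟨hx, hO hxO⟩)
  have hVW : V ≤ W.1 := fun y hy => (hVU hy).1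
  have hVi : V ≤ E.U i := fun y hy => (hVU hy).2
  refine ⟨O ⊓ f ⁻¹ᵁ V, inf_le_right.trans (f.preimage_mono hVW), ⟨hxO, hxV⟩, ?_⟩
  have h1 := ha i ⟨V, hV⟩ hVW hVi
  have h2 : (E.coordIdeal s i V hVi) ≤ RingHom.ker (f.appLE V (O ⊓ f ⁻¹ᵁ V) inf_le_right).hom := by
    rw [coordIdeal, Ideal.span_le]
    rintro _ ⟨b, rfl⟩
    change (f.appLE V (O ⊓ f ⁻¹ᵁ V) inf_le_right).hom (res hVi (s i b)) = 0
    rw [appLE_res_apply, ← res_appLE f hO inf_le_left, h0, map_zero]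
  have h3 := h2 h1
  rw [RingHom.mem_ker, appLE_res_apply] at h3
  rw [← h3, ← res_appLE f (le_refl (f ⁻¹ᵁ W.1)) (inf_le_right.trans (f.preimage_mono hVW)),
    Scheme.Hom.appLE_eq_app]

/-- The coordinates of `s` lie in the ideal of the zero locus on every affine open subset of the
trivializing one. -/
lemma appLE_eq_zero_of_le_ker (hs : E.IsSection s) (f : T ⟶ X) (h : E.zeroIdeal hs ≤ f.ker)
    (i : E.ι) (O : T.Opens) (hO : O ≤ f ⁻¹ᵁ E.U i) (a : E.fib i) :
    (f.appLE (E.U i) O hO).hom (s i a) = 0 := by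
  refine res_eq_zero_of_local _ fun x hx => ?_
  obtain ⟨V, hV, hxV, hVU⟩ := exists_isAffineOpen_mem_and_subset
    (show f x ∈ E.U i from hO hx)
  have hVi : V ≤ E.U i := hVU
  have h1 : res hVi (s i a) ∈ E.zeroIdealAt s V := by
    refine E.mem_zeroIdealAt_of_cover hs _ _ fun y hy => ⟨i, V, le_rfl, hVi, hy, ?_⟩
    rw [res_res]
    exact Ideal.subset_span ⟨a, rfl⟩
  have h2 : (f.app V).hom (res hVi (s i a)) = 0 :=
    (f.ideal_ker_le ⟨V, hV⟩) (h ⟨V, hV⟩ h1)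
  refine ⟨O ⊓ f ⁻¹ᵁ V, inf_le_left, ⟨hx, hxV⟩, ?_⟩
  rw [res_appLE]
  have h3 := appLE_res_apply f (V' := V) (O := O ⊓ f ⁻¹ᵁ V) inf_le_right hVi (s i a)
  rw [← h3, ← res_appLE f le_rfl inf_le_right, Scheme.Hom.appLE_eq_app, h2, map_zero]

lemma zeroIdeal_le_ker_iff (hs : E.IsSection s) (f : T ⟶ X) (i : E.ι) (h : ⊤ ≤ f ⁻¹ᵁ E.U i) :
    E.zeroIdeal hs ≤ f.ker ↔ ∀ a, (f.appLE (E.U i) ⊤ h).hom (s i a) = 0 :=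
  ⟨fun h' => E.appLE_eq_zero_of_le_ker hs f h' i ⊤ h,
    fun h' => E.zeroIdeal_le_ker_of_local hs f fun _ => ⟨i, ⊤, h, trivial, h'⟩⟩

lemma zeroIdeal_le_ker_of_openImmersion (hs : E.IsSection s) (f : T ⟶ X)
    (h : ∀ x : T, ∃ (S : Scheme.{0}) (j : S ⟶ T), IsOpenImmersion j ∧ x ∈ Set.range j ∧
      E.zeroIdeal hs ≤ (j ≫ f).ker) : E.zeroIdeal hs ≤ f.ker := by
  refine E.zeroIdeal_le_ker_of_local hs f fun x => ?_
  obtain ⟨S, j, hj, ⟨y, rfl⟩, hk⟩ := h x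
  have hxt : f (j y) ∈ ⨆ i, E.U i := by rw [E.cover]; trivial
  obtain ⟨i, hi⟩ := TopologicalSpace.Opens.mem_iSup.1 hxt
  refine ⟨i, j ''ᵁ (j ⁻¹ᵁ f ⁻¹ᵁ E.U i), ?_, ⟨y, hi, rfl⟩, fun a => ?_⟩
  · rintro _ ⟨z, hz, rfl⟩
    exact hz
  have h1 := E.appLE_eq_zero_of_le_ker hs (j ≫ f) hk i (j ⁻¹ᵁ f ⁻¹ᵁ E.U i) le_rfl a
  have hinj : Function.Injective (j.appIso (j ⁻¹ᵁ f ⁻¹ᵁ E.U i)).hom.hom :=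
    ((ConcreteCategory.isIso_iff_bijective _).1 inferInstance).1
  apply hinj
  rw [map_zero, ← h1, Scheme.Hom.appIso_hom']
  exact congr($(Scheme.Hom.appLE_comp_appLE j f _ _ _ _ _).hom _)

/-- By adjunction, the pulled-back ideal sheaf lies below `J` exactly when the closed subscheme of
`J` maps into the zero locus, that is, when `J` contains the pulled-back coordinates. The two ideals
are therefore below the same ideal sheaves. -/
lemma comap_ideal_top (hs : E.IsSection s) [IsAffine T] (f : T ⟶ X) (i : E.ι)
    (h : ⊤ ≤ f ⁻¹ᵁ E.U i) :
    ((E.zeroIdeal hs).comap f).ideal ⟨⊤, isAffineOpen_top T⟩ =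
      Ideal.span (Set.range fun a => (f.appLE (E.U i) ⊤ h).hom (s i a)) := by
  have key : ∀ J : T.IdealSheafData, (E.zeroIdeal hs).comap f ≤ J ↔
      Ideal.span (Set.range fun a => (f.appLE (E.U i) ⊤ h).hom (s i a)) ≤
        J.ideal ⟨⊤, isAffineOpen_top T⟩ := by
    intro J
    refine Scheme.IdealSheafData.le_map_iff_comap_le.symm.trans ?_
    refine (E.zeroIdeal_le_ker_iff hs (J.subschemeι ≫ f) i (fun x _ => h trivial)).trans ?_
    refine Iff.trans ?_ (Ideal.span_le.trans Set.range_subset_iff).symm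
    refine forall_congr' fun a => ?_
    have h1 := congr($(Scheme.Hom.appLE_comp_appLE J.subschemeι f (E.U i) ⊤ ⊤ h le_rfl).hom (s i a))
    have h2 : J.subschemeι.appLE ⊤ ⊤ le_rfl = J.subschemeι.appTop := Scheme.Hom.appLE_eq_app _
    have h3 := J.ker_subschemeι_app ⟨⊤, isAffineOpen_top T⟩
    change (_ = (0 : Γ(J.subscheme, ⊤))) ↔ _ ∈ J.ideal ⟨⊤, isAffineOpen_top T⟩
    rw [← h3, RingHom.mem_ker]
    rw [h2] at h1
    constructor
    · intro h4; exact h1.trans h4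
    · intro h4; exact h1.symm.trans h4
  apply le_antisymm
  -- One inclusion comes from taking for `J` the ideal sheaf of the span, the other from taking the
  -- pulled-back ideal itself.
  · have h1 := (key (Scheme.IdealSheafData.ofIdealTop _)).2 (by
      rw [Scheme.IdealSheafData.ofIdealTop_ideal]
      exact fun x hx => by
        have := Ideal.mem_map_of_mem (res (X := T) (le_refl ⊤)) hx
        rwa [res_self] at this)
    refine (h1 ⟨⊤, isAffineOpen_top T⟩).trans ?_
    rw [Scheme.IdealSheafData.ofIdealTop_ideal, Ideal.map_le_iff_le_comap]
    intro x hx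
    rw [Ideal.mem_comap]
    have := res_self (X := T) x
    change res (X := T) (le_refl ⊤) x ∈ _
    rwa [this]
  · exact (key _).1 le_rfl

end VectorBundle

/-! ### Effective Cartier divisors on affine pieces, and blow-ups under isomorphisms of the base. -/

lemma comap_ideal_top_eq_span {X S : Scheme.{0}} (I : X.IdealSheafData) (j : S ⟶ X)
    [IsOpenImmersion j] [IsAffine S] (f : Γ(X, j ''ᵁ ⊤)) :
    (I.comap j).ideal ⟨⊤, isAffineOpen_top S⟩ = Ideal.span {(j.appIso ⊤).hom.hom f} ↔
      I.ideal ⟨j ''ᵁ ⊤, (isAffineOpen_top S).image_of_isOpenImmersion j⟩ = Ideal.span {f} := by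
  let e := (j.appIso ⊤).commRingCatIsoToRingEquiv
  rw [I.ideal_comap_of_isOpenImmersion]
  have h1 : ∀ J : Ideal Γ(X, j ''ᵁ ⊤), J.comap (j.appIso ⊤).inv.hom = J.map (e : Γ(X, j ''ᵁ ⊤) →+* Γ(S, ⊤)) :=
    fun J => Ideal.comap_symm e
  rw [h1]
  have h2 : Ideal.span {(j.appIso ⊤).hom.hom f} = (Ideal.span {f}).map (e : Γ(X, j ''ᵁ ⊤) →+* Γ(S, ⊤)) := by
    rw [Ideal.map_span, Set.image_singleton]; rfl
  rw [h2]
  constructor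
  · intro h
    have hb : Function.Bijective (e : Γ(X, j ''ᵁ ⊤) →+* Γ(S, ⊤)) := e.bijective
    exact (Ideal.comap_map_of_bijective _ hb).symm.trans
      ((congr_arg (Ideal.comap (e : Γ(X, j ''ᵁ ⊤) →+* Γ(S, ⊤))) h).trans
        (Ideal.comap_map_of_bijective _ hb))
  · intro h
    rw [h]

lemma isEffectiveCartier_of_local {X : Scheme.{0}} (I : X.IdealSheafData)
    (h : ∀ x : X, ∃ (S : Scheme.{0}) (j : S ⟶ X) (_ : IsAffine S), IsOpenImmersion j ∧
      x ∈ Set.range j ∧ ∃ f ∈ nonZeroDivisors Γ(S, ⊤),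
        (I.comap j).ideal ⟨⊤, isAffineOpen_top S⟩ = Ideal.span {f}) :
    IsEffectiveCartier I := by
  intro x
  obtain ⟨S, j, hS, hj, ⟨y, rfl⟩, f, hf, hI⟩ := h x
  let e := (j.appIso ⊤).commRingCatIsoToRingEquiv
  obtain ⟨f, rfl⟩ := e.surjective f
  refine ⟨⟨j ''ᵁ ⊤, (isAffineOpen_top S).image_of_isOpenImmersion j⟩, ⟨y, trivial, rfl⟩, f, ?_,
    (comap_ideal_top_eq_span I j f).1 hI⟩
  rw [← MulEquivClass.map_nonZeroDivisors (M₀ := Γ(X, j ''ᵁ ⊤)) e] at hf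
  obtain ⟨f', hf', e'⟩ := hf
  rwa [← e.injective e']

/-- Nonzerodivisors survive localization, so the affine neighbourhood can be shrunk into `U`. -/
lemma IsEffectiveCartier.exists_local {X : Scheme.{0}} {I : X.IdealSheafData}
    (h : IsEffectiveCartier I) (x : X) (U : X.Opens) (hx : x ∈ U) :
    ∃ (S : Scheme.{0}) (j : S ⟶ X) (_ : IsAffine S), IsOpenImmersion j ∧
      x ∈ Set.range j ∧ Set.range j ⊆ U ∧ ∃ f ∈ nonZeroDivisors Γ(S, ⊤),
        (I.comap j).ideal ⟨⊤, isAffineOpen_top S⟩ = Ideal.span {f} := by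
  obtain ⟨W, hxW, f, hf, hI⟩ := h x
  obtain ⟨g, hg, hxg⟩ := W.2.exists_basicOpen_le ⟨x, hx⟩ hxW
  have hloc := W.2.isLocalization_basicOpen g
  have h1 := I.map_ideal_basicOpen W g
  rw [hI, Ideal.map_span, Set.image_singleton] at h1
  have hf' : algebraMap Γ(X, W.1) Γ(X, X.basicOpen g) f ∈ nonZeroDivisors Γ(X, X.basicOpen g) :=
    IsLocalization.map_nonZeroDivisors_le (.powers g) _ ⟨f, hf, rfl⟩
  let V := X.affineBasicOpen g
  let j : V.1.toScheme ⟶ X := V.1.ι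
  have hS : IsAffine V.1.toScheme := V.2
  have key : ∀ V' : X.affineOpens, V' = V → ∃ f ∈ nonZeroDivisors Γ(X, V'.1),
      I.ideal V' = Ideal.span {f} := by
    rintro _ rfl
    exact ⟨_, hf', h1.symm⟩
  obtain ⟨f', hf', hI'⟩ := key ⟨j ''ᵁ ⊤, (isAffineOpen_top _).image_of_isOpenImmersion j⟩
    (Subtype.ext V.1.ι_image_top)
  refine ⟨V.1, j, hS, inferInstance, ?_, ?_,
    (j.appIso ⊤).hom.hom f', ?_, (comap_ideal_top_eq_span I j f').2 hI'⟩
  · rw [V.1.range_ι]; exact hxg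
  · rw [V.1.range_ι]; exact hg
  let e := (j.appIso ⊤).commRingCatIsoToRingEquiv
  have := MulEquivClass.map_nonZeroDivisors (M₀ := Γ(X, j ''ᵁ ⊤)) e
  rw [← this]
  exact ⟨f', hf', rfl⟩

/-- Test morphisms to `X` and to `X'` correspond under `α`, together with the inverse images of the
centre. This is what lets linear automorphisms move the centre. -/
lemma isBlowup_comp_iff {X X' Y : Scheme.{0}} (π : Y ⟶ X) (α : X ⟶ X') [IsIso α]
    (I : X'.IdealSheafData) : IsBlowup (π ≫ α) I ↔ IsBlowup π (I.comap α) := by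
  constructor
  · rintro ⟨h1, h2⟩
    refine ⟨by rwa [← Scheme.IdealSheafData.comap_comp], fun T f hf => ?_⟩
    rw [← Scheme.IdealSheafData.comap_comp] at hf
    obtain ⟨l, hl, hl'⟩ := h2 T (f ≫ α) hf
    refine ⟨l, ?_, fun l' e => hl' l' ?_⟩
    · rwa [← Category.assoc, cancel_mono] at hl
    · change l' ≫ π ≫ α = f ≫ α
      rw [← Category.assoc, e]
  · rintro ⟨h1, h2⟩
    refine ⟨by rwa [Scheme.IdealSheafData.comap_comp], fun T f hf => ?_⟩
    obtain ⟨l, hl, hl'⟩ := h2 T (f ≫ inv α) (by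
      rwa [← Scheme.IdealSheafData.comap_comp, Category.assoc, IsIso.inv_hom_id, Category.comp_id])
    refine ⟨l, ?_, fun l' e => hl' l' ?_⟩
    · change l ≫ π ≫ α = f
      rw [← Category.assoc, hl]; simp
    · change l' ≫ π = _
      rw [← e]; simp

/-! ### Containment in a row space -/

lemma exists_pullback_local {X Y S : Scheme.{0}} (f : X ⟶ Y) (j : S ⟶ Y) [IsOpenImmersion j]
    (x : X) (hx : f x ∈ Set.range j) :
    ∃ (S' : Scheme.{0}) (u : S' ⟶ X) (v : S' ⟶ S), IsOpenImmersion u ∧ x ∈ Set.range u ∧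
      u ≫ f = v ≫ j := by
  obtain ⟨y, hy⟩ := hx
  obtain ⟨z, hz, -⟩ := Scheme.Pullback.exists_preimage_pullback (f := f) (g := j) x y hy.symm
  exact ⟨pullback f j, pullback.fst f j, pullback.snd f j, inferInstance, ⟨z, hz⟩,
    pullback.condition⟩

/-- The rows of `L` lie in the row space that defines the morphism `f`. -/
def RowsIn {k n : ℕ} {T : Scheme.{0}} {p : Type} (f : T ⟶ (Gr k n).left)
    (L : Matrix p (Fin n) Γ(T, ⊤)) : Prop :=
  ∀ (S : Scheme.{0}) (j : S ⟶ T) (M : Matrix (Fin k) (Fin n) Γ(S, ⊤)), IsRowSpace (j ≫ f) M →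
    ∃ A : Matrix p (Fin k) Γ(S, ⊤), L.map j.appTop.hom = A * M

lemma map_appTop_comp {S S' T : Scheme.{0}} (w : S' ⟶ S) (j : S ⟶ T) {m n : Type}
    (L : Matrix m n Γ(T, ⊤)) :
    L.map (w ≫ j).appTop.hom = (L.map j.appTop.hom).map w.appTop.hom := by
  rw [Scheme.Hom.comp_appTop]; rfl

lemma map_appTop_id {T : Scheme.{0}} {m n : Type} (L : Matrix m n Γ(T, ⊤)) :
    L.map (𝟙 T : T ⟶ T).appTop.hom = L := by
  rw [Scheme.Hom.id_appTop]; ext; rfl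

namespace RowsIn

variable {k n : ℕ} {T : Scheme.{0}} {p : Type} {f : T ⟶ (Gr k n).left}
  {L : Matrix p (Fin n) Γ(T, ⊤)}

lemma comp (h : RowsIn f L) {S : Scheme.{0}} (j : S ⟶ T) :
    RowsIn (j ≫ f) (L.map j.appTop.hom) := by
  intro S' w M hM
  rw [← map_appTop_comp]
  exact h S' (w ≫ j) M (by rwa [Category.assoc])

lemma exists_mul (h : RowsIn f L) {M : Matrix (Fin k) (Fin n) Γ(T, ⊤)} (hM : IsRowSpace f M) :
    ∃ A : Matrix p (Fin k) Γ(T, ⊤), L = A * M := by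
  have := h T (𝟙 T) M (by rwa [Category.id_comp])
  rwa [map_appTop_id] at this

lemma of_local (h : ∀ x : T, ∃ (S : Scheme.{0}) (j : S ⟶ T) (M : Matrix (Fin k) (Fin n) Γ(S, ⊤))
    (A : Matrix p (Fin k) Γ(S, ⊤)), IsOpenImmersion j ∧ x ∈ Set.range j ∧ IsRowSpace (j ≫ f) M ∧
      L.map j.appTop.hom = A * M) : RowsIn f L := by
  intro S' w M' hM'
  -- The coefficients are forced: if `L = A * M'` then `A = L * B`. This candidate is defined
  -- globally, so only the equation has to be checked, and that is local.
  obtain ⟨B, hB⟩ := hM'.exists_rightInv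
  refine ⟨L.map w.appTop.hom * B, ?_⟩
  rw [← sub_eq_zero]
  refine matrix_eq_zero_of_local _ fun y => ?_
  obtain ⟨S, j, M, A, hj, hx, hM, hA⟩ := h (w y)
  obtain ⟨S₂, u, v, hu, hy, e⟩ := exists_pullback_local w j y hx
  refine ⟨S₂, u, hu, hy, ?_⟩
  have h1 := hM'.comp u
  have h2 := hM.comp v
  rw [← Category.assoc, e, Category.assoc] at h1
  obtain ⟨G, hG⟩ := h2.eq_mul h1
  have h3 : (L.map w.appTop.hom).map u.appTop.hom =
      A.map v.appTop.hom * G * M'.map u.appTop.hom := by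
    rw [← map_appTop_comp, e, map_appTop_comp, hA, Matrix.map_mul, hG, Matrix.mul_assoc]
  have h4 : M'.map u.appTop.hom * B.map u.appTop.hom = 1 := by
    rw [← Matrix.map_mul, hB]; simp
  have h5 : ∀ (P Q : Matrix p (Fin n) Γ(S', ⊤)), (P - Q).map u.appTop.hom =
      P.map u.appTop.hom - Q.map u.appTop.hom := fun P Q => by ext; simp
  rw [h5, Matrix.map_mul, Matrix.map_mul, h3, Matrix.mul_assoc _ _ (B.map _), h4, Matrix.mul_one,
    sub_self]

lemma of_eq_mul {M : Matrix (Fin k) (Fin n) Γ(T, ⊤)} (hM : IsRowSpace f M)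
    (A : Matrix p (Fin k) Γ(T, ⊤)) (h : L = A * M) : RowsIn f L := by
  refine of_local fun x => ⟨T, 𝟙 T, M, A, inferInstance, ⟨x, rfl⟩, ?_, ?_⟩
  · rwa [Category.id_comp]
  · rwa [map_appTop_id]

lemma of_openImmersion (h : ∀ x : T, ∃ (S : Scheme.{0}) (j : S ⟶ T), IsOpenImmersion j ∧
    x ∈ Set.range j ∧ RowsIn (j ≫ f) (L.map j.appTop.hom)) : RowsIn f L := by
  refine of_local fun x => ?_
  obtain ⟨S, j, hj, ⟨y, rfl⟩, hL⟩ := h x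
  obtain ⟨S', w, σ, M, hw, -, ⟨z, rfl⟩, -, hM, -⟩ := IsRowSpace.exists_local (j ≫ f) y ⊤ trivial
  obtain ⟨A, hA⟩ := hL S' w M hM
  exact ⟨S', w ≫ j, M, A, inferInstance, ⟨z, rfl⟩, by rwa [Category.assoc],
    by rwa [map_appTop_comp]⟩

end RowsIn

/-! ### Morphisms between Grassmannians from operations on matrices -/

/-- The constants on a scheme with a morphism to the Grassmannian. -/
noncomputable abbrev constC {k n : ℕ} {T : Scheme.{0}} (f : T ⟶ (Gr k n).left) : ℂ →+* Γ(T, ⊤) :=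
  pt (R := ℂ) (f ≫ (Gr k n).hom)

lemma constC_comp {k n : ℕ} {S T : Scheme.{0}} (j : S ⟶ T) (f : T ⟶ (Gr k n).left) :
    constC (j ≫ f) = j.appTop.hom.comp (constC f) := by
  rw [constC, Category.assoc, pt_comp]

/-- An operation on matrices descends to Grassmannians if it commutes with base change (`hmap`),
depends only on the row space (`hmul`) and preserves full rank (`hinv`); the argument `c` allows it
to use constant matrices. The minor `τ` appears in the conclusion because `IsRowSpace` asks for one
minor that is invertible on all of `T`. -/
lemma exists_hom_of_matrix_operation {k n k' n' : ℕ}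
    (F : ∀ (B : Type) [CommRing B], (ℂ →+* B) → Matrix (Fin k) (Fin n) B →
      Matrix (Fin k') (Fin n') B)
    (hmap : ∀ (B B' : Type) [CommRing B] [CommRing B'] (φ : B →+* B') (c : ℂ →+* B)
      (M : Matrix (Fin k) (Fin n) B), (F B c M).map φ = F B' (φ.comp c) (M.map φ))
    (hmul : ∀ (B : Type) [CommRing B] (c : ℂ →+* B) (G : Matrix (Fin k) (Fin k) B)
      (M : Matrix (Fin k) (Fin n) B), ∃ G' : Matrix (Fin k') (Fin k') B,
        F B c (G * M) = G' * F B c M)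
    (hinv : ∀ (B : Type) [CommRing B] (c : ℂ →+* B) (M : Matrix (Fin k) (Fin n) B)
      (R : Matrix (Fin n) (Fin k) B), M * R = 1 →
        ∃ R' : Matrix (Fin n') (Fin k') B, F B c M * R' = 1) :
    ∃ α : Gr k n ⟶ Gr k' n', ∀ (T : Scheme.{0}) (f : T ⟶ (Gr k n).left)
      (M : Matrix (Fin k) (Fin n) Γ(T, ⊤)), IsRowSpace f M → ∀ τ : Fin k' ↪o Fin n',
        IsUnit ((F _ (constC f) M).submatrix id τ).det →
          IsRowSpace (f ≫ α.left) (F _ (constC f) M) := by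
  have hc : ∀ {S S' : Scheme.{0}} (w : S' ⟶ S) (j : S ⟶ (Gr k n).left)
      (M : Matrix (Fin k) (Fin n) Γ(S, ⊤)),
      (F _ (constC j) M).map w.appTop.hom = F _ (constC (w ≫ j)) (M.map w.appTop.hom) := by
    intro S S' w j M
    rw [hmap, constC_comp]
  have hu : ∀ {S : Scheme.{0}} (j : S ⟶ (Gr k n).left) (f f' : S ⟶ (Gr k' n').left)
      (M M' : Matrix (Fin k) (Fin n) Γ(S, ⊤)), IsRowSpace j M → IsRowSpace j M' →
      IsRowSpace f (F _ (constC j) M) → IsRowSpace f' (F _ (constC j) M') →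
      f ≫ (Gr k' n').hom = f' ≫ (Gr k' n').hom → f = f' := by
    intro S j f f' M M' hM hM' hf hf' e
    obtain ⟨G, hG⟩ := hM.eq_mul hM'
    obtain ⟨G', hG'⟩ := hmul _ (constC j) G M'
    exact hf.ext hf' G' (by rw [hG, hG']) e
  obtain ⟨α, hα⟩ := exists_glue (X := (Gr k n).left) (Y := (Gr k' n').left)
    (fun S j f => ∃ M, IsRowSpace j M ∧ IsRowSpace f (F _ (constC j) M) ∧
      f ≫ (Gr k' n').hom = j ≫ (Gr k n).hom) (by
    rintro S S' w j f - ⟨M, h1, h2, h3⟩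
    refine ⟨M.map w.appTop.hom, h1.comp w, ?_, ?_⟩
    · rw [← hc]; exact h2.comp w
    · rw [Category.assoc, h3, Category.assoc]) (by
    rintro S j f f' - ⟨M, h1, h2, h3⟩ ⟨M', h1', h2', h3'⟩
    exact hu j f f' M M' h1 h1' h2 h2' (h3.trans h3'.symm)) (by
    intro x
    obtain ⟨S, j, σ, M, hj, -, ⟨y, rfl⟩, -, hM, -⟩ :=
      IsRowSpace.exists_local (𝟙 (Gr k n).left) x ⊤ trivial
    rw [Category.comp_id] at hM
    obtain ⟨R, hR⟩ := hM.exists_rightInv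
    obtain ⟨R', hR'⟩ := hinv _ (constC j) M R hR
    obtain ⟨S', w, τ, hw, -, ⟨z, rfl⟩, hτ⟩ := exists_local_minor _ _ hR' y
    rw [hc] at hτ
    obtain ⟨f, hf, hf'⟩ := IsRowSpace.exists_of_isUnit ((w ≫ j) ≫ (Gr k n).hom) _ _ hτ
    exact ⟨S', w ≫ j, f, inferInstance, ⟨z, rfl⟩, _, hM.comp w, hf, hf'⟩)
  refine ⟨Over.homMk α ?_, fun T f M hM τ hτ => ?_⟩
  · refine hom_ext_of_local _ _ fun x => ?_
    obtain ⟨S, j, hj, hx, M, -, -, h⟩ := hα x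
    exact ⟨S, j, hj, hx, by simpa using h⟩
  · obtain ⟨g, hg, hg'⟩ := IsRowSpace.exists_of_isUnit (f ≫ (Gr k n).hom) _ _ hτ
    -- The matrix `M` need not be the one used in the gluing. On a common pull-back both present the
    -- same morphism, and `hu` identifies the results.
    have : f ≫ α = g := by
      refine hom_ext_of_local _ _ fun x => ?_
      obtain ⟨S, j, hj, hx, M', h1, h2, h3⟩ := hα (f x)
      obtain ⟨S', u, v, hu', hxu, e⟩ := exists_pullback_local f j x hx
      refine ⟨S', u, hu', hxu, ?_⟩
      have e' : u ≫ f ≫ α = v ≫ j ≫ α := by rw [← Category.assoc, e, Category.assoc]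
      refine hu (u ≫ f) _ _ (M'.map v.appTop.hom) (M.map u.appTop.hom) ?_ (hM.comp u) ?_ ?_ ?_
      · rw [e]; exact h1.comp v
      · rw [e', e, ← hc]; exact h2.comp v
      · rw [← hc]; exact hg.comp u
      · simp only [Category.assoc, hg', h3, reassoc_of% e]
    change IsRowSpace (f ≫ α) _
    rwa [this]

/-- The morphism of the Grassmannian induced by a linear automorphism. -/
lemma exists_hom_of_invertible (k : ℕ) {n : ℕ} (g h : Matrix (Fin n) (Fin n) ℂ) (hgh : g * h = 1) :
    ∃ α : Gr k n ⟶ Gr k n, ∀ (T : Scheme.{0}) (f : T ⟶ (Gr k n).left)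
      (M : Matrix (Fin k) (Fin n) Γ(T, ⊤)), IsRowSpace f M → ∀ τ : Fin k ↪o Fin n,
        IsUnit ((M * g.map (constC f)).submatrix id τ).det →
          IsRowSpace (f ≫ α.left) (M * g.map (constC f)) := by
  refine exists_hom_of_matrix_operation (k := k) (k' := k)
    (fun B _ c (M : Matrix (Fin k) (Fin n) B) => (M * g.map c : Matrix (Fin k) (Fin n) B)) ?_ ?_ ?_
  · intro B B' _ _ φ c M
    simp only [Matrix.map_mul, Matrix.map_map, RingHom.coe_comp]
  · intro B _ c G M
    exact ⟨G, Matrix.mul_assoc _ _ _⟩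
  · intro B _ c M R hR
    refine ⟨h.map c * R, ?_⟩
    have : g.map c * h.map c = 1 := by
      rw [← Matrix.map_mul, hgh]; simp
    rw [Matrix.mul_assoc, ← Matrix.mul_assoc _ _ R, this, Matrix.one_mul, hR]

/-- The automorphism `α` of the Grassmannian acts on row spaces as multiplication by `g`. -/
def ActsAs {k n : ℕ} (α : Gr k n ⟶ Gr k n) (g : Matrix (Fin n) (Fin n) ℂ) : Prop :=
  ∀ (T : Scheme.{0}) (f : T ⟶ (Gr k n).left) (x : T), ∃ (S : Scheme.{0}) (j : S ⟶ T)
    (M : Matrix (Fin k) (Fin n) Γ(S, ⊤)), IsOpenImmersion j ∧ x ∈ Set.range j ∧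
    IsRowSpace (j ≫ f) M ∧ IsRowSpace (j ≫ f ≫ α.left) (M * g.map (constC (j ≫ f)))

lemma exists_actsAs (k : ℕ) {n : ℕ} (g h : Matrix (Fin n) (Fin n) ℂ) (hgh : g * h = 1) :
    ∃ α : Gr k n ⟶ Gr k n, ActsAs α g := by
  obtain ⟨α, hα⟩ := exists_hom_of_invertible k g h hgh
  refine ⟨α, fun T f x => ?_⟩
  obtain ⟨S, j, σ, M, hj, -, ⟨y, rfl⟩, -, hM, -⟩ := IsRowSpace.exists_local f x ⊤ trivial
  obtain ⟨R, hR⟩ := hM.exists_rightInv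
  have hR' : (M * g.map (constC (j ≫ f))) * (h.map (constC (j ≫ f)) * R) = 1 := by
    have : g.map (constC (j ≫ f)) * h.map (constC (j ≫ f)) = 1 := by
      rw [← Matrix.map_mul, hgh]; simp
    rw [Matrix.mul_assoc, ← Matrix.mul_assoc _ _ R, this, Matrix.one_mul, hR]
  obtain ⟨S', w, τ, hw, -, ⟨z, rfl⟩, hτ⟩ := exists_local_minor _ _ hR' y
  have e : (M * g.map (constC (j ≫ f))).map w.appTop.hom =
      M.map w.appTop.hom * g.map (constC ((w ≫ j) ≫ f)) := by
    rw [Category.assoc, constC_comp w, Matrix.map_mul, RingHom.coe_comp, Matrix.map_map]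
  refine ⟨S', w ≫ j, M.map w.appTop.hom, inferInstance, ⟨z, rfl⟩, ?_, ?_⟩
  · rw [Category.assoc]; exact hM.comp w
  · rw [e] at hτ
    have := hα S' ((w ≫ j) ≫ f) _ (by rw [Category.assoc]; exact hM.comp w) τ hτ
    simpa only [Category.assoc] using this

lemma ActsAs.comp_eq_id {k n : ℕ} {α β : Gr k n ⟶ Gr k n} {g h : Matrix (Fin n) (Fin n) ℂ}
    (hα : ActsAs α g) (hβ : ActsAs β h) (hgh : g * h = 1) : α ≫ β = 𝟙 _ := by
  refine Over.OverMorphism.ext (hom_ext_of_local _ _ fun x => ?_)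
  obtain ⟨S, j, M, hj, ⟨y, rfl⟩, h1, h2⟩ := hα _ (𝟙 (Gr k n).left) x
  rw [Category.id_comp] at h2
  rw [Category.comp_id] at h1
  obtain ⟨S', w, N, hw, ⟨z, rfl⟩, h3, h4⟩ := hβ _ (j ≫ α.left) y
  refine ⟨S', w ≫ j, inferInstance, ⟨z, rfl⟩, ?_⟩
  obtain ⟨G, hG⟩ := h3.eq_mul (h2.comp w)
  have hcc : constC (w ≫ j ≫ α.left) = constC (w ≫ j) := by
    simp only [constC, Category.assoc, Over.w]
  have key : N * h.map (constC (w ≫ j ≫ α.left)) = G * M.map w.appTop.hom := by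
    have h5 : (constC (j ≫ 𝟙 (Gr k n).left)) = constC j := by rw [Category.comp_id]
    have h6 : (g.map (constC j)).map w.appTop.hom = g.map (constC (w ≫ j)) := by
      rw [constC_comp, RingHom.coe_comp, Matrix.map_map]
    rw [hG, h5, hcc, Matrix.map_mul, h6, Matrix.mul_assoc, Matrix.mul_assoc, ← Matrix.map_mul, hgh]
    simp
  have h4' := h4.ext (h1.comp w) G key (by simp)
  simpa using h4'

lemma exists_aut (k : ℕ) {n : ℕ} (g h : Matrix (Fin n) (Fin n) ℂ) (hgh : g * h = 1) :
    ∃ α : Gr k n ≅ Gr k n, ActsAs α.hom g := by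
  have hhg : h * g = 1 := mul_eq_one_comm.1 hgh
  obtain ⟨α, hα⟩ := exists_actsAs k g h hgh
  obtain ⟨β, hβ⟩ := exists_actsAs k h g hhg
  exact ⟨⟨α, β, hα.comp_eq_id hβ hgh, hβ.comp_eq_id hα hhg⟩, hα⟩

/-! ### Sections of the tautological bundles given by vectors and matrices -/

lemma mul_projMatrix_apply_of_mem {k n : ℕ} (σ : Fin k ↪o Fin n) {B p : Type} [CommRing B]
    (M : Matrix (Fin k) (Fin n) B) (hM : M.submatrix id σ = 1) (L : Matrix p (Fin n) B) (i : p)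
    (j : Fin n) (hj : j ∈ Set.range σ) : (L * projMatrix σ M) i j = 0 := by
  rw [Matrix.mul_apply]
  exact Finset.sum_eq_zero fun l _ => by rw [projMatrix_apply_of_mem σ M hM l j hj, mul_zero]

/-- The kernel of `projMatrix σ M` on row vectors is the row space of `M`, and the coefficients `A`
are the columns `σ` of `L`. The columns of the product in the range of `σ` vanish anyway, so the
remaining ones, the coordinates in the quotient bundle, suffice. -/
lemma exists_mul_iff_projMatrix {k n : ℕ} (σ : Fin k ↪o Fin n) {B p : Type} [CommRing B]
    (M : Matrix (Fin k) (Fin n) B) (hM : M.submatrix id σ = 1) (L : Matrix p (Fin n) B) :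
    (∃ A : Matrix p (Fin k) B, L = A * M) ↔
      ∀ (i : p) (j : {j : Fin n // j ∉ Set.range σ}), (L * projMatrix σ M) i j = 0 := by
  constructor
  · rintro ⟨A, rfl⟩ i j
    rw [Matrix.mul_assoc, mul_projMatrix σ M hM, Matrix.mul_zero]; rfl
  · intro h
    have h0 : L * projMatrix σ M = 0 := by
      ext i j
      by_cases hj : j ∈ Set.range σ
      · exact mul_projMatrix_apply_of_mem σ M hM L i j hj
      · exact h i ⟨j, hj⟩
    refine ⟨L * (1 : Matrix (Fin n) (Fin n) B).submatrix id σ, ?_⟩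
    rwa [projMatrix, Matrix.mul_sub, Matrix.mul_one, sub_eq_zero, ← Matrix.mul_assoc] at h0

/-- The change of coordinates in the quotient by a row space. -/
lemma mul_projMatrix_apply_eq_sum {k n : ℕ} (σ τ : Fin k ↪o Fin n) {B p : Type} [CommRing B]
    (M N : Matrix (Fin k) (Fin n) B) (hM : M.submatrix id σ = 1) (hN : N.submatrix id τ = 1)
    (h : N = N.submatrix id σ * M) [Fintype {j : Fin n // j ∉ Set.range τ}]
    (L : Matrix p (Fin n) B) (i : p) (j : Fin n) :
    (L * projMatrix σ M) i j = ∑ l : {j : Fin n // j ∉ Set.range τ},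
      projMatrix σ M l j * (L * projMatrix τ N) i l := by
  classical
  rw [← projMatrix_mul σ τ M N hM h, ← Matrix.mul_assoc, Matrix.mul_apply,
    ← Fintype.sum_subtype_add_sum_subtype (fun j => j ∉ Set.range τ)]
  have h2 : ∑ x : {x : Fin n // ¬ x ∉ Set.range τ},
      (L * projMatrix τ N) i x * projMatrix σ M x j = 0 :=
    Finset.sum_eq_zero fun x _ => by
      rw [mul_projMatrix_apply_of_mem τ N hN _ _ _ (not_not.1 x.2), zero_mul]
  rw [h2, add_zero]
  refine Finset.sum_congr (by ext; simp) fun l _ => ?_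
  rw [projMatrix_mul σ τ M N hM h, mul_comm]

/-- A vector of constants as a matrix with one row. -/
def constRow {B : Type} [CommRing B] (c : ℂ →+* B) {n : ℕ} (v : Fin n → ℂ) :
    Matrix (Fin 1) (Fin n) B := fun _ j => c (v j)

lemma constRow_map {B B' : Type} [CommRing B] [CommRing B'] (c : ℂ →+* B) (φ : B →+* B') {n : ℕ}
    (v : Fin n → ℂ) : (constRow c v).map φ = constRow (φ.comp c) v := rfl

lemma appLE_algebraMap (X : CScheme) {T : Scheme.{0}} (f : T ⟶ X.left) (U : X.left.Opens)
    (O : T.Opens) (h : O ≤ f ⁻¹ᵁ U) :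
    (f.appLE U O h).hom.comp (algebraMap ℂ Γ(X.left, U)) =
      (res le_top).comp (pt (R := ℂ) (f ≫ X.hom)) := by
  change (f.appLE U O h).hom.comp ((res le_top).comp (pt (R := ℂ) X.hom)) = _
  rw [pt_comp, ← RingHom.comp_assoc, ← RingHom.comp_assoc]
  congr 1
  have := appLE_res f (le_top : O ≤ ⊤) (V := ⊤) (W' := ⊤) le_rfl h le_top
  have h' : f.appLE ⊤ ⊤ le_rfl = f.appTop := Scheme.Hom.appLE_eq_app _
  rw [← this, h']

lemma appLE_top_algebraMap (X : CScheme) {T : Scheme.{0}} (f : T ⟶ X.left) (U : X.left.Opens)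
    (h : ⊤ ≤ f ⁻¹ᵁ U) :
    (f.appLE U ⊤ h).hom.comp (algebraMap ℂ Γ(X.left, U)) = pt (R := ℂ) (f ≫ X.hom) := by
  rw [appLE_algebraMap]
  exact RingHom.ext fun a => res_self (X := T) _

lemma res_algebraMap (X : CScheme) {V W : X.left.Opens} (h : V ≤ W) :
    (res h).comp (algebraMap ℂ Γ(X.left, W)) = algebraMap ℂ Γ(X.left, V) := by
  change (res h).comp ((res le_top).comp _) = (res le_top).comp _
  rw [← RingHom.comp_assoc, res_comp]

lemma grMatrix_map_submatrix {k n : ℕ} (σ : Fin k ↪o Fin n) {B : Type} [CommRing B]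
    (φ : Γ((Gr k n).left, grOpen σ) →+* B) : ((grMatrix σ).map φ).submatrix id σ = 1 := by
  rw [Matrix.submatrix_map, grMatrix_submatrix]; simp

lemma IsRowSpace.le_preimage {k n : ℕ} {T : Scheme.{0}} {f : T ⟶ (Gr k n).left}
    {M : Matrix (Fin k) (Fin n) Γ(T, ⊤)} (h : IsRowSpace f M) {σ : Fin k ↪o Fin n}
    (hM : M.submatrix id σ = 1) : ⊤ ≤ f ⁻¹ᵁ grOpen σ := by
  obtain ⟨w, rfl, -⟩ := h.exists_chart σ (by simp [hM])
  exact le_preimage_grOpen σ w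

lemma IsRowSpace.appLE_grMatrix {k n : ℕ} {T : Scheme.{0}} {f : T ⟶ (Gr k n).left}
    {M : Matrix (Fin k) (Fin n) Γ(T, ⊤)} (h : IsRowSpace f M) {σ : Fin k ↪o Fin n}
    (hM : M.submatrix id σ = 1) (hf : ⊤ ≤ f ⁻¹ᵁ grOpen σ) :
    (grMatrix σ).map (f.appLE (grOpen σ) ⊤ hf).hom = M := by
  obtain ⟨w, hw, e⟩ := h.exists_chart σ (by simp [hM])
  rw [normalize_of_eq_one _ _ hM] at e
  rw [← e, grMatrix, Matrix.map_map, ← RingHom.coe_comp, appLE_grSec σ w hw]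

/-- The coordinates on a chart of the section of the quotient bundle given by a vector. -/
def quotCoord (k n : ℕ) (v : Fin n → ℂ) (σ : Fin k ↪o Fin n) (j : {j : Fin n // j ∉ Set.range σ}) :
    Γ((Gr k n).left, grOpen σ) :=
  (constRow (algebraMap ℂ Γ((Gr k n).left, grOpen σ)) v * projMatrix σ (grMatrix σ) :
    Matrix (Fin 1) (Fin n) Γ((Gr k n).left, grOpen σ)) 0 j.1

lemma map_quotCoord (k n : ℕ) (v : Fin n → ℂ) (σ : Fin k ↪o Fin n)
    (j : {j : Fin n // j ∉ Set.range σ}) {B : Type} [CommRing B]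
    (φ : Γ((Gr k n).left, grOpen σ) →+* B) :
    φ (quotCoord k n v σ j) =
      (constRow (φ.comp (algebraMap ℂ _)) v * projMatrix σ ((grMatrix σ).map φ) :
        Matrix (Fin 1) (Fin n) B) 0 j.1 := by
  rw [← map_projMatrix, ← constRow_map, ← Matrix.map_mul]
  rfl

lemma isSection_quotCoord (k n : ℕ) (v : Fin n → ℂ) :
    (tautQuot k n).IsSection (quotCoord k n v) := by
  intro (σ : Fin k ↪o Fin n) (τ : Fin k ↪o Fin n)
  funext (j : {j : Fin n // j ∉ Set.range σ})
  let _ : Fintype {j : Fin n // j ∉ Set.range τ} := (tautQuot k n).fintype τ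
  have hσ : grOpen σ ⊓ grOpen τ ≤ grOpen σ := inf_le_left
  have hτ : grOpen σ ⊓ grOpen τ ≤ grOpen τ := inf_le_right
  have h := mul_projMatrix_apply_eq_sum σ τ ((grMatrix σ).map (res hσ))
    ((grMatrix τ).map (res hτ)) (grMatrix_map_submatrix _ _) (grMatrix_map_submatrix _ _)
    (grMatrix_rel τ σ _ hτ hσ)
    (constRow (algebraMap ℂ Γ((Gr k n).left, grOpen σ ⊓ grOpen τ)) v) 0 j.1
  have key := fun (ρ : Fin k ↪o Fin n) (hρ : grOpen σ ⊓ grOpen τ ≤ grOpen ρ)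
    (l : {j : Fin n // j ∉ Set.range ρ}) => map_quotCoord k n v ρ l (res hρ)
  simp only [res_algebraMap (Gr k n)] at key
  refine (key σ hσ j).trans (h.trans (Finset.sum_congr rfl fun l _ => ?_))
  refine congr_arg₂ (· * ·) ?_ (key τ hτ l).symm
  rw [← map_projMatrix]
  rfl

lemma quotCoord_add (k n : ℕ) (v w : Fin n → ℂ) (σ : Fin k ↪o Fin n)
    (j : {j : Fin n // j ∉ Set.range σ}) :
    quotCoord k n (v + w) σ j = quotCoord k n v σ j + quotCoord k n w σ j := by
  have : constRow (algebraMap ℂ Γ((Gr k n).left, grOpen σ)) (v + w) =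
      constRow (algebraMap ℂ _) v + constRow (algebraMap ℂ _) w := by
    ext; simp [constRow]
  rw [quotCoord, this, Matrix.add_mul]
  rfl

lemma quotCoord_smul (k n : ℕ) (a : ℂ) (v : Fin n → ℂ) (σ : Fin k ↪o Fin n)
    (j : {j : Fin n // j ∉ Set.range σ}) :
    quotCoord k n (a • v) σ j = a • quotCoord k n v σ j := by
  have : constRow (algebraMap ℂ Γ((Gr k n).left, grOpen σ)) (a • v) =
      a • constRow (algebraMap ℂ _) v := by
    ext; simp [constRow, Algebra.smul_def]
  rw [quotCoord, this, Matrix.smul_mul]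
  rfl

/-- The section of the quotient bundle given by a vector. -/
def quotSection (k n : ℕ) : (Fin n → ℂ) →ₗ[ℂ] (tautQuot k n).H0 where
  toFun v := ⟨quotCoord k n v, isSection_quotCoord k n v⟩
  map_add' v w := Subtype.ext (funext fun σ => funext fun j => quotCoord_add k n v w σ j)
  map_smul' a v := Subtype.ext (funext fun σ => funext fun j => quotCoord_smul k n a v σ j)

lemma quotSection_appLE {k n : ℕ} (v : Fin n → ℂ) {T : Scheme.{0}} {f : T ⟶ (Gr k n).left}
    {M : Matrix (Fin k) (Fin n) Γ(T, ⊤)} (h : IsRowSpace f M) {σ : Fin k ↪o Fin n}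
    (hM : M.submatrix id σ = 1) (hf : ⊤ ≤ f ⁻¹ᵁ grOpen σ) (j : {j : Fin n // j ∉ Set.range σ}) :
    (f.appLE (grOpen σ) ⊤ hf).hom ((quotSection k n v).1 σ j) =
      (constRow (constC f) v * projMatrix σ M) 0 j.1 := by
  have h1 := map_quotCoord k n v σ j (f.appLE (grOpen σ) ⊤ hf).hom
  rw [h.appLE_grMatrix hM hf, appLE_top_algebraMap (Gr k n) f (grOpen σ) hf] at h1
  exact h1

/-- The zero locus of the section given by `v` parametrizes the subspaces that contain `v`. -/
lemma zeroIdeal_quotSection_le_ker_iff {k n : ℕ} (v : Fin n → ℂ) {T : Scheme.{0}}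
    (f : T ⟶ (Gr k n).left) :
    (tautQuot k n).zeroIdeal (quotSection k n v).2 ≤ f.ker ↔
      RowsIn f (constRow (constC f) v) := by
  -- In one chart the section vanishes if and only if the class of `v` in the quotient does, that
  -- is, if `v` is a combination of the rows. Both sides of the equivalence are local, so this is
  -- enough.
  have key : ∀ (S : Scheme.{0}) (g : S ⟶ (Gr k n).left) (σ : Fin k ↪o Fin n)
      (M : Matrix (Fin k) (Fin n) Γ(S, ⊤)), IsRowSpace g M → M.submatrix id σ = 1 →
      ((tautQuot k n).zeroIdeal (quotSection k n v).2 ≤ g.ker ↔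
        ∃ A : Matrix (Fin 1) (Fin k) Γ(S, ⊤), constRow (constC g) v = A * M) := by
    intro S g σ M hM hσ
    rw [exists_mul_iff_projMatrix σ M hσ]
    refine ((tautQuot k n).zeroIdeal_le_ker_iff (quotSection k n v).2 g σ
      (hM.le_preimage hσ)).trans ⟨fun h i j => ?_, fun h j => ?_⟩
    · rw [Subsingleton.elim i 0, ← quotSection_appLE v hM hσ (hM.le_preimage hσ)]
      exact h j
    · exact (quotSection_appLE v hM hσ (hM.le_preimage hσ) j).trans (h 0 j)
  constructor
  · intro h
    refine RowsIn.of_local fun x => ?_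
    obtain ⟨S, j, σ, M, hj, -, hx, -, hM, hσ⟩ := IsRowSpace.exists_local f x ⊤ trivial
    obtain ⟨A, hA⟩ := (key S (j ≫ f) σ M hM hσ).1 (h.trans (j.le_ker_comp f))
    refine ⟨S, j, M, A, hj, hx, hM, ?_⟩
    rw [constRow_map, ← constC_comp, hA]
  · intro h
    refine (tautQuot k n).zeroIdeal_le_ker_of_openImmersion _ f fun x => ?_
    obtain ⟨S, j, σ, M, hj, -, hx, -, hM, hσ⟩ := IsRowSpace.exists_local f x ⊤ trivial
    refine ⟨S, j, hj, hx, (key S (j ≫ f) σ M hM hσ).2 ?_⟩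
    have := (h.comp j).exists_mul hM
    rwa [constRow_map, ← constC_comp] at this

/-- On an affine scheme mapping to a chart, the pull-back of the ideal of the zero locus is
generated by the coordinates of the section. -/
lemma comap_zeroIdeal_quotSection {k n : ℕ} (v : Fin n → ℂ) {T : Scheme.{0}} [IsAffine T]
    {f : T ⟶ (Gr k n).left} {M : Matrix (Fin k) (Fin n) Γ(T, ⊤)} (h : IsRowSpace f M)
    {σ : Fin k ↪o Fin n} (hM : M.submatrix id σ = 1) :
    (((tautQuot k n).zeroIdeal (quotSection k n v).2).comap f).ideal ⟨⊤, isAffineOpen_top T⟩ =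
      Ideal.span (Set.range fun j : {j : Fin n // j ∉ Set.range σ} =>
        (constRow (constC f) v * projMatrix σ M) 0 j.1) := by
  rw [(tautQuot k n).comap_ideal_top (quotSection k n v).2 f σ (h.le_preimage hM)]
  congr 2
  funext j
  exact quotSection_appLE v h hM _ j

/-! ### The incidence condition -/

/-- The linear map `φ`, acting on row vectors, sends the row space of `f₂` into that of `f₁`. -/
def Incid {k k' m n : ℕ} (φ : Matrix (Fin n) (Fin m) ℂ) {T : Scheme.{0}}
    (f₁ : T ⟶ (Gr k' m).left) (f₂ : T ⟶ (Gr k n).left) : Prop :=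
  ∀ (S : Scheme.{0}) (j : S ⟶ T) (N : Matrix (Fin k) (Fin n) Γ(S, ⊤)), IsRowSpace (j ≫ f₂) N →
    RowsIn (j ≫ f₁) (N * φ.map (constC (j ≫ f₂)))

lemma mul_map_constC_comp {k n : ℕ} {p q r : Type} [Fintype q] {S T : Scheme.{0}} (j : S ⟶ T)
    (f : T ⟶ (Gr k n).left) (N : Matrix p q Γ(T, ⊤)) (φ : Matrix q r ℂ) :
    (N * φ.map (constC f)).map j.appTop.hom = N.map j.appTop.hom * φ.map (constC (j ≫ f)) := by
  rw [constC_comp, Matrix.map_mul, RingHom.coe_comp, Matrix.map_map]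

namespace Incid

variable {k k' m n : ℕ} {φ : Matrix (Fin n) (Fin m) ℂ} {T : Scheme.{0}}
  {f₁ : T ⟶ (Gr k' m).left} {f₂ : T ⟶ (Gr k n).left}

lemma comp (h : Incid φ f₁ f₂) {S : Scheme.{0}} (j : S ⟶ T) : Incid φ (j ≫ f₁) (j ≫ f₂) := by
  intro S' w N hN
  have := h S' (w ≫ j) N (by rwa [Category.assoc])
  simpa only [Category.assoc] using this

lemma exists_mul (h : Incid φ f₁ f₂) {M : Matrix (Fin k') (Fin m) Γ(T, ⊤)}
    {N : Matrix (Fin k) (Fin n) Γ(T, ⊤)} (hM : IsRowSpace f₁ M) (hN : IsRowSpace f₂ N) :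
    ∃ A : Matrix (Fin k) (Fin k') Γ(T, ⊤), N * φ.map (constC f₂) = A * M := by
  have := (h T (𝟙 T) N (by rwa [Category.id_comp])).exists_mul (M := M) (by rwa [Category.id_comp])
  rwa [Category.id_comp] at this

/-- One presentation of `f₂` is enough, since any other one over `S` is `G` times its pull-back. -/
lemma of_rowsIn {N : Matrix (Fin k) (Fin n) Γ(T, ⊤)} (hN : IsRowSpace f₂ N)
    (h : RowsIn f₁ (N * φ.map (constC f₂))) : Incid φ f₁ f₂ := by
  intro S j N' hN'
  obtain ⟨G, rfl⟩ := hN'.eq_mul (hN.comp j)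
  have h' := h.comp j
  intro S' w M hM
  obtain ⟨A, hA⟩ := h' S' w M hM
  refine ⟨G.map w.appTop.hom * A, ?_⟩
  rw [Matrix.mul_assoc, ← mul_map_constC_comp, Matrix.map_mul, hA, Matrix.mul_assoc]

lemma of_openImmersion (h : ∀ x : T, ∃ (S : Scheme.{0}) (j : S ⟶ T), IsOpenImmersion j ∧
    x ∈ Set.range j ∧ Incid φ (j ≫ f₁) (j ≫ f₂)) : Incid φ f₁ f₂ := by
  intro S' w N hN
  refine RowsIn.of_openImmersion fun y => ?_
  obtain ⟨S, j, hj, hx, hI⟩ := h (w y)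
  obtain ⟨S₂, u, v, hu, hy, e⟩ := exists_pullback_local w j y hx
  refine ⟨S₂, u, hu, hy, ?_⟩
  have h1 := hN.comp u
  have h2 := hI S₂ v (N.map u.appTop.hom) (by
    rw [← Category.assoc, ← e, Category.assoc]; exact h1)
  rw [mul_map_constC_comp]
  rw [← Category.assoc, ← Category.assoc v, ← e] at h2
  simpa only [Category.assoc] using h2

lemma of_eq_mul {M : Matrix (Fin k') (Fin m) Γ(T, ⊤)} {N : Matrix (Fin k) (Fin n) Γ(T, ⊤)}
    (hM : IsRowSpace f₁ M) (hN : IsRowSpace f₂ N) (A : Matrix (Fin k) (Fin k') Γ(T, ⊤))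
    (h : N * φ.map (constC f₂) = A * M) : Incid φ f₁ f₂ :=
  of_rowsIn hN (RowsIn.of_eq_mul hM A h)

end Incid

lemma grMatrix_rel_appLE {k n : ℕ} (σ τ : Fin k ↪o Fin n) {T : Scheme.{0}}
    (f : T ⟶ (Gr k n).left) (W : T.Opens) (hσ : W ≤ f ⁻¹ᵁ grOpen σ) (hτ : W ≤ f ⁻¹ᵁ grOpen τ) :
    (grMatrix σ).map (f.appLE (grOpen σ) W hσ).hom =
      ((grMatrix σ).map (f.appLE (grOpen σ) W hσ).hom).submatrix id τ *
        (grMatrix τ).map (f.appLE (grOpen τ) W hτ).hom := by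
  have h := grMatrix_rel σ τ (grOpen σ ⊓ grOpen τ) inf_le_left inf_le_right
  have hW : W ≤ f ⁻¹ᵁ (grOpen σ ⊓ grOpen τ) := le_inf hσ hτ
  have h2 := congr_arg (fun M : Matrix _ _ _ => M.map (f.appLE _ W hW).hom) h
  simp only [Matrix.map_mul, ← Matrix.submatrix_map, Matrix.map_map] at h2
  have e : ∀ (ρ : Fin k ↪o Fin n) (h1 : grOpen σ ⊓ grOpen τ ≤ grOpen ρ) (h2 : W ≤ f ⁻¹ᵁ grOpen ρ),
      (f.appLE (grOpen σ ⊓ grOpen τ) W hW).hom ∘ (res h1) = (f.appLE (grOpen ρ) W h2).hom :=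
    fun ρ h1 h2 => funext fun a => appLE_res_apply f hW h1 a
  rw [e σ inf_le_left hσ, e τ inf_le_right hτ] at h2
  exact h2

lemma res_appLE_res {X T : Scheme.{0}} (f : T ⟶ X) {V V' : X.Opens} {O O' : T.Opens}
    (hO : O ≤ f ⁻¹ᵁ V') (h : V' ≤ V) (hO' : O' ≤ O) (hO'' : O' ≤ f ⁻¹ᵁ V) (a : Γ(X, V)) :
    res hO' ((f.appLE V' O hO).hom (res h a)) = (f.appLE V O' hO'').hom a := by
  rw [appLE_res_apply, res_appLE]

/-- The product of two charts, as an open subset of the product of two Grassmannians. -/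
abbrev boxOpen {k m n : ℕ} (σ : Fin k ↪o Fin m) (σ' : Fin k ↪o Fin n) :
    (prodC (Gr k m) (Gr k n)).left.Opens :=
  (fstC (Gr k m) (Gr k n)).left ⁻¹ᵁ grOpen σ ⊓ (sndC (Gr k m) (Gr k n)).left ⁻¹ᵁ grOpen σ'

/-- The coordinates of the homomorphism from the row space of `N` to the quotient by the row space
of `M` that is given by `Φ`. -/
def boxMat {k m n : ℕ} {B : Type} [CommRing B] (σ : Fin k ↪o Fin m) (N : Matrix (Fin k) (Fin n) B)
    (Φ : Matrix (Fin n) (Fin m) B) (M : Matrix (Fin k) (Fin m) B) : Matrix (Fin k) (Fin m) B :=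
  N * Φ * projMatrix σ M

lemma map_boxMat {k m n : ℕ} {B B' : Type} [CommRing B] [CommRing B'] (θ : B →+* B')
    (σ : Fin k ↪o Fin m) (N : Matrix (Fin k) (Fin n) B) (Φ : Matrix (Fin n) (Fin m) B)
    (M : Matrix (Fin k) (Fin m) B) :
    (boxMat σ N Φ M).map θ = boxMat σ (N.map θ) (Φ.map θ) (M.map θ) := by
  rw [boxMat, Matrix.map_mul, Matrix.map_mul, map_projMatrix, boxMat]

/-- The coordinates on a product of charts of the section of `𝒬 ⊠ 𝒰^∨` given by a matrix. -/
def boxCoord (k m n : ℕ) (φ : Matrix (Fin n) (Fin m) ℂ)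
    (p : (Fin k ↪o Fin m) × (Fin k ↪o Fin n))
    (a : {j : Fin m // j ∉ Set.range p.1} × Fin k) :
    Γ((prodC (Gr k m) (Gr k n)).left, boxOpen p.1 p.2) :=
  boxMat p.1 ((grMatrix p.2).map
      ((sndC (Gr k m) (Gr k n)).left.appLE (grOpen p.2) (boxOpen p.1 p.2) inf_le_right).hom)
    (φ.map (algebraMap ℂ _))
    ((grMatrix p.1).map
      ((fstC (Gr k m) (Gr k n)).left.appLE (grOpen p.1) (boxOpen p.1 p.2) inf_le_left).hom)
    a.2 a.1.1

lemma map_boxCoord (k m n : ℕ) (φ : Matrix (Fin n) (Fin m) ℂ)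
    (p : (Fin k ↪o Fin m) × (Fin k ↪o Fin n)) (a : {j : Fin m // j ∉ Set.range p.1} × Fin k)
    {B : Type} [CommRing B] (θ : Γ((prodC (Gr k m) (Gr k n)).left, boxOpen p.1 p.2) →+* B) :
    θ (boxCoord k m n φ p a) =
      boxMat p.1 ((grMatrix p.2).map (θ.comp
        ((sndC (Gr k m) (Gr k n)).left.appLE (grOpen p.2) (boxOpen p.1 p.2) inf_le_right).hom))
      (φ.map (θ.comp (algebraMap ℂ _)))
      ((grMatrix p.1).map (θ.comp
        ((fstC (Gr k m) (Gr k n)).left.appLE (grOpen p.1) (boxOpen p.1 p.2) inf_le_left).hom))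
      a.2 a.1.1 := by
  simp only [RingHom.coe_comp, ← Matrix.map_map]
  rw [← map_boxMat]
  rfl

/-- The change of coordinates in the product of the quotient by a row space and of the dual of
another row space. -/
lemma box_change {k m n : ℕ} (σ τ : Fin k ↪o Fin m) (τ' : Fin k ↪o Fin n)
    {B : Type} [CommRing B] (M M' : Matrix (Fin k) (Fin m) B) (N N' : Matrix (Fin k) (Fin n) B)
    (hM : M.submatrix id σ = 1) (hM' : M'.submatrix id τ = 1) (h : M' = M'.submatrix id σ * M)
    (h' : N = N.submatrix id τ' * N') [Fintype {j : Fin m // j ∉ Set.range τ}]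
    (Φ : Matrix (Fin n) (Fin m) B) (i : Fin k) (j : Fin m) :
    boxMat σ N Φ M i j = ∑ b : {j : Fin m // j ∉ Set.range τ} × Fin k,
      (projMatrix σ M b.1 j * N i (τ' b.2)) * boxMat τ N' Φ M' b.2 b.1 := by
  simp only [boxMat]
  have h1 : N * Φ * projMatrix σ M = N.submatrix id τ' * (N' * Φ * projMatrix σ M) := by
    conv_lhs => rw [h']
    simp only [Matrix.mul_assoc]
  rw [h1, Matrix.mul_apply, Fintype.sum_prod_type_right]
  refine Finset.sum_congr rfl fun i' _ => ?_
  rw [mul_projMatrix_apply_eq_sum σ τ M M' hM hM' h (N' * Φ), Finset.mul_sum]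
  refine Finset.sum_congr rfl fun l _ => ?_
  simp only [Matrix.submatrix_apply, id]
  ring

lemma isSection_boxCoord (k m n : ℕ) (φ : Matrix (Fin n) (Fin m) ℂ) :
    (quotBoxSubDual k m n).IsSection (boxCoord k m n φ) := by
  rintro ⟨(σ : Fin k ↪o Fin m), (σ' : Fin k ↪o Fin n)⟩ ⟨(τ : Fin k ↪o Fin m), (τ' : Fin k ↪o Fin n)⟩
  funext ⟨(j : {j : Fin m // j ∉ Set.range σ}), (i : Fin k)⟩
  let _ : Fintype {j : Fin m // j ∉ Set.range τ} := (tautQuot k m).fintype τ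
  let X := prodC (Gr k m) (Gr k n)
  let p₁ : X.left ⟶ (Gr k m).left := (fstC (Gr k m) (Gr k n)).left
  let p₂ : X.left ⟶ (Gr k n).left := (sndC (Gr k m) (Gr k n)).left
  let W : X.left.Opens := boxOpen σ σ' ⊓ boxOpen τ τ'
  have hσ : W ≤ p₁ ⁻¹ᵁ grOpen σ := inf_le_left.trans inf_le_left
  have hτ : W ≤ p₁ ⁻¹ᵁ grOpen τ := inf_le_right.trans inf_le_left
  have hσ' : W ≤ p₂ ⁻¹ᵁ grOpen σ' := inf_le_left.trans inf_le_right
  have hτ' : W ≤ p₂ ⁻¹ᵁ grOpen τ' := inf_le_right.trans inf_le_right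
  have h := box_change σ τ τ' ((grMatrix σ).map (p₁.appLE _ W hσ).hom)
    ((grMatrix τ).map (p₁.appLE _ W hτ).hom) ((grMatrix σ').map (p₂.appLE _ W hσ').hom)
    ((grMatrix τ').map (p₂.appLE _ W hτ').hom)
    (grMatrix_map_submatrix _ _) (grMatrix_map_submatrix _ _)
    (grMatrix_rel_appLE τ σ p₁ W hτ hσ) (grMatrix_rel_appLE σ' τ' p₂ W hσ' hτ')
    (φ.map (algebraMap ℂ _)) i j.1
  have key : ∀ (ρ : Fin k ↪o Fin m) (ρ' : Fin k ↪o Fin n) (hρ : W ≤ boxOpen ρ ρ')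
      (a : {j : Fin m // j ∉ Set.range ρ} × Fin k),
      res hρ (boxCoord k m n φ (ρ, ρ') a) =
      boxMat ρ ((grMatrix ρ').map (p₂.appLE _ W (hρ.trans inf_le_right)).hom)
        (φ.map (algebraMap ℂ _)) ((grMatrix ρ).map (p₁.appLE _ W (hρ.trans inf_le_left)).hom)
        a.2 a.1.1 := by
    intro ρ ρ' hρ a
    have e1 : (res hρ).comp (p₁.appLE (grOpen ρ) (boxOpen ρ ρ') inf_le_left).hom =
        (p₁.appLE _ W (hρ.trans inf_le_left)).hom := RingHom.ext fun b => res_appLE p₁ _ hρ b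
    have e2 : (res hρ).comp (p₂.appLE (grOpen ρ') (boxOpen ρ ρ') inf_le_right).hom =
        (p₂.appLE _ W (hρ.trans inf_le_right)).hom := RingHom.ext fun b => res_appLE p₂ _ hρ b
    rw [← e1, ← e2, ← res_algebraMap X hρ]
    exact map_boxCoord k m n φ (ρ, ρ') a (res hρ)
  refine (key σ σ' inf_le_left (j, i)).trans (h.trans (Finset.sum_congr rfl fun b _ => ?_))
  refine congr_arg₂ (· * ·) (congr_arg₂ (· * ·) ?_ ?_) (key τ τ' inf_le_right b).symm
  · rw [← map_projMatrix]
    exact (res_appLE_res p₁ _ _ _ hσ (projMatrix σ (grMatrix σ) b.1.1 j.1)).symm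
  -- The transition matrix of the dual bundle is a restriction of a restriction, because dualizing
  -- exchanges the two open subsets of the overlap; `res_res` merges the two.
  · refine Eq.trans ?_ (congr_arg (fun c => res _ ((p₂.appLE (grOpen σ' ⊓ grOpen τ') _ _).hom c))
      (res_res _ _ (grMatrix σ' i (τ' b.2))).symm)
    exact (res_appLE_res p₂ _ _ _ hσ' (grMatrix σ' i (τ' b.2))).symm

lemma boxCoord_add (k m n : ℕ) (φ ψ : Matrix (Fin n) (Fin m) ℂ)
    (p : (Fin k ↪o Fin m) × (Fin k ↪o Fin n)) (a : {j : Fin m // j ∉ Set.range p.1} × Fin k) :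
    boxCoord k m n (φ + ψ) p a = boxCoord k m n φ p a + boxCoord k m n ψ p a := by
  have : (φ + ψ).map (algebraMap ℂ Γ((prodC (Gr k m) (Gr k n)).left, boxOpen p.1 p.2)) =
      φ.map (algebraMap ℂ _) + ψ.map (algebraMap ℂ _) := by
    ext; simp
  rw [boxCoord, this, boxMat, Matrix.mul_add, Matrix.add_mul]
  rfl

lemma boxCoord_smul (k m n : ℕ) (c : ℂ) (φ : Matrix (Fin n) (Fin m) ℂ)
    (p : (Fin k ↪o Fin m) × (Fin k ↪o Fin n)) (a : {j : Fin m // j ∉ Set.range p.1} × Fin k) :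
    boxCoord k m n (c • φ) p a = c • boxCoord k m n φ p a := by
  have : (c • φ).map (algebraMap ℂ Γ((prodC (Gr k m) (Gr k n)).left, boxOpen p.1 p.2)) =
      c • φ.map (algebraMap ℂ _) := by
    ext; simp [Algebra.smul_def]
  rw [boxCoord, this, boxMat, Matrix.mul_smul, Matrix.smul_mul]
  rfl

/-- The section of `𝒬 ⊠ 𝒰^∨` given by a matrix. -/
def boxSection (k m n : ℕ) : Matrix (Fin n) (Fin m) ℂ →ₗ[ℂ] (quotBoxSubDual k m n).H0 where
  toFun φ := ⟨boxCoord k m n φ, isSection_boxCoord k m n φ⟩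
  map_add' φ ψ := Subtype.ext (funext fun p => funext fun a => boxCoord_add k m n φ ψ p a)
  map_smul' c φ := Subtype.ext (funext fun p => funext fun a => boxCoord_smul k m n c φ p a)

section Points

variable {k m n : ℕ} {T : Scheme.{0}} (h : T ⟶ (prodC (Gr k m) (Gr k n)).left)

lemma comp_prodC_hom :
    h ≫ (prodC (Gr k m) (Gr k n)).hom =
      (h ≫ (sndC (Gr k m) (Gr k n)).left) ≫ (Gr k n).hom := by
  rw [Category.assoc, Over.w]

variable {h}

lemma le_preimage_boxOpen {M : Matrix (Fin k) (Fin m) Γ(T, ⊤)} {N : Matrix (Fin k) (Fin n) Γ(T, ⊤)}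
    {σ : Fin k ↪o Fin m} {σ' : Fin k ↪o Fin n}
    (hM : IsRowSpace (h ≫ (fstC (Gr k m) (Gr k n)).left) M) (hσ : M.submatrix id σ = 1)
    (hN : IsRowSpace (h ≫ (sndC (Gr k m) (Gr k n)).left) N) (hσ' : N.submatrix id σ' = 1) :
    ⊤ ≤ h ⁻¹ᵁ boxOpen σ σ' :=
  le_inf (hM.le_preimage hσ) (hN.le_preimage hσ')

lemma boxCoord_appLE (φ : Matrix (Fin n) (Fin m) ℂ)
    {M : Matrix (Fin k) (Fin m) Γ(T, ⊤)} {N : Matrix (Fin k) (Fin n) Γ(T, ⊤)}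
    {σ : Fin k ↪o Fin m} {σ' : Fin k ↪o Fin n}
    (hM : IsRowSpace (h ≫ (fstC (Gr k m) (Gr k n)).left) M) (hσ : M.submatrix id σ = 1)
    (hN : IsRowSpace (h ≫ (sndC (Gr k m) (Gr k n)).left) N) (hσ' : N.submatrix id σ' = 1)
    (hh : ⊤ ≤ h ⁻¹ᵁ boxOpen σ σ') (a : {j : Fin m // j ∉ Set.range σ} × Fin k) :
    (h.appLE (boxOpen σ σ') ⊤ hh).hom (boxCoord k m n φ (σ, σ') a) =
      boxMat σ N (φ.map (constC (h ≫ (sndC (Gr k m) (Gr k n)).left))) M a.2 a.1.1 := by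
  have h1 := map_boxCoord k m n φ (σ, σ') a (h.appLE (boxOpen σ σ') ⊤ hh).hom
  have e1 : (h.appLE (boxOpen σ σ') ⊤ hh).hom.comp
      ((fstC (Gr k m) (Gr k n)).left.appLE (grOpen σ) (boxOpen σ σ') inf_le_left).hom =
      ((h ≫ (fstC (Gr k m) (Gr k n)).left).appLE (grOpen σ) ⊤ (hM.le_preimage hσ)).hom :=
    congr($(Scheme.Hom.appLE_comp_appLE h _ _ _ _ _ _).hom)
  have e2 : (h.appLE (boxOpen σ σ') ⊤ hh).hom.comp
      ((sndC (Gr k m) (Gr k n)).left.appLE (grOpen σ') (boxOpen σ σ') inf_le_right).hom =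
      ((h ≫ (sndC (Gr k m) (Gr k n)).left).appLE (grOpen σ') ⊤ (hN.le_preimage hσ')).hom :=
    congr($(Scheme.Hom.appLE_comp_appLE h _ _ _ _ _ _).hom)
  have e3 := appLE_top_algebraMap (prodC (Gr k m) (Gr k n)) h (boxOpen σ σ') hh
  rw [comp_prodC_hom] at e3
  rw [← hM.appLE_grMatrix hσ (hM.le_preimage hσ), ← hN.appLE_grMatrix hσ' (hN.le_preimage hσ'),
    constC, ← e1, ← e2, ← e3]
  exact h1

end Points

/-- A pair of morphisms to the two Grassmannians is locally given by a pair of matrices. -/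
lemma exists_local_pair {k k' m n : ℕ} {T : Scheme.{0}} (f₁ : T ⟶ (Gr k' m).left)
    (f₂ : T ⟶ (Gr k n).left) (x : T) :
    ∃ (S : Scheme.{0}) (j : S ⟶ T) (σ : Fin k' ↪o Fin m) (σ' : Fin k ↪o Fin n)
      (M : Matrix (Fin k') (Fin m) Γ(S, ⊤)) (N : Matrix (Fin k) (Fin n) Γ(S, ⊤)),
      IsOpenImmersion j ∧ IsAffine S ∧ x ∈ Set.range j ∧ IsRowSpace (j ≫ f₁) M ∧
      M.submatrix id σ = 1 ∧ IsRowSpace (j ≫ f₂) N ∧ N.submatrix id σ' = 1 := by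
  obtain ⟨S, j, σ, M, hj, -, ⟨y, rfl⟩, -, hM, hσ⟩ := IsRowSpace.exists_local f₁ x ⊤ trivial
  obtain ⟨S', w, σ', N, hw, hS', ⟨z, rfl⟩, -, hN, hσ'⟩ :=
    IsRowSpace.exists_local (j ≫ f₂) y ⊤ trivial
  refine ⟨S', w ≫ j, σ, σ', M.map w.appTop.hom, N, inferInstance, hS', ⟨z, rfl⟩, ?_, ?_, ?_, hσ'⟩
  · rw [Category.assoc]; exact hM.comp w
  · rw [Matrix.submatrix_map, hσ]; simp
  · rwa [Category.assoc]

/-- The zero locus of the section given by `φ` parametrizes the pairs of subspaces such that `φ`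
sends the second to the first. -/
lemma zeroIdeal_boxSection_le_ker_iff {k m n : ℕ} (φ : Matrix (Fin n) (Fin m) ℂ) {T : Scheme.{0}}
    (h : T ⟶ (prodC (Gr k m) (Gr k n)).left) :
    (quotBoxSubDual k m n).zeroIdeal (boxSection k m n φ).2 ≤ h.ker ↔
      Incid φ (h ≫ (fstC (Gr k m) (Gr k n)).left) (h ≫ (sndC (Gr k m) (Gr k n)).left) := by
  have key : ∀ (S : Scheme.{0}) (g : S ⟶ (prodC (Gr k m) (Gr k n)).left) (σ : Fin k ↪o Fin m)
      (σ' : Fin k ↪o Fin n) (M : Matrix (Fin k) (Fin m) Γ(S, ⊤))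
      (N : Matrix (Fin k) (Fin n) Γ(S, ⊤)),
      IsRowSpace (g ≫ (fstC (Gr k m) (Gr k n)).left) M → M.submatrix id σ = 1 →
      IsRowSpace (g ≫ (sndC (Gr k m) (Gr k n)).left) N → N.submatrix id σ' = 1 →
      ((quotBoxSubDual k m n).zeroIdeal (boxSection k m n φ).2 ≤ g.ker ↔
        ∃ A : Matrix (Fin k) (Fin k) Γ(S, ⊤),
          N * φ.map (constC (g ≫ (sndC (Gr k m) (Gr k n)).left)) = A * M) := by
    intro S g σ σ' M N hM hσ hN hσ'
    have hle := le_preimage_boxOpen hM hσ hN hσ'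
    rw [exists_mul_iff_projMatrix σ M hσ]
    refine ((quotBoxSubDual k m n).zeroIdeal_le_ker_iff (boxSection k m n φ).2 g (σ, σ')
      hle).trans ⟨fun h i j => ?_, fun h a => ?_⟩
    · exact (boxCoord_appLE φ hM hσ hN hσ' hle (j, i)).symm.trans (h (j, i))
    · exact (boxCoord_appLE φ hM hσ hN hσ' hle a).trans (h a.2 a.1)
  constructor
  · intro hk
    refine Incid.of_openImmersion fun x => ?_
    obtain ⟨S, j, σ, σ', M, N, hj, -, hx, hM, hσ, hN, hσ'⟩ := exists_local_pair
      (h ≫ (fstC (Gr k m) (Gr k n)).left) (h ≫ (sndC (Gr k m) (Gr k n)).left) x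
    rw [← Category.assoc] at hM hN
    obtain ⟨A, hA⟩ := (key S (j ≫ h) σ σ' M N hM hσ hN hσ').1 (hk.trans (j.le_ker_comp h))
    have := Incid.of_eq_mul hM hN A hA
    simp only [Category.assoc] at this
    exact ⟨S, j, hj, hx, this⟩
  · intro hI
    refine (quotBoxSubDual k m n).zeroIdeal_le_ker_of_openImmersion _ h fun x => ?_
    obtain ⟨S, j, σ, σ', M, N, hj, -, hx, hM, hσ, hN, hσ'⟩ := exists_local_pair
      (h ≫ (fstC (Gr k m) (Gr k n)).left) (h ≫ (sndC (Gr k m) (Gr k n)).left) x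
    have := (hI.comp j).exists_mul hM hN
    rw [← Category.assoc] at hM hN this
    exact ⟨S, j, hj, hx, (key S (j ≫ h) σ σ' M N hM hσ hN hσ').2 this⟩

/-! ### Zero loci under linear automorphisms -/

lemma constC_comp_hom {k n k' n' : ℕ} {T : Scheme.{0}} (f : T ⟶ (Gr k n).left)
    (α : Gr k n ⟶ Gr k' n') : constC (f ≫ α.left) = constC f := by
  simp only [constC, Category.assoc, Over.w]

lemma map_mul_map_eq_one {n : ℕ} {B : Type} [CommRing B] (c : ℂ →+* B)
    {g h : Matrix (Fin n) (Fin n) ℂ} (hgh : g * h = 1) : g.map c * h.map c = 1 := by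
  rw [← Matrix.map_mul, hgh]; simp

lemma ActsAs.rowsIn_iff {k n : ℕ} {α : Gr k n ⟶ Gr k n} {g h : Matrix (Fin n) (Fin n) ℂ}
    (hα : ActsAs α g) (hgh : g * h = 1) {T : Scheme.{0}} (f : T ⟶ (Gr k n).left) {p : Type}
    (L : Matrix p (Fin n) Γ(T, ⊤)) :
    RowsIn f L ↔ RowsIn (f ≫ α.left) (L * g.map (constC f)) := by
  constructor
  · intro hL
    refine RowsIn.of_local fun x => ?_
    obtain ⟨S, j, M, hj, hx, h1, h2⟩ := hα T f x
    obtain ⟨A, hA⟩ := hL S j M h1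
    exact ⟨S, j, _, A, hj, hx, h2, by rw [mul_map_constC_comp, hA, Matrix.mul_assoc]⟩
  · intro hL
    refine RowsIn.of_local fun x => ?_
    obtain ⟨S, j, M, hj, hx, h1, h2⟩ := hα T f x
    obtain ⟨A, hA⟩ := hL S j _ h2
    refine ⟨S, j, M, A, hj, hx, h1, ?_⟩
    rw [mul_map_constC_comp] at hA
    have := congr_arg (fun P : Matrix _ _ _ => P * h.map (constC (j ≫ f))) hA
    simpa only [Matrix.mul_assoc, map_mul_map_eq_one _ hgh, Matrix.mul_one] using this

lemma ActsAs.incid_iff {k k' m n : ℕ} {α : Gr k n ⟶ Gr k n} {g : Matrix (Fin n) (Fin n) ℂ}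
    (hα : ActsAs α g) {T : Scheme.{0}} (f₁ : T ⟶ (Gr k' m).left) (f₂ : T ⟶ (Gr k n).left)
    (φ : Matrix (Fin n) (Fin m) ℂ) :
    Incid (g * φ) f₁ f₂ ↔ Incid φ f₁ (f₂ ≫ α.left) := by
  have key : ∀ (S : Scheme.{0}) (j : S ⟶ T) (M : Matrix (Fin k) (Fin n) Γ(S, ⊤)),
      M * (g * φ).map (constC (j ≫ f₂)) =
        M * g.map (constC (j ≫ f₂)) * φ.map (constC (j ≫ f₂ ≫ α.left)) := by
    intro S j M
    rw [← Category.assoc, constC_comp_hom, Matrix.map_mul, Matrix.mul_assoc]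
  constructor
  · intro hL
    refine Incid.of_openImmersion fun x => ?_
    obtain ⟨S, j, M, hj, hx, h1, h2⟩ := hα T f₂ x
    refine ⟨S, j, hj, hx, Incid.of_rowsIn h2 ?_⟩
    rw [← key]
    exact hL S j M h1
  · intro hL
    refine Incid.of_openImmersion fun x => ?_
    obtain ⟨S, j, M, hj, hx, h1, h2⟩ := hα T f₂ x
    refine ⟨S, j, hj, hx, Incid.of_rowsIn h1 ?_⟩
    rw [key]
    exact hL S j _ h2

lemma constRow_mul_map {n : ℕ} {B : Type} [CommRing B] (c : ℂ →+* B) (v : Fin n → ℂ)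
    (g : Matrix (Fin n) (Fin n) ℂ) : constRow c v * g.map c = constRow c (Matrix.vecMul v g) := by
  ext i j
  simp [constRow, Matrix.mul_apply, Matrix.vecMul, dotProduct]

lemma comap_le_ker_iff {X Y T : Scheme.{0}} (α : X ⟶ Y) (I : Y.IdealSheafData) (f : T ⟶ X) :
    I.comap α ≤ f.ker ↔ I ≤ (f ≫ α).ker := by
  rw [← Scheme.IdealSheafData.le_map_iff_comap_le, Scheme.Hom.ker_comp]

/-- A closed subscheme is determined by the morphisms that factor through it: test each ideal on the
inclusion of the subscheme of the other. -/
lemma idealSheaf_eq_of_le_ker_iff {X : Scheme.{0}} {I J : X.IdealSheafData}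
    (h : ∀ (T : Scheme.{0}) (f : T ⟶ X), I ≤ f.ker ↔ J ≤ f.ker) : I = J := by
  apply le_antisymm
  · have := (h _ J.subschemeι).2
    rw [Scheme.IdealSheafData.ker_subschemeι] at this
    exact this le_rfl
  · have := (h _ I.subschemeι).1
    rw [Scheme.IdealSheafData.ker_subschemeι] at this
    exact this le_rfl

/-- A subspace contains `v` if and only if its image under `g` contains the image of `v`, and this
holds for `T`-valued points. -/
lemma ActsAs.comap_zeroIdeal {k n : ℕ} {α : Gr k n ⟶ Gr k n} {g h : Matrix (Fin n) (Fin n) ℂ}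
    (hα : ActsAs α g) (hgh : g * h = 1) (v : Fin n → ℂ) :
    ((tautQuot k n).zeroIdeal (quotSection k n (Matrix.vecMul v g)).2).comap α.left =
      (tautQuot k n).zeroIdeal (quotSection k n v).2 := by
  refine idealSheaf_eq_of_le_ker_iff fun T f => ?_
  rw [comap_le_ker_iff, zeroIdeal_quotSection_le_ker_iff, zeroIdeal_quotSection_le_ker_iff,
    hα.rowsIn_iff hgh f, constRow_mul_map, constC_comp_hom]

/-- The general linear group acts transitively on nonzero vectors; the transposes turn the action on
columns into one on rows. -/
lemma exists_matrix_vecMul_eq {n : ℕ} {v w : Fin n → ℂ} (hv : v ≠ 0) (hw : w ≠ 0) :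
    ∃ g h : Matrix (Fin n) (Fin n) ℂ, g * h = 1 ∧ Matrix.vecMul v g = w := by
  obtain ⟨A, hA⟩ := SeparatingDual.exists_continuousLinearEquiv_apply_eq (R := ℂ) hv hw
  refine ⟨(LinearMap.toMatrix' (A : (Fin n → ℂ) →ₗ[ℂ] _)).transpose,
    (LinearMap.toMatrix' (A.symm : (Fin n → ℂ) →ₗ[ℂ] _)).transpose, ?_, ?_⟩
  · rw [← Matrix.transpose_mul, ← LinearMap.toMatrix'_comp]
    have : (A.symm : (Fin n → ℂ) →ₗ[ℂ] (Fin n → ℂ)) ∘ₗ (A : (Fin n → ℂ) →ₗ[ℂ] (Fin n → ℂ)) =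
        LinearMap.id := by ext; simp
    rw [this]; simp
  · rw [Matrix.vecMul_transpose, LinearMap.toMatrix'_mulVec]
    exact hA

/-! ### Bordered matrices -/

/-- The block matrix with first row `(1, r)`, first column `(1, 0)ᵀ` and remaining block `M`. -/
def border {k n : ℕ} {B : Type} [CommRing B] (r : Fin n → B) (M : Matrix (Fin k) (Fin n) B) :
    Matrix (Fin (k + 1)) (Fin (n + 1)) B :=
  Matrix.of (Fin.cons (Fin.cons 1 r) fun i => Fin.cons 0 (M i))

section border

variable {k n : ℕ} {B : Type} [CommRing B]

@[simp] lemma border_zero_zero (r : Fin n → B) (M : Matrix (Fin k) (Fin n) B) :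
    border r M 0 0 = 1 := rfl

@[simp] lemma border_zero_succ (r : Fin n → B) (M : Matrix (Fin k) (Fin n) B) (j : Fin n) :
    border r M 0 j.succ = r j := rfl

@[simp] lemma border_succ_zero (r : Fin n → B) (M : Matrix (Fin k) (Fin n) B) (i : Fin k) :
    border r M i.succ 0 = 0 := rfl

@[simp] lemma border_succ_succ (r : Fin n → B) (M : Matrix (Fin k) (Fin n) B) (i : Fin k)
    (j : Fin n) : border r M i.succ j.succ = M i j := rfl

lemma border_mul {l : ℕ} (s : Fin k → B) (G : Matrix (Fin l) (Fin k) B) (r : Fin n → B)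
    (M : Matrix (Fin k) (Fin n) B) :
    border s G * border r M = border (r + Matrix.vecMul s M) (G * M) := by
  ext i j
  rw [Matrix.mul_apply, Fin.sum_univ_succ]
  refine Fin.cases ?_ (fun i => ?_) i <;> refine Fin.cases ?_ (fun j => ?_) j <;>
    simp [Matrix.mul_apply, Matrix.vecMul, dotProduct]

lemma border_zero_one : border (0 : Fin n → B) (1 : Matrix (Fin n) (Fin n) B) = 1 := by
  ext i j
  refine Fin.cases ?_ (fun i => ?_) i <;> refine Fin.cases ?_ (fun j => ?_) j <;>
    simp [Matrix.one_apply, Fin.succ_ne_zero, (Fin.succ_ne_zero _).symm]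

lemma border_map {B' : Type} [CommRing B'] (φ : B →+* B') (r : Fin n → B)
    (M : Matrix (Fin k) (Fin n) B) : (border r M).map φ = border (φ ∘ r) (M.map φ) := by
  ext i j
  refine Fin.cases ?_ (fun i => ?_) i <;> refine Fin.cases ?_ (fun j => ?_) j <;> simp

end border

/-- The increasing embedding with values `0` and the successors of the values of `σ`. -/
def consEmb {k n : ℕ} (σ : Fin k ↪o Fin n) : Fin (k + 1) ↪o Fin (n + 1) :=
  OrderEmbedding.ofStrictMono (Fin.cons 0 fun i => (σ i).succ) (by
    intro i j hij
    induction i using Fin.cases with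
    | zero =>
      induction j using Fin.cases with
      | zero => exact absurd hij (lt_irrefl _)
      | succ j => exact Fin.succ_pos _
    | succ i =>
      induction j using Fin.cases with
      | zero => exact absurd hij (Fin.not_lt_zero _)
      | succ j => exact Fin.succ_lt_succ_iff.2 (σ.strictMono (Fin.succ_lt_succ_iff.1 hij)))

@[simp] lemma consEmb_zero {k n : ℕ} (σ : Fin k ↪o Fin n) : consEmb σ 0 = 0 := rfl

@[simp] lemma consEmb_succ {k n : ℕ} (σ : Fin k ↪o Fin n) (i : Fin k) :
    consEmb σ i.succ = (σ i).succ := rfl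

/-- The increasing embedding with values the successors of the values of `σ`. -/
def succEmb {k n : ℕ} (σ : Fin k ↪o Fin n) : Fin k ↪o Fin (n + 1) :=
  σ.trans (Fin.succOrderEmb n)

@[simp] lemma succEmb_apply {k n : ℕ} (σ : Fin k ↪o Fin n) (i : Fin k) :
    succEmb σ i = (σ i).succ := rfl

/-- This splits the charts into those using column `0`, which can meet the locus of subspaces
containing `e₀`, and those not using it, which miss that locus. -/
lemma eq_consEmb_or_succEmb {k n : ℕ} (σ : Fin (k + 1) ↪o Fin (n + 1)) :
    (∃ ρ, σ = consEmb ρ) ∨ ∃ τ, σ = succEmb τ := by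
  by_cases h : σ 0 = 0
  · have h' : ∀ i : Fin k, σ i.succ ≠ 0 := fun i e => by
      have := σ.injective (e.trans h.symm)
      exact Fin.succ_ne_zero _ this
    refine Or.inl ⟨OrderEmbedding.ofStrictMono (fun i => (σ i.succ).pred (h' i)) ?_, ?_⟩
    · intro i j hij
      simpa [Fin.pred_lt_pred_iff] using hij
    · ext i
      refine Fin.cases ?_ (fun i => ?_) i
      · simp [h]
      · exact congr_arg Fin.val (Fin.succ_pred _ (h' i)).symm
  · have h' : ∀ i, σ i ≠ 0 := fun i e => h (le_antisymm ((σ.monotone (Fin.zero_le i)).trans e.le)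
      (Fin.zero_le _))
    refine Or.inr ⟨OrderEmbedding.ofStrictMono (fun i => (σ i).pred (h' i)) ?_, ?_⟩
    · intro i j hij
      simpa [Fin.pred_lt_pred_iff] using hij
    · ext i
      exact congr_arg Fin.val (Fin.succ_pred _ (h' i)).symm

lemma submatrix_mul_right {p q r s B : Type} [Fintype q] [CommRing B] (A : Matrix p q B)
    (M : Matrix q r B) (c : s → r) : (A * M).submatrix id c = A * M.submatrix id c := rfl

lemma border_submatrix_consEmb {k l n : ℕ} {B : Type} [CommRing B] (r : Fin n → B)
    (M : Matrix (Fin k) (Fin n) B) (σ : Fin l ↪o Fin n) :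
    (border r M).submatrix id (consEmb σ) = border (r ∘ σ) (M.submatrix id σ) := by
  ext i j
  refine Fin.cases ?_ (fun i => ?_) i <;> refine Fin.cases ?_ (fun j => ?_) j <;> simp

lemma isUnit_det_border {k : ℕ} {B : Type} [CommRing B] (r : Fin k → B)
    {G : Matrix (Fin k) (Fin k) B} (h : IsUnit G.det) : IsUnit (border r G).det := by
  refine Matrix.isUnit_det_of_right_inverse (B := border (-Matrix.vecMul r G⁻¹) G⁻¹) ?_
  rw [border_mul, Matrix.mul_nonsing_inv _ h, neg_add_cancel, border_zero_one]

/-- A matrix with the identity in columns containing the first one. -/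
lemma exists_eq_border {k n : ℕ} {B : Type} [CommRing B] {σ : Fin k ↪o Fin n}
    {N : Matrix (Fin (k + 1)) (Fin (n + 1)) B} (h : N.submatrix id (consEmb σ) = 1) :
    N = border (fun j => N 0 j.succ) (N.submatrix Fin.succ Fin.succ) ∧
      (∀ i, N 0 (σ i).succ = 0) ∧ (N.submatrix Fin.succ Fin.succ).submatrix id σ = 1 := by
  have h' : ∀ i j, N i (consEmb σ j) = (1 : Matrix _ _ _) i j :=
    fun i j => congr_fun (congr_fun h i) j
  refine ⟨?_, fun i => ?_, ?_⟩
  · ext i j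
    refine Fin.cases ?_ (fun i => ?_) i <;> refine Fin.cases ?_ (fun j => ?_) j
    · simpa using h' 0 0
    · rfl
    · simpa using h' i.succ 0
    · rfl
  · simpa [Matrix.one_apply, (Fin.succ_ne_zero _).symm] using h' 0 i.succ
  · ext i j
    simpa [Matrix.one_apply] using h' i.succ j.succ

/-! ### Subspaces that contain the first standard basis vector -/

/-- The first standard basis vector. -/
def stdVec (n : ℕ) : Fin (n + 1) → ℂ := Pi.single 0 1

lemma stdVec_ne_zero (n : ℕ) : stdVec n ≠ 0 := by
  simp [stdVec]

lemma constRow_stdVec_zero {n : ℕ} {B : Type} [CommRing B] (c : ℂ →+* B) (i : Fin 1) :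
    constRow c (stdVec n) i 0 = 1 := by
  simp [constRow, stdVec]

lemma constRow_stdVec_succ {n : ℕ} {B : Type} [CommRing B] (c : ℂ →+* B) (i : Fin 1) (j : Fin n) :
    constRow c (stdVec n) i j.succ = 0 := by
  simp [constRow, stdVec]

/-- The subspaces `ℂ ⊕ V`, with `V` varying. -/
lemma exists_hom_border (k n : ℕ) : ∃ ι : Gr k n ⟶ Gr (k + 1) (n + 1),
    ∀ (T : Scheme.{0}) (f : T ⟶ (Gr k n).left) (M : Matrix (Fin k) (Fin n) Γ(T, ⊤)),
      IsRowSpace f M → IsRowSpace (f ≫ ι.left) (border 0 M) := by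
  obtain ⟨ι, hι⟩ := exists_hom_of_matrix_operation (k := k) (n := n)
    (fun B _ c (M : Matrix (Fin k) (Fin n) B) => border 0 M) (by
      intro B B' _ _ φ c M
      rw [border_map]
      congr 1
      ext; simp) (by
      intro B _ c G M
      refine ⟨border 0 G, ?_⟩
      rw [border_mul]; simp) (by
      intro B _ c M R h
      refine ⟨border 0 R, ?_⟩
      rw [border_mul, h]; simp [border_zero_one])
  refine ⟨ι, fun T f M hM => ?_⟩
  obtain ⟨σ, -, -, hσ, -⟩ := id hM
  refine hι T f M hM (consEmb σ) ?_
  rw [border_submatrix_consEmb]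
  exact isUnit_det_border _ hσ

/-- The coefficients expressing `e₀` through the rows of `M` are its entries in the columns `σ'`. If
column `0` is among these, they are `(1, 0, …, 0)` and the first row of `M` is `e₀`. Otherwise they
all vanish, so `1 = 0` on a nonempty scheme. -/
lemma RowsIn.exists_border {k n : ℕ} {T : Scheme.{0}} [Nonempty T]
    {f : T ⟶ (Gr (k + 1) (n + 1)).left} (h : RowsIn f (constRow (constC f) (stdVec n)))
    {M : Matrix (Fin (k + 1)) (Fin (n + 1)) Γ(T, ⊤)} (hM : IsRowSpace f M)
    {σ' : Fin (k + 1) ↪o Fin (n + 1)} (hσ' : M.submatrix id σ' = 1) :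
    ∃ (σ : Fin k ↪o Fin n) (M' : Matrix (Fin k) (Fin n) Γ(T, ⊤)), M = border 0 M' ∧
      M'.submatrix id σ = 1 := by
  obtain ⟨A, hA⟩ := h.exists_mul hM
  have hA' : ∀ j, A 0 j = constRow (constC f) (stdVec n) 0 (σ' j) := by
    intro j
    have h1 := congr_arg (fun P : Matrix _ _ _ => P.submatrix id σ') hA
    simp only [submatrix_mul_right, hσ', Matrix.mul_one] at h1
    exact congr_fun (congr_fun h1.symm 0) j
  rcases eq_consEmb_or_succEmb σ' with ⟨σ, rfl⟩ | ⟨τ, rfl⟩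
  · obtain ⟨e, -, h2⟩ := exists_eq_border hσ'
    refine ⟨σ, _, e.trans ?_, h2⟩
    congr 1
    ext j
    have h3 := congr_fun (congr_fun hA 0) j.succ
    rw [constRow_stdVec_succ, Matrix.mul_apply, Fin.sum_univ_succ] at h3
    simpa [hA', constRow_stdVec_succ, constRow_stdVec_zero] using h3.symm
  · exfalso
    have h3 := congr_fun (congr_fun hA 0) 0
    rw [constRow_stdVec_zero, Matrix.mul_apply] at h3
    simp only [hA', succEmb_apply, constRow_stdVec_succ, zero_mul, Finset.sum_const_zero] at h3
    have : Nonempty (⊤ : T.Opens) := ⟨⟨Classical.arbitrary T, trivial⟩⟩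
    have : Nontrivial Γ(T, ⊤) := Scheme.component_nontrivial T ⊤
    exact one_ne_zero h3

/-- The space `ℂ ⊕ V` determines `V`: the lower right block of a matrix relating two bordered
matrices relates the blocks themselves. -/
lemma mono_of_border {k n : ℕ} (ι : Gr k n ⟶ Gr (k + 1) (n + 1))
    (hι : ∀ (T : Scheme.{0}) (f : T ⟶ (Gr k n).left) (M : Matrix (Fin k) (Fin n) Γ(T, ⊤)),
      IsRowSpace f M → IsRowSpace (f ≫ ι.left) (border 0 M)) : Mono ι.left := by
  refine ⟨fun {T} f g h => hom_ext_of_local _ _ fun x => ?_⟩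
  obtain ⟨S, j, σ, σ', M, N, hj, -, hx, hM, -, hN, -⟩ := exists_local_pair f g x
  refine ⟨S, j, hj, hx, ?_⟩
  have h1 := hι _ _ _ hM
  have h2 := hι _ _ _ hN
  rw [Category.assoc, h, ← Category.assoc] at h1
  obtain ⟨G, hG⟩ := h1.eq_mul h2
  refine hM.ext hN (G.submatrix Fin.succ Fin.succ) ?_ ?_
  · ext a b
    have := congr_fun (congr_fun hG a.succ) b.succ
    rw [Matrix.mul_apply, Fin.sum_univ_succ] at this
    simpa [Matrix.mul_apply] using this
  · have : (f ≫ ι.left) ≫ (Gr (k + 1) (n + 1)).hom = (g ≫ ι.left) ≫ (Gr (k + 1) (n + 1)).hom := by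
      rw [h]
    simp only [Category.assoc, Over.w] at this
    simp only [Category.assoc, this]

/-- A monomorphism through which the same morphisms factor as through the closed immersion of the
zero locus represents the same subfunctor. -/
lemma nonempty_iso_of_factors {X Z : CScheme} (E : VectorBundle X.left) (s : E.H0) (ι : Z ⟶ X)
    [Mono ι.left] (h : E.zeroIdeal s.2 ≤ ι.left.ker)
    (hex : ∀ (T : Scheme.{0}) (f : T ⟶ X.left), E.zeroIdeal s.2 ≤ f.ker → ∃ g, g ≫ ι.left = f) :
    Nonempty (E.zeroLocus s ≅ Z) := by
  obtain ⟨a, ha⟩ := hex _ (E.zeroIdeal s.2).subschemeι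
    (Scheme.IdealSheafData.ker_subschemeι _).ge
  have hker : (E.zeroIdeal s.2).subschemeι.ker ≤ ι.left.ker := by
    rwa [Scheme.IdealSheafData.ker_subschemeι]
  let b := IsClosedImmersion.lift (E.zeroIdeal s.2).subschemeι ι.left hker
  have hb : b ≫ (E.zeroIdeal s.2).subschemeι = ι.left := IsClosedImmersion.lift_fac _ _ _
  have ha' : a ≫ Z.hom = (E.zeroIdeal s.2).subschemeι ≫ X.hom := by
    rw [← Over.w ι, ← Category.assoc, ha]
  let a' : E.zeroLocus s ⟶ Z := Over.homMk a ha'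
  have hb' : b ≫ (E.zeroIdeal s.2).subschemeι ≫ X.hom = Z.hom := by
    rw [← Over.w ι, ← hb, Category.assoc]
  let b' : Z ⟶ E.zeroLocus s := Over.homMk b hb'
  refine ⟨⟨a', b', Over.OverMorphism.ext ?_, Over.OverMorphism.ext ?_⟩⟩
  · change a ≫ b = 𝟙 (E.zeroIdeal s.2).subscheme
    rw [← cancel_mono (E.zeroIdeal s.2).subschemeι, Category.assoc, hb, ha, Category.id_comp]
  · change b ≫ a = 𝟙 Z.left
    rw [← cancel_mono ι.left, Category.assoc, ha, hb, Category.id_comp]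

/-- Local factorizations come from `RowsIn.exists_border`, and they glue because `ι` is a
monomorphism. -/
lemma exists_factor_border {k n : ℕ} (ι : Gr k n ⟶ Gr (k + 1) (n + 1)) [Mono ι.left]
    (hι : ∀ (T : Scheme.{0}) (f : T ⟶ (Gr k n).left) (M : Matrix (Fin k) (Fin n) Γ(T, ⊤)),
      IsRowSpace f M → IsRowSpace (f ≫ ι.left) (border 0 M)) {T : Scheme.{0}}
    (f : T ⟶ (Gr (k + 1) (n + 1)).left) (h : RowsIn f (constRow (constC f) (stdVec n))) :
    ∃ g, g ≫ ι.left = f := by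
  obtain ⟨g, hg⟩ := exists_glue (X := T) (Y := (Gr k n).left)
    (fun S j g => g ≫ ι.left = j ≫ f) (by
      intro S S' w j g _ e
      rw [Category.assoc, e, Category.assoc]) (by
      intro S j g g' _ e e'
      rw [← cancel_mono ι.left, e, e']) (by
      intro x
      obtain ⟨S, j, σ', M, hj, -, ⟨y, rfl⟩, -, hM, hσ'⟩ := IsRowSpace.exists_local f x ⊤ trivial
      have : Nonempty S := ⟨y⟩
      have h' := h.comp j
      rw [constRow_map, ← constC_comp] at h'
      obtain ⟨σ, M', rfl, hσ⟩ := h'.exists_border hM hσ'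
      obtain ⟨g, hg, hg'⟩ := IsRowSpace.exists_of_isUnit ((j ≫ f) ≫ (Gr (k + 1) (n + 1)).hom) M' σ
        (by rw [hσ]; simp)
      refine ⟨S, j, g, hj, ⟨y, rfl⟩, (hι _ _ _ hg).ext hM 1 (by simp) ?_⟩
      rw [Category.assoc, Over.w, hg'])
  refine ⟨g, hom_ext_of_local _ _ fun x => ?_⟩
  obtain ⟨S, j, hj, hx, e⟩ := hg x
  exact ⟨S, j, hj, hx, by rw [← Category.assoc, e]⟩

lemma rowsIn_border {k n : ℕ} (ι : Gr k n ⟶ Gr (k + 1) (n + 1))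
    (hι : ∀ (T : Scheme.{0}) (f : T ⟶ (Gr k n).left) (M : Matrix (Fin k) (Fin n) Γ(T, ⊤)),
      IsRowSpace f M → IsRowSpace (f ≫ ι.left) (border 0 M)) :
    RowsIn ι.left (constRow (constC ι.left) (stdVec n)) := by
  refine RowsIn.of_openImmersion fun x => ?_
  obtain ⟨S, j, σ, M, hj, -, hx, -, hM, -⟩ :=
    IsRowSpace.exists_local (𝟙 (Gr k n).left) x ⊤ trivial
  rw [Category.comp_id] at hM
  refine ⟨S, j, hj, hx, RowsIn.of_eq_mul (hι _ _ _ hM) (Matrix.of fun _ => Fin.cons 1 0) ?_⟩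
  rw [constRow_map]
  ext a b
  rw [Matrix.mul_apply, Fin.sum_univ_succ]
  refine Fin.cases ?_ (fun b => ?_) b <;> simp [constRow_stdVec_zero, constRow_stdVec_succ]

/-- The subspaces containing a given nonzero vector form a Grassmannian. -/
theorem nonempty_zeroLocus_quotSection_iso {k n : ℕ} {v : Fin (n + 1) → ℂ} (hv : v ≠ 0) :
    Nonempty ((tautQuot (k + 1) (n + 1)).zeroLocus (quotSection (k + 1) (n + 1) v) ≅ Gr k n) := by
  -- Reduction to `v = e₀`: the embedding of the smaller Grassmannian is `V ↦ ℂ ⊕ V` followed by the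
  -- inverse of the automorphism taking `v` to `e₀`.
  obtain ⟨g, h, hgh, hg⟩ := exists_matrix_vecMul_eq hv (stdVec_ne_zero n)
  obtain ⟨α, hα⟩ := exists_aut (k + 1) g h hgh
  obtain ⟨ι, hι⟩ := exists_hom_border k n
  have := mono_of_border ι hι
  have key : ∀ (T : Scheme.{0}) (f : T ⟶ (Gr (k + 1) (n + 1)).left),
      (tautQuot (k + 1) (n + 1)).zeroIdeal (quotSection (k + 1) (n + 1) v).2 ≤ f.ker ↔
        RowsIn (f ≫ α.hom.left) (constRow (constC (f ≫ α.hom.left)) (stdVec n)) := by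
    intro T f
    rw [zeroIdeal_quotSection_le_ker_iff, hα.rowsIn_iff hgh f, constRow_mul_map, constC_comp_hom, hg]
  have : Mono (ι ≫ α.inv).left := by
    rw [Over.comp_left]; infer_instance
  have e1 : α.inv.left ≫ α.hom.left = 𝟙 _ := by rw [← Over.comp_left, α.inv_hom_id]; rfl
  have e2 : α.hom.left ≫ α.inv.left = 𝟙 _ := by rw [← Over.comp_left, α.hom_inv_id]; rfl
  refine nonempty_iso_of_factors _ _ (ι ≫ α.inv) ?_ fun T f hf => ?_
  · rw [key, Over.comp_left, Category.assoc, e1, Category.comp_id]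
    exact rowsIn_border ι hι
  · obtain ⟨g, hg⟩ := exists_factor_border ι hι _ ((key T f).1 hf)
    refine ⟨g, ?_⟩
    rw [Over.comp_left, ← Category.assoc, hg, Category.assoc, e2, Category.comp_id]

/-! ### Linear algebra for the blow-up -/

/-- The matrix of the projection that forgets the first coordinate. -/
def dropMatrix (n : ℕ) : Matrix (Fin (n + 1)) (Fin n) ℂ :=
  (1 : Matrix (Fin (n + 1)) (Fin (n + 1)) ℂ).submatrix id Fin.succ

section linear

variable {k n : ℕ} {B : Type} [CommRing B]

lemma mul_dropMatrix_map {p : Type} (c : ℂ →+* B) (N : Matrix p (Fin (n + 1)) B) :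
    N * (dropMatrix n).map c = N.submatrix id Fin.succ := by
  ext i j
  simp [dropMatrix, Matrix.mul_apply, Matrix.one_apply, apply_ite c]

lemma constRow_stdVec_mul {p : Type} (c : ℂ →+* B) (P : Matrix (Fin (n + 1)) p B) (i : Fin 1)
    (j : p) : (constRow c (stdVec n) * P) i j = P 0 j := by
  rw [Matrix.mul_apply, Fin.sum_univ_succ]
  simp [constRow_stdVec_zero, constRow_stdVec_succ]

lemma projMatrix_consEmb_zero (σ : Fin k ↪o Fin n) (N : Matrix (Fin (k + 1)) (Fin (n + 1)) B)
    (j : Fin n) : projMatrix (consEmb σ) N 0 j.succ = -N 0 j.succ := by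
  simp only [projMatrix, Matrix.sub_apply, Matrix.mul_apply, Fin.sum_univ_succ]
  simp [Matrix.one_apply, (Fin.succ_ne_zero _).symm]

/-- In a chart using column `0` the first row is `(1, r)`, so `e₀` is congruent to `-(0, r)` modulo
the row space. The entries of `r` in the columns `σ` vanish, so it does no harm to include them
among the generators. -/
lemma span_projMatrix_consEmb (c : ℂ →+* B) {σ : Fin k ↪o Fin n}
    {N : Matrix (Fin (k + 1)) (Fin (n + 1)) B} (hN : N.submatrix id (consEmb σ) = 1) :
    Ideal.span (Set.range fun j : {j : Fin (n + 1) // j ∉ Set.range (consEmb σ)} =>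
      (constRow c (stdVec n) * projMatrix (consEmb σ) N) 0 j) =
      Ideal.span (Set.range fun j : Fin n => N 0 j.succ) := by
  obtain ⟨-, h0, -⟩ := exists_eq_border hN
  apply le_antisymm <;> rw [Ideal.span_le]
  · rintro _ ⟨⟨j, hj⟩, rfl⟩
    induction j using Fin.cases with
    | zero => exact absurd ⟨0, rfl⟩ hj
    | succ j =>
      simp only [constRow_stdVec_mul, projMatrix_consEmb_zero, SetLike.mem_coe, neg_mem_iff]
      exact Ideal.subset_span ⟨j, rfl⟩
  · rintro _ ⟨j, rfl⟩
    by_cases hj : j.succ ∈ Set.range (consEmb σ)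
    · obtain ⟨i, hi⟩ := hj
      induction i using Fin.cases with
      | zero => exact absurd hi.symm (Fin.succ_ne_zero _)
      | succ i =>
        simp only [← hi, consEmb_succ, h0]
        exact Ideal.zero_mem _
    · have := Ideal.subset_span (α := B) (s := Set.range
        fun j : {j : Fin (n + 1) // j ∉ Set.range (consEmb σ)} =>
          (constRow c (stdVec n) * projMatrix (consEmb σ) N) 0 j) ⟨⟨j.succ, hj⟩, rfl⟩
      simpa only [constRow_stdVec_mul, projMatrix_consEmb_zero, SetLike.mem_coe,
        neg_mem_iff] using this

/-- Where the ideal of the centre is generated by a nonzerodivisor `d`, the image of the row space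
of `N` under the projection generates a unique row space of full rank. -/
lemma exists_saturation (c : ℂ →+* B) {σ' : Fin (k + 1) ↪o Fin (n + 1)}
    {N : Matrix (Fin (k + 1)) (Fin (n + 1)) B} (hN : N.submatrix id σ' = 1) {d : B}
    (hd : d ∈ nonZeroDivisors B)
    (hspan : Ideal.span (Set.range fun j : {j : Fin (n + 1) // j ∉ Set.range σ'} =>
      (constRow c (stdVec n) * projMatrix σ' N) 0 j) = Ideal.span {d}) :
    ∃ (V : Matrix (Fin (k + 1)) (Fin n) B) (A E : Matrix (Fin (k + 1)) (Fin (k + 1)) B)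
      (R : Matrix (Fin n) (Fin (k + 1)) B), N.submatrix id Fin.succ = A * V ∧
        d • V = E * N.submatrix id Fin.succ ∧ V * R = 1 := by
  rcases eq_consEmb_or_succEmb σ' with ⟨σ, rfl⟩ | ⟨τ, rfl⟩
  · rw [span_projMatrix_consEmb c hN] at hspan
    obtain ⟨e, h0, h1⟩ := exists_eq_border hN
    set N' := N.submatrix Fin.succ Fin.succ with hN'
    have hcan : ∀ a b : B, d * a = d * b → a = b := fun a b h =>
      (mul_cancel_left_mem_nonZeroDivisors hd).1 h
    -- The first row without its leading `1` is `d` times a vector `u`. Since its entries also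
    -- generate `d`, cancelling `d` shows that `u` is unimodular.
    have hu : ∀ j, ∃ u, d * u = N 0 (Fin.succ j) := by
      intro j
      have : N 0 j.succ ∈ Ideal.span {d} := by
        rw [← hspan]
        exact Ideal.subset_span ⟨j, rfl⟩
      obtain ⟨u, hu⟩ := Ideal.mem_span_singleton.1 this
      exact ⟨u, hu.symm⟩
    choose u hu using hu
    have hd' : d ∈ Ideal.span (Set.range fun j : Fin n => N 0 j.succ) := by
      rw [hspan]; exact Ideal.subset_span rfl
    obtain ⟨x, hx⟩ := Ideal.mem_span_range_iff_exists_fun.1 hd'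
    have hux : ∑ j, u j * x j = 1 := by
      apply hcan
      rw [mul_one, Finset.mul_sum]
      refine Eq.trans (Finset.sum_congr rfl fun j _ => ?_) hx
      rw [← hu]; ring
    have huσ : ∀ i, u (σ i) = 0 := fun i => hcan _ _ (by rw [hu, h0, mul_zero])
    have h1' : ∀ i j, N' i (σ j) = (1 : Matrix _ _ _) i j :=
      fun i j => congr_fun (congr_fun h1 i) j
    -- `V` is `N` without column `0` and with its first row divided by `d`. In the right inverse the
    -- later columns are the unit vectors of the positions `σ`, where `u` vanishes. The first column
    -- is `x`, corrected at these positions so that the rows of `N'` annihilate it.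
    refine ⟨Matrix.of (Fin.cons u fun i => N' i), Matrix.diagonal (Fin.cons d 1),
      Matrix.diagonal (Fin.cons 1 fun _ => d),
      Matrix.of fun l => Fin.cons (x l - ∑ i, (∑ j, N' i j * x j) * (1 : Matrix _ _ _) l (σ i))
        fun i => (1 : Matrix _ _ _) l (σ i), ?_, ?_, ?_⟩
    · ext i j
      refine Fin.cases ?_ (fun i => ?_) i
      · simp [Matrix.diagonal_mul, hu]
      · simp [Matrix.diagonal_mul, hN']
    · ext i j
      refine Fin.cases ?_ (fun i => ?_) i
      · simp [Matrix.diagonal_mul, hu]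
      · simp [Matrix.diagonal_mul, hN']
    · have hsum : ∀ y : Fin n → B, ∑ l, y l * (x l - ∑ i, (∑ j, N' i j * x j) *
          (1 : Matrix _ _ _) l (σ i)) = ∑ l, y l * x l - ∑ i, (∑ j, N' i j * x j) * y (σ i) := by
        intro y
        simp only [mul_sub, Finset.sum_sub_distrib]
        congr 1
        simp only [Finset.mul_sum]
        rw [Finset.sum_comm]
        refine Finset.sum_congr rfl fun i _ => ?_
        simp [Matrix.one_apply, mul_comm]
      ext i j
      rw [Matrix.mul_apply]
      refine Fin.cases ?_ (fun i => ?_) i <;> refine Fin.cases ?_ (fun j => ?_) j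
      · simp [hsum, hux, huσ]
      · simp [Matrix.one_apply, huσ, (Fin.succ_ne_zero _).symm]
      · simp only [Matrix.of_apply, Fin.cons_succ, Fin.cons_zero, hsum, h1']
        simp [Matrix.one_apply]
      · simp only [Matrix.of_apply, Fin.cons_succ, Matrix.one_apply, mul_ite, mul_one, mul_zero,
          Finset.sum_ite_eq', Finset.mem_univ, if_true, h1', Fin.succ_inj]
  -- Here column `0` is not among the normalized ones, so the image of the row space already has
  -- full rank and is itself the answer.
  · refine ⟨N.submatrix id Fin.succ, 1, Matrix.diagonal fun _ => d,
      (1 : Matrix (Fin n) (Fin n) B).submatrix id τ, ?_, ?_, ?_⟩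
    · rw [Matrix.one_mul]
    · ext i j; simp [Matrix.diagonal_mul]
    · rw [← hN]
      ext i j
      simp [Matrix.mul_apply, Matrix.one_apply]

/-- The quotient by the row space of `M` is free, so a nonzerodivisor can be cancelled in it. -/
lemma exists_mul_of_smul_eq {σ : Fin k ↪o Fin n} {p : Type} {M : Matrix (Fin k) (Fin n) B}
    (hM : M.submatrix id σ = 1) {d : B} (hd : d ∈ nonZeroDivisors B) {V : Matrix p (Fin n) B}
    {A : Matrix p (Fin k) B} (h : d • V = A * M) : ∃ G : Matrix p (Fin k) B, V = G * M := by
  rw [exists_mul_iff_projMatrix σ M hM]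
  intro i j
  have h1 := (exists_mul_iff_projMatrix σ M hM (d • V)).1 ⟨A, h⟩ i j
  rw [Matrix.smul_mul, Matrix.smul_apply, smul_eq_mul] at h1
  exact (mul_cancel_left_mem_nonZeroDivisors hd).1 (h1.trans (mul_zero d).symm)

/-- The matrix whose row space is sent to that of `M` by the projection, with coordinates `z` in
the chart of the blow-up. -/
def blowMatrix (M : Matrix (Fin (k + 1)) (Fin n) B) (z : Fin (k + 1) → B) :
    Matrix (Fin (k + 1)) (Fin (n + 1)) B :=
  border (fun j => z 0 * M 0 j) (Matrix.of fun i j => M i.succ j + z i.succ * M 0 j)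

lemma blowMatrix_map {B' : Type} [CommRing B'] (f : B →+* B') (M : Matrix (Fin (k + 1)) (Fin n) B)
    (z : Fin (k + 1) → B) : (blowMatrix M z).map f = blowMatrix (M.map f) (f ∘ z) := by
  rw [blowMatrix, border_map, blowMatrix]
  congr 1
  · ext; simp
  · ext; simp

lemma blowMatrix_submatrix (M : Matrix (Fin (k + 1)) (Fin n) B) (z : Fin (k + 1) → B)
    {b : Fin n} {σ : Fin k ↪o Fin n}
    (hM : M.submatrix id (Fin.cons b σ : Fin (k + 1) → Fin n) = 1) :
    (blowMatrix M z).submatrix id (consEmb σ) = 1 := by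
  have h : ∀ i j, M i (σ j) = (1 : Matrix _ _ _) i j.succ :=
    fun i j => congr_fun (congr_fun hM i) j.succ
  rw [blowMatrix, border_submatrix_consEmb, ← border_zero_one]
  congr 1
  · ext i; simp [h, (Fin.succ_ne_zero _).symm]
  · ext i j; simp [h, Matrix.one_apply, (Fin.succ_ne_zero _).symm]

/-- The parameters `z` can be read off in column `b`. Hence they are honest coordinates, and `z 0`
lies in the ideal of the centre. -/
lemma blowMatrix_apply (M : Matrix (Fin (k + 1)) (Fin n) B) (z : Fin (k + 1) → B)
    {b : Fin n} {σ : Fin k ↪o Fin n}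
    (hM : M.submatrix id (Fin.cons b σ : Fin (k + 1) → Fin n) = 1) (i : Fin (k + 1)) :
    blowMatrix M z i b.succ = z i := by
  have h : ∀ i, M i b = (1 : Matrix _ (Fin (k + 1)) _) i 0 := fun i => congr_fun (congr_fun hM i) 0
  refine Fin.cases ?_ (fun i => ?_) i
  · simp [blowMatrix, h]
  · simp [blowMatrix, h, Fin.succ_ne_zero]

lemma exists_blowMatrix_eq_mul (M : Matrix (Fin (k + 1)) (Fin n) B) (z : Fin (k + 1) → B) :
    ∃ A : Matrix (Fin (k + 1)) (Fin (k + 1)) B,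
      (blowMatrix M z).submatrix id Fin.succ = A * M := by
  refine ⟨Matrix.of (Fin.cons (Fin.cons (z 0) 0)
    fun i => Fin.cons (z i.succ) ((1 : Matrix _ _ _) i)), ?_⟩
  ext i j
  rw [Matrix.mul_apply, Fin.sum_univ_succ]
  refine Fin.cases ?_ (fun i => ?_) i
  · simp [blowMatrix]
  · simp [blowMatrix, Matrix.one_apply, add_comm]

/-- Since `M` is the identity in the columns `(b, σ)`, the coefficients `A` are the entries of `N`
in the corresponding columns. Those over `σ` are fixed by the normalization of `N`, so only those
over `b` are free. -/
lemma eq_blowMatrix {M : Matrix (Fin (k + 1)) (Fin n) B} {b : Fin n} {σ : Fin k ↪o Fin n}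
    (hM : M.submatrix id (Fin.cons b σ : Fin (k + 1) → Fin n) = 1)
    {N : Matrix (Fin (k + 1)) (Fin (n + 1)) B} (hN : N.submatrix id (consEmb σ) = 1)
    {A : Matrix (Fin (k + 1)) (Fin (k + 1)) B} (h : N.submatrix id Fin.succ = A * M) :
    N = blowMatrix M fun i => N i b.succ := by
  obtain ⟨e, h0, h1⟩ := exists_eq_border hN
  have h1' : ∀ i j : Fin k, N i.succ (σ j).succ = (1 : Matrix _ _ _) i j :=
    fun i j => congr_fun (congr_fun h1 i) j
  have hA : ∀ i l, A i l = N i (Fin.succ ((Fin.cons b σ : Fin (k + 1) → Fin n) l)) := by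
    intro i l
    have := congr_arg (fun P : Matrix _ _ _ =>
      P.submatrix id (Fin.cons b σ : Fin (k + 1) → Fin n)) h
    simp only [submatrix_mul_right, hM, Matrix.mul_one] at this
    exact (congr_fun (congr_fun this i) l).symm
  have hent : ∀ i j, N i (Fin.succ j) = N i b.succ * M 0 j + ∑ l, N i (σ l).succ * M l.succ j := by
    intro i j
    have := congr_fun (congr_fun h i) j
    rw [Matrix.mul_apply, Fin.sum_univ_succ] at this
    simpa [hA] using this
  rw [e, blowMatrix]
  congr 1
  · ext j; simp [hent 0 j, h0]
  · ext i j
    simp [hent i.succ j, h1', Matrix.one_apply, add_comm]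

/-- The `k` columns `σ` are annihilated by some nonzero form `ρ`. As `M` has a right inverse, `ρ` is
nonzero on some column `b`. In a linear relation between the columns `b` and `σ`, applying `ρ` kills
the coefficient of `b`, and the rows of `A` then kill the others. -/
lemma exists_det_ne_zero {K q : Type} [Field K] [Fintype q] {M : Matrix (Fin (k + 1)) q K}
    {R : Matrix q (Fin (k + 1)) K} (hR : M * R = 1) {σ : Fin k → q}
    {A : Matrix (Fin k) (Fin (k + 1)) K} (hA : (A * M).submatrix id σ = 1) :
    ∃ b, (M.submatrix id (Fin.cons b σ : Fin (k + 1) → q)).det ≠ 0 := by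
  -- An added zero column makes the matrix of the columns `σ` square and singular.
  obtain ⟨ρ, hρ, h0⟩ := Matrix.exists_vecMul_eq_zero_iff.2
    (Matrix.det_eq_zero_of_column_eq_zero (A := Matrix.of fun i =>
      (Fin.cons 0 fun j => M i (σ j) : Fin (k + 1) → K)) 0 (fun i => rfl))
  have h0' : ∀ j, ∑ i, ρ i * M i (σ j) = 0 := fun j => congr_fun h0 j.succ
  have h1 : ∃ b, (Matrix.vecMul ρ M) b ≠ 0 := by
    by_contra! h
    have h2 : Matrix.vecMul ρ M = 0 := funext h
    apply hρ
    rw [← Matrix.vecMul_one ρ, ← hR, ← Matrix.vecMul_vecMul, h2, Matrix.zero_vecMul]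
  obtain ⟨b, hb⟩ := h1
  refine ⟨b, fun hdet => ?_⟩
  obtain ⟨v, hv, hv0⟩ := Matrix.exists_mulVec_eq_zero_iff.2 hdet
  have hv0' : ∀ i, M i b * v 0 + ∑ j, M i (σ j) * v j.succ = 0 := by
    intro i
    have := congr_fun hv0 i
    rw [Matrix.mulVec, dotProduct, Fin.sum_univ_succ] at this
    simpa using this
  have hlin : ∀ y : Fin (k + 1) → K, (∑ i, y i * M i b) * v 0 +
      ∑ j, (∑ i, y i * M i (σ j)) * v j.succ = 0 := by
    intro y
    have : ∑ i, y i * (M i b * v 0 + ∑ j, M i (σ j) * v j.succ) = 0 :=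
      Finset.sum_eq_zero fun i _ => by rw [hv0', mul_zero]
    rw [← this]
    simp only [mul_add, Finset.sum_add_distrib, Finset.sum_mul, Finset.mul_sum, mul_assoc]
    congr 1
    rw [Finset.sum_comm]
  have hz : v 0 = 0 := by
    have := hlin ρ
    simp only [h0', zero_mul, Finset.sum_const_zero, add_zero] at this
    exact (mul_eq_zero.1 this).resolve_left hb
  have hs : ∀ i : Fin k, v i.succ = 0 := by
    intro i
    have hA' : ∀ j, ∑ l, A i l * M l (σ j) = (1 : Matrix _ _ _) i j :=
      fun j => congr_fun (congr_fun hA i) j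
    have := hlin (A i)
    simpa [hz, hA', Matrix.one_apply] using this
  exact hv (funext fun i => Fin.cases hz hs i)

end linear

/-! ### The incidence variety is the blow-up -/

/-- Open immersions are flat, and nonzerodivisors stay regular under flat base change. -/
lemma appTop_mem_nonZeroDivisors {S T : Scheme.{0}} [IsAffine S] [IsAffine T] (j : S ⟶ T)
    [IsOpenImmersion j] {d : Γ(T, ⊤)} (hd : d ∈ nonZeroDivisors Γ(T, ⊤)) :
    j.appTop.hom d ∈ nonZeroDivisors Γ(S, ⊤) := by
  have hflat : j.appTop.hom.Flat := j.flat_appTop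
  algebraize [j.appTop.hom]
  have h := Module.Flat.isSMulRegular_of_nonZeroDivisors (M := Γ(S, ⊤)) hd
  rw [mem_nonZeroDivisors_iff_right]
  intro z hz
  refine h ?_
  change d • z = d • 0
  rw [Algebra.smul_def, smul_zero, mul_comm]
  exact hz

lemma IsEffectiveCartier.comap {X S : Scheme.{0}} {I : X.IdealSheafData}
    (h : IsEffectiveCartier I) (j : S ⟶ X) [IsOpenImmersion j] :
    IsEffectiveCartier (I.comap j) := by
  refine isEffectiveCartier_of_local _ fun x => ?_
  obtain ⟨S', j', hS', hj', ⟨y, hy⟩, hr, d, hd, he⟩ := h.exists_local (j x) j.opensRange ⟨x, rfl⟩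
  have e : IsOpenImmersion.lift j j' hr ≫ j = j' := IsOpenImmersion.lift_fac _ _ _
  have : IsOpenImmersion (IsOpenImmersion.lift j j' hr ≫ j) := by rwa [e]
  refine ⟨S', IsOpenImmersion.lift j j' hr, hS', IsOpenImmersion.of_comp _ j, ⟨y, ?_⟩, d, hd, ?_⟩
  · apply j.isOpenEmbedding.injective
    rw [← Scheme.Hom.comp_apply, e, hy]
  · rw [← he, ← Scheme.IdealSheafData.comap_comp, e]

lemma IsRowSpace.eq_of_submatrix_eq_one {k n : ℕ} {T : Scheme.{0}} {f : T ⟶ (Gr k n).left}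
    {M M' : Matrix (Fin k) (Fin n) Γ(T, ⊤)} (hM : IsRowSpace f M) (hM' : IsRowSpace f M')
    {σ : Fin k ↪o Fin n} (h : M.submatrix id σ = 1) (h' : M'.submatrix id σ = 1) : M = M' := by
  obtain ⟨G, hG⟩ := hM.eq_mul hM'
  have : G = 1 := by
    rw [← h, hG, submatrix_mul_right, h', Matrix.mul_one]
  rw [hG, this, Matrix.one_mul]

/-- The columns `(b, σ)` of a chart of the incidence variety are not in increasing order; permuting
rows compensates for sorting them. -/
lemma IsRowSpace.permute {k n : ℕ} {T : Scheme.{0}} {f : T ⟶ (Gr k n).left}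
    {M : Matrix (Fin k) (Fin n) Γ(T, ⊤)} (hM : IsRowSpace f M) (e : Equiv.Perm (Fin k)) :
    IsRowSpace f (M.submatrix e id) := by
  obtain ⟨σ, -, -, hσ, -⟩ := id hM
  have hu : IsUnit ((M.submatrix e id).submatrix id σ).det := by
    have : (M.submatrix e id).submatrix id σ = (M.submatrix id σ).submatrix e id := rfl
    rw [this, Matrix.det_permute]
    exact (((Equiv.Perm.sign e).isUnit.map (Int.castRingHom _))).mul hσ
  obtain ⟨g, hg, hg'⟩ := IsRowSpace.exists_of_isUnit (f ≫ (Gr k n).hom) _ σ hu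
  have : g = f := hg.ext hM ((1 : Matrix (Fin k) (Fin k) Γ(T, ⊤)).submatrix e id) (by
    ext i j
    simp [Matrix.mul_apply, Matrix.one_apply]) hg'
  rwa [← this]

lemma exists_chart_of_le {k n : ℕ} {T : Scheme.{0}} (f : T ⟶ (Gr k n).left) (σ : Fin k ↪o Fin n)
    (h : ∀ x, f x ∈ grOpen σ) : ∃ w : T ⟶ chart σ, w ≫ grι σ = f := by
  have hr : Set.range f ⊆ Set.range (grι σ) := by
    rintro _ ⟨x, rfl⟩
    obtain ⟨y, -, hy⟩ := h x
    exact ⟨y, hy⟩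
  exact ⟨IsOpenImmersion.lift (grι σ) f hr, IsOpenImmersion.lift_fac _ _ _⟩

/-- The ideal of the subspaces containing the first standard basis vector. -/
abbrev stdIdeal (k n : ℕ) : (Gr k (n + 1)).left.IdealSheafData :=
  (tautQuot k (n + 1)).zeroIdeal (quotSection k (n + 1) (stdVec n)).2

lemma exists_mem_grOpen {k n : ℕ} (x : (Gr k n).left) : ∃ σ : Fin k ↪o Fin n, x ∈ grOpen σ := by
  have : x ∈ ⨆ σ : Fin k ↪o Fin n, grOpen σ := by rw [iSup_grOpen]; trivial
  exact TopologicalSpace.Opens.mem_iSup.1 this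

/-- The local form of a morphism that pulls the centre back to a Cartier divisor. -/
lemma exists_local_saturation {k n : ℕ} {T : Scheme.{0}} (f : T ⟶ (Gr (k + 1) (n + 1)).left)
    (hf : IsEffectiveCartier ((stdIdeal (k + 1) n).comap f)) (x : T) :
    ∃ (S : Scheme.{0}) (j : S ⟶ T) (N : Matrix (Fin (k + 1)) (Fin (n + 1)) Γ(S, ⊤))
      (V : Matrix (Fin (k + 1)) (Fin n) Γ(S, ⊤)) (A E : Matrix (Fin (k + 1)) (Fin (k + 1)) Γ(S, ⊤))
      (d : Γ(S, ⊤)) (g : S ⟶ (Gr (k + 1) n).left), IsOpenImmersion j ∧ IsAffine S ∧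
      x ∈ Set.range j ∧ IsRowSpace (j ≫ f) N ∧ d ∈ nonZeroDivisors Γ(S, ⊤) ∧
      N.submatrix id Fin.succ = A * V ∧ d • V = E * N.submatrix id Fin.succ ∧ IsRowSpace g V ∧
      g ≫ (Gr (k + 1) n).hom = (j ≫ f) ≫ (Gr (k + 1) (n + 1)).hom := by
  obtain ⟨σ', hσ'⟩ := exists_mem_grOpen (f x)
  obtain ⟨S, j, hS, hj, ⟨y, rfl⟩, hr, d, hd, he⟩ := hf.exists_local x (f ⁻¹ᵁ grOpen σ') hσ'
  obtain ⟨w, hw⟩ := exists_chart_of_le (j ≫ f) σ' (fun y => hr ⟨y, rfl⟩)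
  obtain ⟨hN, hN1⟩ := IsRowSpace.of_chart σ' w
  rw [hw] at hN
  set N := (chartMatrix σ').map (pt w) with hNdef
  rw [← Scheme.IdealSheafData.comap_comp, comap_zeroIdeal_quotSection _ hN hN1] at he
  obtain ⟨V, A, E, R, h1, h2, h3⟩ := exists_saturation _ hN1 hd he
  obtain ⟨S', u, σ, hu, hS', ⟨z, rfl⟩, hσ⟩ := exists_local_minor V R h3 y
  obtain ⟨g, hg, hg'⟩ := IsRowSpace.exists_of_isUnit ((u ≫ j ≫ f) ≫ (Gr (k + 1) (n + 1)).hom) _ σ hσ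
  refine ⟨S', u ≫ j, N.map u.appTop.hom, V.map u.appTop.hom, A.map u.appTop.hom,
    E.map u.appTop.hom, u.appTop.hom d, g, inferInstance, hS', ⟨z, rfl⟩, ?_,
    appTop_mem_nonZeroDivisors u hd, ?_, ?_, hg, ?_⟩
  · rw [Category.assoc]; exact hN.comp u
  · rw [← Matrix.map_mul, ← h1]; rfl
  · have := congr_arg (fun P : Matrix _ _ _ => P.map u.appTop.hom) h2
    simp only [Matrix.map_mul] at this
    rw [Matrix.submatrix_map, ← this]
    ext; simp
  · rw [hg', Category.assoc u j f]

/-- The incidence puts the image of `N` into the row space `f₁`, hence also `d • V`. Cancelling `d`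
puts the rows of `V` there, and a containment of row spaces of equal rank is an equality. -/
lemma eq_of_incid_of_saturation {k n : ℕ} {S : Scheme.{0}} [IsAffine S]
    {f₁ g : S ⟶ (Gr (k + 1) n).left} {f₂ : S ⟶ (Gr (k + 1) (n + 1)).left}
    (hI : Incid (dropMatrix n) f₁ f₂) {N : Matrix (Fin (k + 1)) (Fin (n + 1)) Γ(S, ⊤)}
    (hN : IsRowSpace f₂ N) {V : Matrix (Fin (k + 1)) (Fin n) Γ(S, ⊤)} (hg : IsRowSpace g V)
    {d : Γ(S, ⊤)} (hd : d ∈ nonZeroDivisors Γ(S, ⊤))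
    {E : Matrix (Fin (k + 1)) (Fin (k + 1)) Γ(S, ⊤)} (h : d • V = E * N.submatrix id Fin.succ)
    (e : g ≫ (Gr (k + 1) n).hom = f₁ ≫ (Gr (k + 1) n).hom) : g = f₁ := by
  refine hom_ext_of_local _ _ fun x => ?_
  obtain ⟨S', w, σ, M, hw, hS', hx, -, hM, hσ⟩ := IsRowSpace.exists_local f₁ x ⊤ trivial
  refine ⟨S', w, hw, hx, ?_⟩
  obtain ⟨A, hA⟩ := (hI.comp w).exists_mul hM (hN.comp w)
  rw [mul_dropMatrix_map] at hA
  have h' : w.appTop.hom d • V.map w.appTop.hom = E.map w.appTop.hom * A * M := by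
    rw [Matrix.mul_assoc, ← hA, Matrix.submatrix_map, ← Matrix.map_mul, ← h]
    ext; simp
  obtain ⟨G, hG⟩ := exists_mul_of_smul_eq hσ (appTop_mem_nonZeroDivisors w hd) h'
  exact (hg.comp w).ext hM G hG (by rw [Category.assoc, e, Category.assoc])

/-- `Y` with the two morphisms is the universal pair of row spaces incident with respect to `φ`. -/
structure IsIncidenceVariety {k m n : ℕ} (φ : Matrix (Fin n) (Fin m) ℂ) {Y : Scheme.{0}}
    (p₁ : Y ⟶ (Gr k m).left) (p₂ : Y ⟶ (Gr k n).left) : Prop where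
  w : p₁ ≫ (Gr k m).hom = p₂ ≫ (Gr k n).hom
  incid : Incid φ p₁ p₂
  exists_lift : ∀ (T : Scheme.{0}) (f₁ : T ⟶ (Gr k m).left) (f₂ : T ⟶ (Gr k n).left),
    f₁ ≫ (Gr k m).hom = f₂ ≫ (Gr k n).hom → Incid φ f₁ f₂ → ∃ h, h ≫ p₁ = f₁ ∧ h ≫ p₂ = f₂
  ext : ∀ (T : Scheme.{0}) (h h' : T ⟶ Y), h ≫ p₁ = h' ≫ p₁ → h ≫ p₂ = h' ≫ p₂ → h = h'

namespace IsIncidenceVariety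

variable {k n : ℕ} {Y : Scheme.{0}} {p₁ : Y ⟶ (Gr (k + 1) n).left}
  {p₂ : Y ⟶ (Gr (k + 1) (n + 1)).left}

/-- The second components agree by assumption, and both first components are locally the saturation
of the image of the second. -/
lemma eq_of_isEffectiveCartier (hY : IsIncidenceVariety (dropMatrix n) p₁ p₂) {T : Scheme.{0}}
    {h h' : T ⟶ Y} (hf : IsEffectiveCartier ((stdIdeal (k + 1) n).comap (h ≫ p₂)))
    (e : h ≫ p₂ = h' ≫ p₂) : h = h' := by
  refine hY.ext _ _ _ (hom_ext_of_local _ _ fun x => ?_) e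
  obtain ⟨S, j, N, V, A, E, d, g, hj, hS, hx, hN, hd, -, h2, hg, hg'⟩ :=
    exists_local_saturation _ hf x
  refine ⟨S, j, hj, hx, ?_⟩
  have hw := hY.w
  have h3 : g = j ≫ h ≫ p₁ := by
    refine eq_of_incid_of_saturation (f₂ := j ≫ h ≫ p₂) ?_ hN hg hd h2 ?_
    · simpa only [Category.assoc] using (hY.incid.comp h).comp j
    · rw [hg']; simp only [Category.assoc, hw]
  have h4 : g = j ≫ h' ≫ p₁ := by
    refine eq_of_incid_of_saturation (f₂ := j ≫ h ≫ p₂) ?_ hN hg hd h2 ?_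
    · rw [e]; simpa only [Category.assoc] using (hY.incid.comp h').comp j
    · rw [hg', e]; simp only [Category.assoc, hw]
  rw [← h3, h4]

/-- Locally the saturation, paired with `f`, is an incident pair. Uniqueness of lifts glues the
local ones, since the Cartier condition restricts to open subschemes. -/
lemma exists_lift_of_isEffectiveCartier (hY : IsIncidenceVariety (dropMatrix n) p₁ p₂)
    {T : Scheme.{0}} (f : T ⟶ (Gr (k + 1) (n + 1)).left)
    (hf : IsEffectiveCartier ((stdIdeal (k + 1) n).comap f)) : ∃ h, h ≫ p₂ = f := by
  obtain ⟨h, hh⟩ := exists_glue (X := T) (Y := Y) (fun S j h => h ≫ p₂ = j ≫ f) (by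
      intro S S' w j g _ e
      rw [Category.assoc, e, Category.assoc]) (by
      intro S j g g' hj e e'
      refine hY.eq_of_isEffectiveCartier ?_ (e.trans e'.symm)
      rw [e, Scheme.IdealSheafData.comap_comp]
      exact hf.comap j) (by
      intro x
      obtain ⟨S, j, N, V, A, E, d, g, hj, hS, hx, hN, hd, h1, -, hg, hg'⟩ :=
        exists_local_saturation _ hf x
      obtain ⟨h, -, hh⟩ := hY.exists_lift S g (j ≫ f) hg' (Incid.of_eq_mul hg hN A (by
        rw [mul_dropMatrix_map, h1]))
      exact ⟨S, j, h, hj, hx, hh⟩)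
  refine ⟨h, hom_ext_of_local _ _ fun x => ?_⟩
  obtain ⟨S, j, hj, hx, e⟩ := hh x
  exact ⟨S, j, hj, hx, by rw [← Category.assoc, e]⟩

/-- An affine chart of the incidence variety, on which the ideal of the centre is generated by a
nonzerodivisor. -/
lemma exists_chart (hY : IsIncidenceVariety (dropMatrix n) p₁ p₂) {b : Fin n} {σ : Fin k ↪o Fin n}
    {τ : Fin (k + 1) ↪o Fin n} {e : Equiv.Perm (Fin (k + 1))}
    (hτ : ∀ i, τ i = (Fin.cons b σ : Fin (k + 1) → Fin n) (e i)) {x : Y} (h₁ : p₁ x ∈ grOpen τ)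
    (h₂ : p₂ x ∈ grOpen (consEmb σ)) :
    ∃ (S : Scheme.{0}) (j : S ⟶ Y) (_ : IsAffine S), IsOpenImmersion j ∧ x ∈ Set.range j ∧
      ∃ d ∈ nonZeroDivisors Γ(S, ⊤),
        (((stdIdeal (k + 1) n).comap p₂).comap j).ideal ⟨⊤, isAffineOpen_top S⟩ =
          Ideal.span {d} := by
  have hperm : ∀ {B : Type} [CommRing B] (M : Matrix (Fin (k + 1)) (Fin n) B),
      M.submatrix id τ = 1 →
      (M.submatrix e.symm id).submatrix id (Fin.cons b σ : Fin (k + 1) → Fin n) = 1 := by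
    intro B _ M hM
    ext i l
    have := congr_fun (congr_fun hM (e.symm i)) (e.symm l)
    simp only [Matrix.submatrix_apply, id, hτ, Equiv.apply_symm_apply] at this
    simp only [Matrix.submatrix_apply, id, this, Matrix.one_apply, e.symm.injective.eq_iff]
  -- The expected chart: `V₁` varies in the chart `τ`, and the new variables `z` are the entries in
  -- column `b` of the matrix of `V₂`.
  let D : Type := MvPolynomial (Fin (k + 1)) (ChartRing τ)
  let S : Scheme.{0} := Spec (.of D)
  let w : S ⟶ chart τ := Spec.map (CommRingCat.ofHom (MvPolynomial.C : ChartRing τ →+* D))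
  let z : Fin (k + 1) → Γ(S, ⊤) := fun i => pt (R := D) (𝟙 S) (MvPolynomial.X i)
  obtain ⟨hM₀, hM₀1⟩ := IsRowSpace.of_chart τ w
  have hM := hM₀.permute e.symm
  set M := ((chartMatrix τ).map (pt w)).submatrix e.symm id with hMdef
  have hM1 := hperm _ hM₀1
  rw [← hMdef] at hM1
  have hN1 := blowMatrix_submatrix M z hM1
  obtain ⟨g₂, hg₂, hg₂'⟩ := IsRowSpace.exists_of_isUnit
    ((w ≫ grι τ) ≫ (Gr (k + 1) n).hom) (blowMatrix M z) (consEmb σ) (by rw [hN1]; simp)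
  obtain ⟨A₀, hA₀⟩ := exists_blowMatrix_eq_mul M z
  obtain ⟨χ, hχ₁, hχ₂⟩ := hY.exists_lift S (w ≫ grι τ) g₂ hg₂'.symm
    (Incid.of_eq_mul hM hg₂ A₀ (by rw [mul_dropMatrix_map, hA₀]))
  -- The first component recovers the point of the chart `τ`, and column `b` of the normalized
  -- matrix of the second recovers `z`.
  have hmono : Mono χ := by
    refine ⟨fun {T} u u' huu => pt_injective ?_⟩
    have h1 : u ≫ w = u' ≫ w := by
      rw [← cancel_mono (grι τ), Category.assoc, Category.assoc, ← hχ₁, reassoc_of% huu]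
    have h2 : u ≫ g₂ = u' ≫ g₂ := by rw [← hχ₂, reassoc_of% huu]
    have h3 := hg₂.comp u
    have h4 := hg₂.comp u'
    rw [← h2] at h4
    have hid : ∀ v : T ⟶ S, ((blowMatrix M z).map v.appTop.hom).submatrix id (consEmb σ) = 1 := by
      intro v
      rw [Matrix.submatrix_map, hN1]; simp
    have h5 := h3.eq_of_submatrix_eq_one h4 (hid u) (hid u')
    refine MvPolynomial.ringHom_ext' ?_ fun i => ?_
    · have := congr_arg pt h1
      rwa [pt_comp_map, pt_comp_map] at this
    · have h6 := congr_fun (congr_fun h5 i) b.succ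
      simp only [Matrix.map_apply, blowMatrix_apply M z hM1] at h6
      have hz : ∀ v : T ⟶ S, v.appTop.hom (z i) = pt (R := D) v (MvPolynomial.X i) := by
        intro v
        have := pt_comp (R := D) v (𝟙 S)
        rw [Category.comp_id] at this
        rw [this]; rfl
      rwa [hz, hz] at h6
  let O : Y.Opens := p₁ ⁻¹ᵁ grOpen τ ⊓ p₂ ⁻¹ᵁ grOpen (consEmb σ)
  obtain ⟨w₁, hw₁⟩ := exists_chart_of_le (O.ι ≫ p₁) τ (fun y => y.2.1)
  obtain ⟨w₂, hw₂⟩ := exists_chart_of_le (O.ι ≫ p₂) (consEmb σ) (fun y => y.2.2)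
  obtain ⟨hP₀, hP₀1⟩ := IsRowSpace.of_chart τ w₁
  obtain ⟨hQ, hQ1⟩ := IsRowSpace.of_chart (consEmb σ) w₂
  have hP := hP₀.permute e.symm
  have hP1 := hperm _ hP₀1
  rw [hw₁] at hP
  rw [hw₂] at hQ
  set P := ((chartMatrix τ).map (pt w₁)).submatrix e.symm id with hPdef
  set Q := (chartMatrix (consEmb σ)).map (pt w₂) with hQdef
  obtain ⟨A, hA⟩ := (hY.incid.comp O.ι).exists_mul hP hQ
  rw [mul_dropMatrix_map] at hA
  have hQP := eq_blowMatrix hP1 hQ1 hA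
  -- The inverse of `χ` over the open subset where `V₁` and `V₂` lie in the prescribed charts: it
  -- reads `z` off column `b`, and `eq_blowMatrix` shows that nothing else is free.
  let ψ : O.toScheme ⟶ S := toSpec (R := D)
    (MvPolynomial.eval₂Hom (pt w₁) fun i => Q i b.succ)
  have hψw : ψ ≫ w = w₁ := by
    apply pt_injective
    rw [pt_comp_map, pt_toSpec]
    exact MvPolynomial.eval₂Hom_comp_C _ _
  have hψz : ψ.appTop.hom ∘ z = fun i => Q i b.succ := by
    funext i
    have h1 := pt_comp (R := D) ψ (𝟙 S)
    rw [Category.comp_id, pt_toSpec] at h1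
    have := congr($h1 (MvPolynomial.X i))
    simpa using this.symm
  have hψM : M.map ψ.appTop.hom = P := by
    rw [hMdef, ← Matrix.submatrix_map, Matrix.map_map, ← RingHom.coe_comp, ← pt_comp, hψw]
  have hψ : ψ ≫ χ = O.ι := by
    have e1 : (ψ ≫ χ) ≫ p₁ = O.ι ≫ p₁ := by
      rw [Category.assoc, hχ₁, ← Category.assoc, hψw, hw₁]
    refine hY.ext _ _ _ e1 ?_
    have h1 := hg₂.comp ψ
    rw [blowMatrix_map, hψM, hψz, ← hQP] at h1
    rw [Category.assoc, hχ₂]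
    refine h1.ext hQ 1 (by rw [Matrix.one_mul]) ?_
    rw [Category.assoc, hg₂', ← hχ₁, Category.assoc χ, ← Category.assoc ψ, ← Category.assoc,
      e1, Category.assoc, hY.w, Category.assoc]
  have hχr : Set.range χ ⊆ Set.range O.ι := by
    rintro _ ⟨s, rfl⟩
    rw [Scheme.Opens.range_ι]
    refine ⟨?_, ?_⟩
    · change p₁ (χ s) ∈ grOpen τ
      rw [← Scheme.Hom.comp_apply, hχ₁]
      exact le_preimage_grOpen τ w trivial
    · change p₂ (χ s) ∈ grOpen (consEmb σ)
      rw [← Scheme.Hom.comp_apply, hχ₂]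
      exact hg₂.le_preimage hN1 trivial
  let χ' : S ⟶ O.toScheme := IsOpenImmersion.lift O.ι χ hχr
  have hχ' : χ' ≫ O.ι = χ := IsOpenImmersion.lift_fac _ _ _
  have hiso : IsIso χ' := by
    refine ⟨ψ, ?_, ?_⟩
    · rw [← cancel_mono χ, Category.assoc, hψ, hχ', Category.id_comp]
    · rw [← cancel_mono O.ι, Category.assoc, hχ', hψ, Category.id_comp]
  have hopen : IsOpenImmersion χ := by rw [← hχ']; infer_instance
  refine ⟨S, χ, inferInstance, hopen, ⟨ψ ⟨x, h₁, h₂⟩, ?_⟩, z 0, ?_, ?_⟩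
  · exact congr($hψ (⟨x, h₁, h₂⟩ : O.toScheme))
  · have hbij : Function.Bijective (pt (R := D) (𝟙 S)) := by
      have : IsIso ((Scheme.ΓSpecIso (.of D)).inv ≫ (𝟙 S : S ⟶ S).appTop) := by
        rw [Scheme.Hom.id_appTop]
        exact inferInstanceAs (IsIso ((Scheme.ΓSpecIso (.of D)).inv ≫ 𝟙 _))
      exact (ConcreteCategory.isIso_iff_bijective _).1 this
    have hX : (MvPolynomial.X 0 : D) ∈ nonZeroDivisors D :=
      mem_nonZeroDivisors_of_ne_zero (MvPolynomial.X_ne_zero 0)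
    rw [mem_nonZeroDivisors_iff_right]
    intro a ha
    obtain ⟨a, rfl⟩ := hbij.2 a
    have h0 : pt (R := D) (𝟙 S) (a * MvPolynomial.X 0) = pt (R := D) (𝟙 S) 0 := by
      rw [map_mul, map_zero]; exact ha
    rw [(mem_nonZeroDivisors_iff_right.1 hX) a (hbij.1 h0), map_zero]
  · rw [← Scheme.IdealSheafData.comap_comp, hχ₂, comap_zeroIdeal_quotSection _ hg₂ hN1,
      span_projMatrix_consEmb _ hN1]
    -- The ideal is generated by the entries of `z 0` times the first row of `M`, and that row has
    -- entry `1` at `b`.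
    apply le_antisymm <;> rw [Ideal.span_le]
    · rintro _ ⟨j, rfl⟩
      exact Ideal.mem_span_singleton.2 ⟨M 0 j, rfl⟩
    · rw [Set.singleton_subset_iff, ← blowMatrix_apply M z hM1 0]
      exact Ideal.subset_span ⟨b, rfl⟩

/-- At the point, the rows of the matrix of `V₂` after the first map into `V₁` and have the identity
in the columns `σ`. So the columns `σ` of a matrix of `V₁` are independent, and `exists_det_ne_zero`
completes them by a column `b`. -/
lemma exists_chart_cover (hY : IsIncidenceVariety (dropMatrix n) p₁ p₂) {σ : Fin k ↪o Fin n} {x : Y}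
    (h₂ : p₂ x ∈ grOpen (consEmb σ)) :
    ∃ (b : Fin n) (τ : Fin (k + 1) ↪o Fin n) (e : Equiv.Perm (Fin (k + 1))),
      (∀ i, τ i = (Fin.cons b σ : Fin (k + 1) → Fin n) (e i)) ∧ p₁ x ∈ grOpen τ := by
  obtain ⟨S, j, ρ, M, hj, hS, ⟨y, rfl⟩, hr, hM, -⟩ :=
    IsRowSpace.exists_local p₁ x (p₂ ⁻¹ᵁ grOpen (consEmb σ)) h₂
  obtain ⟨R, hR⟩ := hM.exists_rightInv
  obtain ⟨w, hw⟩ := exists_chart_of_le (j ≫ p₂) (consEmb σ) (fun y => hr ⟨y, rfl⟩)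
  obtain ⟨hN, hN1⟩ := IsRowSpace.of_chart (consEmb σ) w
  rw [hw] at hN
  obtain ⟨A, hA⟩ := (hY.incid.comp j).exists_mul hM hN
  rw [mul_dropMatrix_map] at hA
  let ev := (S.evaluation ⊤ y trivial).hom
  have h1 : M.map ev * R.map ev = 1 := by
    rw [← Matrix.map_mul, hR]; simp
  have h2 : ((A.submatrix Fin.succ id).map ev * M.map ev).submatrix id σ = 1 := by
    obtain ⟨-, -, h3⟩ := exists_eq_border hN1
    have h4 : A.submatrix Fin.succ id * M = ((chartMatrix (consEmb σ)).map (pt w)).submatrix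
        Fin.succ Fin.succ := by
      ext a b
      exact (congr_fun (congr_fun hA a.succ) b).symm
    rw [← Matrix.map_mul, h4, Matrix.submatrix_map, h3]; simp
  obtain ⟨b, hb⟩ := exists_det_ne_zero h1 h2
  have hinj : Function.Injective (Fin.cons b σ : Fin (k + 1) → Fin n) := by
    rw [Fin.cons_injective_iff]
    refine ⟨?_, σ.injective⟩
    rintro ⟨i, rfl⟩
    refine hb (Matrix.det_zero_of_column_eq (i := 0) (j := i.succ) (Fin.succ_ne_zero _).symm ?_)
    intro a; simp
  obtain ⟨τ, e, hτ⟩ := exists_orderEmb_range _ hinj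
  refine ⟨b, τ, e, hτ, ?_⟩
  have hb' : ev ((M.submatrix id τ).det) ≠ 0 := by
    have h5 : (M.map ev).submatrix id τ =
        ((M.map ev).submatrix id (Fin.cons b σ : Fin (k + 1) → Fin n)).submatrix id e := by
      ext a i; simp [hτ]
    rw [RingHom.map_det, RingHom.mapMatrix_apply, ← Matrix.submatrix_map, h5, Matrix.det_permute']
    rcases Int.units_eq_one_or (Equiv.Perm.sign e) with h | h <;> simpa [h] using hb
  have hy := (S.evaluation_ne_zero_iff_mem_basicOpen (U := ⊤) y trivial _).1 hb'
  obtain ⟨S', u, hu, hS', ⟨v, rfl⟩, hr'⟩ := exists_affine_nhd y _ hy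
  have hunit := isUnit_appTop_of_le_basicOpen u _ hr'
  rw [RingHom.map_det, RingHom.mapMatrix_apply, ← Matrix.submatrix_map] at hunit
  obtain ⟨w', hw', -⟩ := (hM.comp u).exists_chart τ hunit
  have h6 : p₁ (j (u v)) = grι τ (w' v) := by
    rw [← Scheme.Hom.comp_apply, ← Scheme.Hom.comp_apply, ← Scheme.Hom.comp_apply, hw']
  rw [h6]
  exact ⟨w' v, trivial, rfl⟩

lemma isEffectiveCartier (hY : IsIncidenceVariety (dropMatrix n) p₁ p₂) :
    IsEffectiveCartier ((stdIdeal (k + 1) n).comap p₂) := by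
  refine isEffectiveCartier_of_local _ fun x => ?_
  obtain ⟨σ', hσ'⟩ := exists_mem_grOpen (p₂ x)
  rcases eq_consEmb_or_succEmb σ' with ⟨σ, rfl⟩ | ⟨τ, rfl⟩
  · obtain ⟨b, τ, e, hτ, h₁⟩ := hY.exists_chart_cover hσ'
    exact hY.exists_chart hτ h₁ hσ'
  -- A chart not using column `0` misses the centre: `e₀` is one of the basis vectors of the
  -- quotient, so the ideal is generated by `1`.
  · obtain ⟨S, j, hj, hS, hx, hr⟩ := exists_affine_nhd x (p₂ ⁻¹ᵁ grOpen (succEmb τ)) hσ'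
    obtain ⟨w, hw⟩ := exists_chart_of_le (j ≫ p₂) (succEmb τ) (fun y => hr ⟨y, rfl⟩)
    obtain ⟨hN, hN1⟩ := IsRowSpace.of_chart (succEmb τ) w
    rw [hw] at hN
    refine ⟨S, j, hS, hj, hx, 1, one_mem _, ?_⟩
    rw [← Scheme.IdealSheafData.comap_comp, comap_zeroIdeal_quotSection _ hN hN1,
      Ideal.span_singleton_one, Ideal.eq_top_iff_one]
    have h0 : (0 : Fin (n + 1)) ∉ Set.range (succEmb τ) := by
      rintro ⟨i, hi⟩
      exact Fin.succ_ne_zero _ hi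
    refine Ideal.subset_span ⟨⟨0, h0⟩, ?_⟩
    simp only [constRow_stdVec_mul]
    rw [projMatrix_apply_of_notMem _ _ _ _ h0]; simp

theorem isBlowup (hY : IsIncidenceVariety (dropMatrix n) p₁ p₂) :
    IsBlowup p₂ (stdIdeal (k + 1) n) where
  isEffectiveCartier := hY.isEffectiveCartier
  existsUnique_lift T f hf := by
    obtain ⟨h, rfl⟩ := hY.exists_lift_of_isEffectiveCartier f hf
    exact ⟨h, rfl, fun h' e => (hY.eq_of_isEffectiveCartier hf e.symm).symm⟩

end IsIncidenceVariety

/-! ### Functions of matrices that are affine along rank one directions -/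

lemma polynomial_eq_of_eval_eq {P Q : Polynomial ℂ} (h : ∀ t : ℂ, t ≠ 0 → P.eval t = Q.eval t) :
    P = Q :=
  Polynomial.eq_of_infinite_eval_eq P Q
    ((Set.finite_singleton (0 : ℂ)).infinite_compl.mono fun t ht => h t ht)

/-- `P` and `Q` are the two halves of a section of `𝒪(1)` on the projective line. Clearing
denominators gives `X ^ Q.natDegree * P = X * Q.reverse`, so `P` has degree at most one, and its
slope is the value of `Q` at infinity. -/
lemma eval_eq_of_eval_eq_mul_inv {P Q : Polynomial ℂ}
    (h : ∀ t : ℂ, t ≠ 0 → P.eval t = t * Q.eval t⁻¹) :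
    ∃ A : ℂ, ∀ t, P.eval t = A + t * Q.eval 0 := by
  have hP : P.natDegree ≤ 1 := by
    by_cases h0 : P = 0
    · simp [h0]
    have e : Polynomial.X ^ Q.natDegree * P = Polynomial.X * Q.reverse := by
      refine polynomial_eq_of_eval_eq fun t ht => ?_
      let := invertibleOfNonzero (inv_ne_zero ht)
      have h1 := Polynomial.eval₂_reverse_mul_pow (RingHom.id ℂ) t⁻¹ Q
      simp only [invOf_eq_inv, inv_inv, Polynomial.eval₂_id] at h1
      have h2 := h t ht
      rw [← h1] at h2
      have h3 : t ^ Q.natDegree * (t⁻¹) ^ Q.natDegree = 1 := by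
        rw [← mul_pow, mul_inv_cancel₀ ht, one_pow]
      simp only [Polynomial.eval_mul, Polynomial.eval_pow, Polynomial.eval_X]
      linear_combination t ^ Q.natDegree * h2 + t * Q.reverse.eval t * h3
    have h1 := congr_arg Polynomial.natDegree e
    rw [Polynomial.natDegree_X_pow_mul _ h0] at h1
    have h2 : (Polynomial.X * Q.reverse).natDegree ≤ 1 + Q.natDegree :=
      Polynomial.natDegree_mul_le.trans (add_le_add Polynomial.natDegree_X_le
        (Polynomial.reverse_natDegree_le _))
    omega
  obtain ⟨a, b, rfl⟩ := Polynomial.exists_eq_X_add_C_of_natDegree_le_one hP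
  have hQ : Q = Polynomial.C b * Polynomial.X + Polynomial.C a := by
    refine polynomial_eq_of_eval_eq fun t ht => ?_
    have := h t⁻¹ (inv_ne_zero ht)
    simp only [inv_inv, Polynomial.eval_add, Polynomial.eval_mul, Polynomial.eval_C,
      Polynomial.eval_X] at this ⊢
    field_simp at this
    linear_combination -this
  exact ⟨b, fun t => by simp [hQ]; ring⟩

/-- A function that is affine on every line is affine. -/
lemma exists_affine_of_affine_on_lines {ι : Type} [Fintype ι] [DecidableEq ι] (G : (ι → ℂ) → ℂ)
    (h : ∀ y u : ι → ℂ, u ≠ 0 → ∃ A L : ℂ, ∀ t : ℂ, G (y + t • u) = A + t * L) :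
    ∃ (c : ℂ) (l : ι → ℂ), ∀ y, G y = c + ∑ a, l a * y a := by
  have h1 : ∀ (y u : ι → ℂ) (t : ℂ), G (y + t • u) = G y + t * (G (y + u) - G y) := by
    intro y u t
    by_cases hu : u = 0
    · simp [hu]
    · obtain ⟨A, L, hAL⟩ := h y u hu
      have e0 := hAL 0
      have e1 := hAL 1
      simp only [zero_smul, add_zero, zero_mul, one_smul, one_mul] at e0 e1
      rw [hAL, e0, e1]; ring
  have hsmul : ∀ (t : ℂ) (u : ι → ℂ), G (t • u) - G 0 = t * (G u - G 0) := by
    intro t u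
    have := h1 0 u t
    rw [zero_add, zero_add] at this
    rw [this]; ring
  have hadd : ∀ y z : ι → ℂ, G (y + z) - G 0 = (G y - G 0) + (G z - G 0) := by
    intro y z
    -- Additivity comes from the midpoint: `y + z` is twice the point halfway from `y` to `z`.
    have e1 := h1 y (z - y) (1 / 2)
    have e2 := hsmul 2 (y + (1 / 2 : ℂ) • (z - y))
    have e3 : (2 : ℂ) • (y + (1 / 2 : ℂ) • (z - y)) = y + z := by
      ext i; simp; ring
    rw [e3, e1, add_sub_cancel] at e2
    rw [e2]; ring
  let H : (ι → ℂ) →ₗ[ℂ] ℂ :=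
    { toFun := fun y => G y - G 0
      map_add' := hadd
      map_smul' := hsmul }
  refine ⟨G 0, fun a => H (Pi.single a 1), fun y => ?_⟩
  have h2 : H y = ∑ a, y a • H (Pi.single a 1) := by
    conv_lhs => rw [← Finset.univ_sum_single y]
    rw [map_sum]
    refine Finset.sum_congr rfl fun a _ => ?_
    rw [← map_smul]
    congr 1
    ext b
    by_cases hb : b = a
    · subst hb; simp
    · simp [hb]
  have h3 : G y = G 0 + H y := by simp [H]
  rw [h3, h2]
  simp [mul_comm]

/-- A direction `u ⊗ w` with `w b = 0` does not change component `b`. So this component depends only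
on column `b` of `x`, and it does so affinely. Directions whose `w` is nonzero on two columns show
that the linear parts in these columns coincide. -/
lemma exists_affine_of_rank_one {I J : Type} [Fintype I] [DecidableEq I] [Fintype J] [DecidableEq J]
    (F : Matrix I J ℂ → J → ℂ)
    (h : ∀ (x : Matrix I J ℂ) (u : I → ℂ) (w : J → ℂ), u ≠ 0 → w ≠ 0 → ∃ (A : J → ℂ) (L : ℂ),
      ∀ (t : ℂ) (j : J), F (x + t • Matrix.vecMulVec u w) j = A j + t * (L * w j)) :
    ∃ (c : J → ℂ) (l : I → ℂ), ∀ x j, F x j = c j + ∑ a, l a * x a j := by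
  have hcol : ∀ (b : J) (x : Matrix I J ℂ) (u : I → ℂ) (w : J → ℂ), w b = 0 →
      F (x + Matrix.vecMulVec u w) b = F x b := by
    intro b x u w hb
    by_cases hu : u = 0
    · simp [hu]
    by_cases hw : w = 0
    · have : Matrix.vecMulVec u (0 : J → ℂ) = 0 := by ext; simp [Matrix.vecMulVec_apply]
      rw [hw, this, add_zero]
    obtain ⟨A, L, hAL⟩ := h x u w hu hw
    have e0 := hAL 0 b
    have e1 := hAL 1 b
    simp only [zero_smul, add_zero, one_smul, hb, mul_zero] at e0 e1
    rw [e0, e1]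
  have hcols : ∀ (b : J) (x : Matrix I J ℂ) (s : Finset J), b ∉ s → ∀ v : J → I → ℂ,
      F (x + ∑ j ∈ s, Matrix.vecMulVec (v j) (Pi.single j 1)) b = F x b := by
    intro b x s
    induction s using Finset.induction_on with
    | empty => intro _ v; simp
    | insert j s hj ih =>
      intro hb v
      rw [Finset.mem_insert, not_or] at hb
      rw [Finset.sum_insert hj, add_comm (Matrix.vecMulVec _ _), ← add_assoc,
        hcol b _ _ _ (by simp [hb.1]), ih hb.2]
  have hdep : ∀ (b : J) (x : Matrix I J ℂ),
      F x b = F (Matrix.vecMulVec (fun i => x i b) (Pi.single b 1)) b := by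
    intro b x
    rw [← hcols b (Matrix.vecMulVec (fun i => x i b) (Pi.single b 1)) (Finset.univ.erase b)
      (by simp) fun j i => x i j]
    congr 1
    rw [Finset.add_sum_erase _ (fun j => Matrix.vecMulVec (fun i => x i j) (Pi.single j 1))
      (Finset.mem_univ b)]
    ext i j
    simp [Matrix.sum_apply, Matrix.vecMulVec_apply, Pi.single_apply]
  have haff : ∀ b : J, ∃ (c : ℂ) (l : I → ℂ), ∀ y : I → ℂ,
      F (Matrix.vecMulVec y (Pi.single b 1)) b = c + ∑ a, l a * y a := by
    intro b
    refine exists_affine_of_affine_on_lines _ fun y u hu => ?_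
    obtain ⟨A, L, hAL⟩ := h (Matrix.vecMulVec y (Pi.single b 1)) u (Pi.single b 1) hu (by simp)
    refine ⟨A b, L, fun t => ?_⟩
    rw [Matrix.add_vecMulVec, Matrix.smul_vecMulVec, hAL]
    simp
  choose c l hl using haff
  have hF : ∀ x b, F x b = c b + ∑ a, l b a * x a b := fun x b => by rw [hdep, hl]
  have heq : ∀ b j a, l b a = l j a := by
    intro b j a
    by_cases hbj : b = j
    · rw [hbj]
    -- In this direction the components `b` and `j` have the same slope `L`, which is also `l b a`
    -- and `l j a`.
    obtain ⟨A, L, hAL⟩ := h 0 (Pi.single a 1) (Pi.single b 1 + Pi.single j 1) (by simp) (by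
      intro e
      have := congr_fun e b
      simp [hbj] at this)
    have key : ∀ d, (Pi.single b 1 + Pi.single j 1 : J → ℂ) d = 1 → l d a = L := by
      intro d hd
      have e0 := hAL 0 d
      have e1 := hAL 1 d
      simp only [hF, hd, zero_add, Matrix.smul_apply, Matrix.vecMulVec_apply] at e0 e1
      simp [Pi.single_apply] at e0 e1
      rw [← e0] at e1
      exact add_left_cancel e1
    rw [key b (by simp [hbj]), key j (by simp [Ne.symm hbj])]
  by_cases hJ : Nonempty J
  · obtain ⟨b⟩ := hJ
    exact ⟨c, l b, fun x j => by rw [hF]; simp only [heq j b]⟩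
  · exact ⟨c, 0, fun x j => absurd ⟨j⟩ hJ⟩

/-! ### Functions on matrices that transform like sections of the tautological bundles -/

open Polynomial in
/-- A chart at infinity of the line `M + t u ⊗ w`, with parameter `t⁻¹`. -/
lemma exists_curve {k n : ℕ} {σ : Fin k ↪o Fin n} {M : Matrix (Fin k) (Fin n) ℂ}
    (hM : M.submatrix id σ = 1) {u : Fin k → ℂ} {w : Fin n → ℂ} (hw : ∀ i, w (σ i) = 0)
    {a : Fin k} {b : Fin n} (ha : u a = 1) (hb : w b = 1) (hab : M a b = 0) :
    ∃ (τ : Fin k ↪o Fin n) (e : Equiv.Perm (Fin k)) (N : Matrix (Fin k) (Fin n) ℂ[X]),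
      (∀ i, τ i = Function.update σ a b (e i)) ∧ N.submatrix id τ = 1 ∧
      ∀ t : ℂ, t ≠ 0 → ∃ G : Matrix (Fin k) (Fin k) ℂ,
        N.map (eval t⁻¹) = G * (M + t • Matrix.vecMulVec u w) := by
  have hM' : ∀ i l, M i (σ l) = if i = l then 1 else 0 := fun i l =>
    (congr_fun (congr_fun hM i) l).trans (Matrix.one_apply)
  have hbσ : ∀ i, σ i ≠ b := fun i e => by
    have := hw i
    rw [e, hb] at this
    exact one_ne_zero this
  have hinj : Function.Injective (Function.update σ a b) := by
    intro i l h
    by_cases hi : i = a <;> by_cases hl : l = a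
    · rw [hi, hl]
    · subst hi
      rw [Function.update_self, Function.update_of_ne hl] at h
      exact absurd h.symm (hbσ l)
    · subst hl
      rw [Function.update_self, Function.update_of_ne hi] at h
      exact absurd h (hbσ i)
    · rw [Function.update_of_ne hi, Function.update_of_ne hl] at h
      exact σ.injective h
  obtain ⟨τ, e, hτ⟩ := exists_orderEmb_range _ hinj
  -- Row operations with `X = t⁻¹`: row `a` of `M + t u ⊗ w` is multiplied by `t⁻¹`, which gives `r`
  -- with `r b = 1`. Then `t w` is removed from the other rows with row `a`, and their column `b` is
  -- cleared with `r`. Column `b` replaces `σ a`.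
  let r : Fin n → ℂ[X] := fun j => X * C (M a j) + C (w j)
  let N₀ : Matrix (Fin k) (Fin n) ℂ[X] := Matrix.of fun i j =>
    if i = a then r j else C (M i j) - C (u i) * C (M a j) - C (M i b) * r j
  have hN₀ : ∀ i l, N₀ i (Function.update σ a b l) = (1 : Matrix _ _ _) i l := by
    intro i l
    by_cases hl : l = a
    · subst hl
      by_cases hi : i = l
      · subst hi; simp [N₀, r, hab, hb]
      · simp [N₀, r, hab, hb, hi]
    · by_cases hi : i = a
      · subst hi; simp [N₀, r, hw, hM', hl, Ne.symm hl]
      · by_cases hil : i = l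
        · subst hil; simp [N₀, r, hw, hM', hi, Ne.symm hi]
        · simp [N₀, r, hw, hM', hi, hl, Ne.symm hl, hil]
  refine ⟨τ, e, N₀.submatrix e id, hτ, ?_, fun t ht => ?_⟩
  · ext1 i l
    simp only [Matrix.submatrix_apply, id, hτ, hN₀, Matrix.one_apply, e.injective.eq_iff]
  · let G₀ : Matrix (Fin k) (Fin k) ℂ := Matrix.of fun i l =>
      if i = a then (if l = a then t⁻¹ else 0) else
        ((if i = l then 1 else 0) - if l = a then u i + M i b * t⁻¹ else 0)
    refine ⟨G₀.submatrix e id, ?_⟩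
    have key : N₀.map (eval t⁻¹) = G₀ * (M + t • Matrix.vecMulVec u w) := by
      ext i j
      by_cases hi : i = a
      · subst hi
        simp [N₀, r, G₀, Matrix.mul_apply, Matrix.vecMulVec_apply, ha]
        field_simp
      · simp [N₀, r, G₀, Matrix.mul_apply, Matrix.vecMulVec_apply, ha, hi, sub_mul,
          Finset.sum_sub_distrib]
        field_simp
        ring
    ext i j
    exact congr_fun (congr_fun key (e i)) j

open Polynomial in
/-- A line in the chart `σ` that meets the chart `τ`. -/
lemma exists_line {k n : ℕ} (σ τ : Fin k ↪o Fin n) {M : Matrix (Fin k) (Fin n) ℂ}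
    (hM : M.submatrix id σ = 1) :
    ∃ (N : Matrix (Fin k) (Fin n) ℂ[X]) (q : ℂ[X]), q ≠ 0 ∧ N.submatrix id σ = 1 ∧
      N.map (eval 0) = M ∧ ∀ t : ℂ, q.eval t ≠ 0 → ∃ (M' : Matrix (Fin k) (Fin n) ℂ)
        (G : Matrix (Fin k) (Fin k) ℂ), M'.submatrix id τ = 1 ∧ M' = G * N.map (eval t) := by
  -- A Vandermonde matrix has all maximal minors nonzero, so its row space lies in every chart. The
  -- line joins `M` to it within the chart `σ`, and `q` is the `τ`-minor along the line, nonzero at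
  -- `t = 1`.
  let V : Matrix (Fin k) (Fin n) ℂ := Matrix.of fun i j => (j : ℂ) ^ (i : ℕ)
  have hV : ∀ ρ : Fin k ↪o Fin n, IsUnit (V.submatrix id ρ).det := by
    intro ρ
    have : V.submatrix id ρ = (Matrix.vandermonde fun i => ((ρ i : ℕ) : ℂ)).transpose := by
      ext i j; simp [V, Matrix.vandermonde_apply]
    rw [this, Matrix.det_transpose, isUnit_iff_ne_zero, Matrix.det_vandermonde_ne_zero_iff]
    intro i j h
    exact ρ.injective (Fin.ext (Nat.cast_injective h))
  let M₁ := normalize σ V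
  have hM₁ : M₁.submatrix id σ = 1 := normalize_submatrix σ V (hV σ)
  have hM₁τ : IsUnit (M₁.submatrix id τ).det := isUnit_normalize σ τ V (hV σ) (hV τ)
  let N : Matrix (Fin k) (Fin n) ℂ[X] := Matrix.of fun i j => C (M i j) + X * C (M₁ i j - M i j)
  have hev : ∀ t : ℂ, eval t (N.submatrix id τ).det = ((N.map (eval t)).submatrix id τ).det := by
    intro t
    have := RingHom.map_det (evalRingHom t) (N.submatrix id τ)
    exact this
  have h1 : N.map (eval 1) = M₁ := by ext i j; simp [N]
  refine ⟨N, (N.submatrix id τ).det, ?_, ?_, ?_, fun t ht => ?_⟩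
  · intro h
    have := hev 1
    rw [h, h1, eval_zero] at this
    exact not_isUnit_zero (this ▸ hM₁τ)
  · ext1 i l
    have h2 := congr_fun (congr_fun hM i) l
    have h3 := congr_fun (congr_fun hM₁ i) l
    simp only [Matrix.submatrix_apply, id] at h2 h3
    simp only [N, Matrix.submatrix_apply, Matrix.of_apply, id, h2, h3, sub_self, C_0, mul_zero, add_zero]
    by_cases hil : i = l
    · subst hil; simp
    · simp [hil]
  · ext i j; simp [N]
  · rw [hev] at ht
    exact ⟨normalize τ (N.map (eval t)), _,
      normalize_submatrix τ _ (isUnit_iff_ne_zero.2 ht), rfl⟩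

lemma polynomial_eq_zero_of_eval {p q : Polynomial ℂ} (hq : q ≠ 0)
    (h : ∀ t, q.eval t ≠ 0 → p.eval t = 0) : p = 0 := by
  have : p * q = 0 := by
    refine Polynomial.funext fun t => ?_
    rw [Polynomial.eval_mul, Polynomial.eval_zero]
    by_cases hqt : q.eval t = 0
    · rw [hqt, mul_zero]
    · rw [h t hqt, zero_mul]
  exact (mul_eq_zero.1 this).resolve_right hq

lemma vecMul_projMatrix_apply {k n : ℕ} {B : Type} [CommRing B] (σ : Fin k ↪o Fin n)
    (M : Matrix (Fin k) (Fin n) B) (v : Fin n → B) (j : Fin n) :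
    Matrix.vecMul v (projMatrix σ M) j = v j - ∑ i, v (σ i) * M i j := by
  rw [projMatrix, Matrix.vecMul_sub, Matrix.vecMul_one, ← Matrix.vecMul_vecMul]
  simp only [Pi.sub_apply, Matrix.vecMul, dotProduct, Matrix.submatrix_apply, id, Matrix.one_apply]
  simp

/-- Functions on matrices in normal form that transform like the coordinates of a section of the
quotient bundle. -/
structure QuotSystem {k n : ℕ}
    (F : (Fin k ↪o Fin n) → Matrix (Fin k) (Fin n) ℂ → Fin n → ℂ) : Prop where
  apply_of_mem : ∀ (σ : Fin k ↪o Fin n) M i, F σ M (σ i) = 0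
  poly : ∀ (σ : Fin k ↪o Fin n) (N : Matrix (Fin k) (Fin n) (Polynomial ℂ)), N.submatrix id σ = 1 → ∀ j,
    ∃ p : Polynomial ℂ, ∀ t, F σ (N.map (Polynomial.eval t)) j = p.eval t
  trans : ∀ (σ τ : Fin k ↪o Fin n) (M M' : Matrix (Fin k) (Fin n) ℂ) (G : Matrix (Fin k) (Fin k) ℂ), M.submatrix id σ = 1 →
    M'.submatrix id τ = 1 → M' = G * M → F σ M = Matrix.vecMul (F τ M') (projMatrix σ M)

/-- Functions on matrices in normal form that transform like the coordinates of a section of the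
dual of the tautological subbundle. -/
structure SubDualSystem {k n : ℕ}
    (F : (Fin k ↪o Fin n) → Matrix (Fin k) (Fin n) ℂ → Fin k → ℂ) : Prop where
  poly : ∀ (σ : Fin k ↪o Fin n) (N : Matrix (Fin k) (Fin n) (Polynomial ℂ)), N.submatrix id σ = 1 → ∀ i,
    ∃ p : Polynomial ℂ, ∀ t, F σ (N.map (Polynomial.eval t)) i = p.eval t
  trans : ∀ (σ τ : Fin k ↪o Fin n) (M M' : Matrix (Fin k) (Fin n) ℂ) (G : Matrix (Fin k) (Fin k) ℂ), M.submatrix id σ = 1 →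
    M'.submatrix id τ = 1 → M' = G * M → F σ M = Matrix.mulVec (M.submatrix id τ) (F τ M')

open Polynomial in
/-- The line `M + t u ⊗ w` with polynomial parameter. -/
def polyLine {k n : ℕ} (M : Matrix (Fin k) (Fin n) ℂ) (u : Fin k → ℂ) (w : Fin n → ℂ) :
    Matrix (Fin k) (Fin n) ℂ[X] := Matrix.of fun i j => C (M i j) + X * C (u i * w j)

open Polynomial in
lemma polyLine_map {k n : ℕ} (M : Matrix (Fin k) (Fin n) ℂ) (u : Fin k → ℂ) (w : Fin n → ℂ)
    (t : ℂ) : (polyLine M u w).map (eval t) = M + t • Matrix.vecMulVec u w := by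
  ext i j; simp [polyLine, Matrix.vecMulVec_apply]

lemma polyLine_submatrix {k n : ℕ} {σ : Fin k ↪o Fin n} {M : Matrix (Fin k) (Fin n) ℂ}
    (hM : M.submatrix id σ = 1) (u : Fin k → ℂ) {w : Fin n → ℂ} (hw : ∀ i, w (σ i) = 0) :
    (polyLine M u w).submatrix id σ = 1 := by
  ext1 i l
  have h2 := congr_fun (congr_fun hM i) l
  simp only [Matrix.submatrix_apply, id] at h2
  simp only [polyLine, Matrix.submatrix_apply, Matrix.of_apply, id, h2, hw, mul_zero, Polynomial.C_0, add_zero]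
  by_cases hil : i = l
  · subst hil; simp
  · simp [hil]

lemma submatrix_add_vecMulVec {k n : ℕ} {σ : Fin k ↪o Fin n} {M : Matrix (Fin k) (Fin n) ℂ}
    (hM : M.submatrix id σ = 1) (u : Fin k → ℂ) {w : Fin n → ℂ} (hw : ∀ i, w (σ i) = 0) (t : ℂ) :
    (M + t • Matrix.vecMulVec u w).submatrix id σ = 1 := by
  rw [← hM]
  ext i l
  simp [Matrix.vecMulVec_apply, hw]

/-- Reduction to a line with a simple parametrization. -/
lemma exists_line_normal {k n : ℕ} (σ : Fin k ↪o Fin n) {M : Matrix (Fin k) (Fin n) ℂ}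
    (hM : M.submatrix id σ = 1) {u : Fin k → ℂ} {w : Fin n → ℂ} (hw : ∀ i, w (σ i) = 0)
    (hu0 : u ≠ 0) (hw0 : w ≠ 0) :
    ∃ (M₀ : Matrix (Fin k) (Fin n) ℂ) (u' : Fin k → ℂ) (w' : Fin n → ℂ) (a : Fin k) (b : Fin n)
      (c d e : ℂ), M₀.submatrix id σ = 1 ∧ (∀ i, w' (σ i) = 0) ∧ u' a = 1 ∧ w' b = 1 ∧
      M₀ a b = 0 ∧ u' = c • u ∧ w' = d • w ∧ ∀ t : ℂ, M + t • Matrix.vecMulVec u w =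
        M₀ + (e + t * (u a * w b)) • Matrix.vecMulVec u' w' := by
  obtain ⟨a, ha⟩ := Function.ne_iff.1 hu0
  obtain ⟨b, hb⟩ := Function.ne_iff.1 hw0
  simp only [Pi.zero_apply] at ha hb
  have hw' : ∀ i, ((w b)⁻¹ • w) (σ i) = 0 := fun i => by simp [hw]
  -- Rescaling makes the entries of `u` at `a` and of `w` at `b` equal to `1`; sliding the base
  -- point along the line makes its entry `(a, b)` zero.
  refine ⟨M + (-M a b) • Matrix.vecMulVec ((u a)⁻¹ • u) ((w b)⁻¹ • w), (u a)⁻¹ • u, (w b)⁻¹ • w,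
    a, b, _, _, M a b, submatrix_add_vecMulVec hM _ hw' _, hw', by simp [ha], by simp [hb], ?_,
    rfl, rfl, fun t => ?_⟩
  · simp [Matrix.vecMulVec_apply, ha, hb]
  · ext i j
    simp only [Matrix.add_apply, Matrix.smul_apply, Matrix.vecMulVec_apply, smul_eq_mul,
      Pi.smul_apply]
    field_simp
    ring

open Classical in
/-- The matrix with the identity in the columns `σ` and the other columns given by `x`. -/
def fillMatrix {k n : ℕ} (σ : Fin k ↪o Fin n)
    (x : Matrix (Fin k) {j : Fin n // j ∉ Set.range σ} ℂ) : Matrix (Fin k) (Fin n) ℂ :=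
  Matrix.of fun i j => if h : j ∈ Set.range σ then (if σ i = j then 1 else 0) else x i ⟨j, h⟩

lemma fillMatrix_submatrix {k n : ℕ} (σ : Fin k ↪o Fin n)
    (x : Matrix (Fin k) {j : Fin n // j ∉ Set.range σ} ℂ) : (fillMatrix σ x).submatrix id σ = 1 := by
  ext i j : 2
  simp [fillMatrix, Matrix.one_apply]

lemma fillMatrix_apply {k n : ℕ} (σ : Fin k ↪o Fin n)
    (x : Matrix (Fin k) {j : Fin n // j ∉ Set.range σ} ℂ) (i : Fin k)
    (j : {j : Fin n // j ∉ Set.range σ}) : fillMatrix σ x i j = x i j := by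
  simp only [fillMatrix, Matrix.of_apply, dif_neg j.2]

lemma fillMatrix_eq {k n : ℕ} {σ : Fin k ↪o Fin n} {M : Matrix (Fin k) (Fin n) ℂ}
    (hM : M.submatrix id σ = 1) : fillMatrix σ (M.submatrix id Subtype.val) = M := by
  ext i j
  by_cases hj : j ∈ Set.range σ
  · obtain ⟨l, rfl⟩ := hj
    have h1 := congr_fun (congr_fun (fillMatrix_submatrix σ (M.submatrix id Subtype.val)) i) l
    have h2 := congr_fun (congr_fun hM i) l
    exact h1.trans h2.symm
  · exact fillMatrix_apply σ _ i ⟨j, hj⟩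

open Classical in
/-- Extension by zero. -/
def extendZero {k n : ℕ} (σ : Fin k ↪o Fin n) (w : {j : Fin n // j ∉ Set.range σ} → ℂ) :
    Fin n → ℂ := fun j => if h : j ∈ Set.range σ then 0 else w ⟨j, h⟩

lemma extendZero_apply {k n : ℕ} (σ : Fin k ↪o Fin n) (w : {j : Fin n // j ∉ Set.range σ} → ℂ)
    (j : {j : Fin n // j ∉ Set.range σ}) : extendZero σ w j = w j := by
  simp only [extendZero, dif_neg j.2]

lemma extendZero_range {k n : ℕ} (σ : Fin k ↪o Fin n) (w : {j : Fin n // j ∉ Set.range σ} → ℂ)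
    (i : Fin k) : extendZero σ w (σ i) = 0 := by
  simp [extendZero]

lemma fillMatrix_add {k n : ℕ} (σ : Fin k ↪o Fin n)
    (x : Matrix (Fin k) {j : Fin n // j ∉ Set.range σ} ℂ) (u : Fin k → ℂ)
    (w : {j : Fin n // j ∉ Set.range σ} → ℂ) (t : ℂ) :
    fillMatrix σ (x + t • Matrix.vecMulVec u w) =
      fillMatrix σ x + t • Matrix.vecMulVec u (extendZero σ w) := by
  ext i j
  by_cases hj : j ∈ Set.range σ
  · simp only [fillMatrix, extendZero, Matrix.of_apply, Matrix.add_apply, Matrix.smul_apply,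
      Matrix.vecMulVec_apply, dif_pos hj, smul_eq_mul, mul_zero, add_zero]
  · simp only [fillMatrix, extendZero, Matrix.of_apply, Matrix.add_apply, Matrix.smul_apply,
      Matrix.vecMulVec_apply, dif_neg hj]

/-! ### Systems that transform like the quotient bundle. -/

namespace QuotSystem

variable {k n : ℕ} {F : (Fin k ↪o Fin n) → Matrix (Fin k) (Fin n) ℂ → Fin n → ℂ}

open Polynomial in
-- Comparison with the chart at infinity gives `p j (t) = t Q (t⁻¹)` with `Q = X * q j - q (σ a) *
-- (X * C (M a j) + C (w j))`. The slope is `Q 0`, a multiple of `w j` with a factor independent of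
-- `j`.
lemma line_normal (hF : QuotSystem F) {σ : Fin k ↪o Fin n} {M : Matrix (Fin k) (Fin n) ℂ}
    (hM : M.submatrix id σ = 1) {u : Fin k → ℂ} {w : Fin n → ℂ} (hw : ∀ i, w (σ i) = 0)
    {a : Fin k} {b : Fin n} (ha : u a = 1) (hb : w b = 1) (hab : M a b = 0) :
    ∃ (A : Fin n → ℂ) (L : ℂ), ∀ t j,
      F σ (M + t • Matrix.vecMulVec u w) j = A j + t * (L * w j) := by
  obtain ⟨τ, e, N, hτ, hN, hG⟩ := exists_curve hM hw ha hb hab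
  choose p hp using hF.poly σ _ (polyLine_submatrix hM u hw)
  choose q hq using hF.poly τ _ hN
  simp only [polyLine_map] at hp
  -- For `i ≠ a` the column `σ i` is also one of the normalized columns of `τ`, so of the correction
  -- terms in the transition only the one for `σ a` survives.
  have hq0 : ∀ i, i ≠ a → ∀ t, (q (σ i)).eval t = 0 := by
    intro i hi t
    have h1 := hF.apply_of_mem τ (N.map (eval t)) (e.symm i)
    rw [hτ, Equiv.apply_symm_apply, Function.update_of_ne hi] at h1
    rw [← hq, h1]
  have key : ∀ j, ∃ A : ℂ, ∀ t, (p j).eval t = A + t * (X * q j -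
      q (σ a) * (X * C (M a j) + C (w j))).eval 0 := by
    intro j
    refine eval_eq_of_eval_eq_mul_inv fun t ht => ?_
    obtain ⟨G, hG⟩ := hG t ht
    have hN' : (N.map (eval t⁻¹)).submatrix id τ = 1 := by
      rw [← coe_evalRingHom, Matrix.submatrix_map, hN]; simp
    have h1 := congr_fun (hF.trans σ τ _ _ G (submatrix_add_vecMulVec hM u hw t) hN' hG) j
    rw [vecMul_projMatrix_apply, hp, Finset.sum_eq_single a] at h1
    · simp only [hq] at h1
      rw [h1]
      simp only [Matrix.add_apply, Matrix.smul_apply, Matrix.vecMulVec_apply, ha, one_mul,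
        smul_eq_mul, eval_sub, eval_mul, eval_X, eval_add, eval_C]
      field_simp
    · intro i _ hi
      rw [hq, hq0 i hi, zero_mul]
    · simp
  choose A hA using key
  refine ⟨A, -(q (σ a)).eval 0, fun t j => ?_⟩
  rw [hp, hA]
  simp

end QuotSystem

lemma submatrix_eq_of_eq_mul {k n : ℕ} {B : Type} [CommRing B] {σ : Fin k ↪o Fin n}
    {M M' : Matrix (Fin k) (Fin n) B} {G : Matrix (Fin k) (Fin k) B} (hM : M.submatrix id σ = 1)
    (h : M' = G * M) : M'.submatrix id σ = G := by
  rw [h, submatrix_mul_right, hM, Matrix.mul_one]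

lemma extendZero_ne_zero {k n : ℕ} (σ : Fin k ↪o Fin n) {w : {j : Fin n // j ∉ Set.range σ} → ℂ}
    (hw : w ≠ 0) : extendZero σ w ≠ 0 := by
  intro h
  apply hw
  ext j
  rw [← extendZero_apply σ w, h]; rfl

namespace QuotSystem

variable {k n : ℕ} {F : (Fin k ↪o Fin n) → Matrix (Fin k) (Fin n) ℂ → Fin n → ℂ}

lemma line (hF : QuotSystem F) {σ : Fin k ↪o Fin n} {M : Matrix (Fin k) (Fin n) ℂ}
    (hM : M.submatrix id σ = 1) {u : Fin k → ℂ} {w : Fin n → ℂ} (hw : ∀ i, w (σ i) = 0)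
    (hu0 : u ≠ 0) (hw0 : w ≠ 0) :
    ∃ (A : Fin n → ℂ) (L : ℂ), ∀ t j,
      F σ (M + t • Matrix.vecMulVec u w) j = A j + t * (L * w j) := by
  obtain ⟨M₀, u', w', a, b, c, d, e, hM₀, hw', ha, hb, hab, hu, hd, ht⟩ :=
    exists_line_normal σ hM hw hu0 hw0
  obtain ⟨A, L, hAL⟩ := hF.line_normal hM₀ hw' ha hb hab
  refine ⟨fun j => A j + e * (L * w' j), u a * w b * (L * d), fun t j => ?_⟩
  rw [ht, hAL, hd]
  simp only [Pi.smul_apply, smul_eq_mul]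
  ring

/-- The coordinates of `v` modulo the row space are `v j - ∑ i, v (σ i) * M i j`. So `v` is the
constant part `c` outside of `σ` and minus the linear part `l` on `σ`. -/
lemma exists_vec_chart (hF : QuotSystem F) (σ : Fin k ↪o Fin n) :
    ∃ v : Fin n → ℂ, ∀ M, M.submatrix id σ = 1 → F σ M = Matrix.vecMul v (projMatrix σ M) := by
  classical
  obtain ⟨c, l, hcl⟩ := exists_affine_of_rank_one
    (fun (x : Matrix (Fin k) {j : Fin n // j ∉ Set.range σ} ℂ)
      (j : {j : Fin n // j ∉ Set.range σ}) => F σ (fillMatrix σ x) j) (by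
    intro x u w hu hw
    obtain ⟨A, L, hAL⟩ := hF.line (fillMatrix_submatrix σ x) (extendZero_range σ w) hu
      (extendZero_ne_zero σ hw)
    refine ⟨fun j => A j, L, fun t j => ?_⟩
    rw [fillMatrix_add, hAL, extendZero_apply])
  cases isEmpty_or_nonempty (Fin k) with
  | inl hk =>
    have hσ : ∀ j, j ∉ Set.range σ := by rintro j ⟨i, -⟩; exact hk.elim i
    refine ⟨fun j => c ⟨j, hσ j⟩, fun M hM => ?_⟩
    ext j
    rw [vecMul_projMatrix_apply]
    have := hcl (M.submatrix id Subtype.val) ⟨j, hσ j⟩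
    rw [fillMatrix_eq hM] at this
    simpa using this
  | inr hk =>
    have hinv : ∀ i, Function.invFun σ (σ i) = i := Function.leftInverse_invFun σ.injective
    refine ⟨fun j => if h : j ∈ Set.range σ then -l (Function.invFun σ j) else c ⟨j, h⟩,
      fun M hM => ?_⟩
    ext j
    by_cases hj : j ∈ Set.range σ
    · obtain ⟨i, rfl⟩ := hj
      rw [hF.apply_of_mem, Matrix.vecMul, dotProduct]
      exact (Finset.sum_eq_zero fun l _ => by
        rw [projMatrix_apply_of_mem σ M hM l _ ⟨i, rfl⟩, mul_zero]).symm
    · rw [vecMul_projMatrix_apply]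
      have := hcl (M.submatrix id Subtype.val) ⟨j, hj⟩
      rw [fillMatrix_eq hM] at this
      simp only [dif_neg hj]
      rw [this]
      have h1 : ∀ i, (if h : σ i ∈ Set.range σ then -l (Function.invFun σ (σ i)) else
          c ⟨σ i, h⟩) = -l i := fun i => by rw [dif_pos ⟨i, rfl⟩, hinv]
      simp only [h1]
      simp

open Polynomial in
/-- Sections of the quotient bundle are given by vectors. -/
theorem exists_vec (hF : QuotSystem F) : ∃ v : Fin n → ℂ, ∀ (σ : Fin k ↪o Fin n) M,
    M.submatrix id σ = 1 → F σ M = Matrix.vecMul v (projMatrix σ M) := by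
  cases isEmpty_or_nonempty (Fin k ↪o Fin n) with
  | inl h => exact ⟨0, fun σ => h.elim σ⟩
  | inr h =>
    obtain ⟨σ₀⟩ := h
    obtain ⟨v, hv⟩ := hF.exists_vec_chart σ₀
    refine ⟨v, fun σ M hM => ?_⟩
    -- Passage from the chart `σ₀` to `σ`: along a line through `M` that meets `σ₀` both sides are
    -- polynomials, equal for all but finitely many parameters, hence also at `0`.
    obtain ⟨N, q, hq, hN, hN0, hline⟩ := exists_line σ σ₀ hM
    ext j
    obtain ⟨p, hp⟩ := hF.poly σ N hN j
    have h0 : p - (C (v j) - ∑ i, C (v (σ i)) * N i j) = 0 := by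
      refine polynomial_eq_zero_of_eval hq fun t ht => ?_
      obtain ⟨M', G, hM', hG⟩ := hline t ht
      have hNt : (N.map (eval t)).submatrix id σ = 1 := by
        rw [← coe_evalRingHom, Matrix.submatrix_map, hN]; simp
      have h1 := hF.trans σ σ₀ _ _ G hNt hM' hG
      rw [hv M' hM', Matrix.vecMul_vecMul, projMatrix_mul σ σ₀ _ _ hNt (by
        rw [submatrix_eq_of_eq_mul hNt hG]; exact hG)] at h1
      have h2 := congr_fun h1 j
      rw [hp, vecMul_projMatrix_apply] at h2
      rw [eval_sub, h2]
      simp [eval_finsetSum]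
    have h3 := hp 0
    rw [sub_eq_zero.1 h0, hN0] at h3
    rw [h3, vecMul_projMatrix_apply, ← hN0]
    simp [eval_finsetSum]

end QuotSystem

/-! ### Systems that transform like the dual of the subbundle. -/

namespace SubDualSystem

variable {k n : ℕ} {F : (Fin k ↪o Fin n) → Matrix (Fin k) (Fin n) ℂ → Fin k → ℂ}

open Polynomial in
-- The transition matrix consists of the columns `τ` of `M + t u ⊗ w`. Only column `b` depends on
-- `t`, with entries `M i b + t * u i`, so the slope at infinity is a multiple of `u i` with a
-- factor independent of `i`.
lemma line_normal (hF : SubDualSystem F) {σ : Fin k ↪o Fin n} {M : Matrix (Fin k) (Fin n) ℂ}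
    (hM : M.submatrix id σ = 1) {u : Fin k → ℂ} {w : Fin n → ℂ} (hw : ∀ i, w (σ i) = 0)
    {a : Fin k} {b : Fin n} (ha : u a = 1) (hb : w b = 1) (hab : M a b = 0) :
    ∃ (A : Fin k → ℂ) (L : ℂ), ∀ t i,
      F σ (M + t • Matrix.vecMulVec u w) i = A i + t * (L * u i) := by
  obtain ⟨τ, e, N, hτ, hN, hG⟩ := exists_curve hM hw ha hb hab
  choose p hp using hF.poly σ _ (polyLine_submatrix hM u hw)
  choose q hq using hF.poly τ _ hN
  simp only [polyLine_map] at hp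
  have key : ∀ i, ∃ A : ℂ, ∀ t, (p i).eval t = A + t * ((X * C (M i b) + C (u i)) * q (e.symm a) +
      X * (if i = a then 0 else q (e.symm i))).eval 0 := by
    intro i
    refine eval_eq_of_eval_eq_mul_inv fun t ht => ?_
    obtain ⟨G, hG⟩ := hG t ht
    have hN' : (N.map (eval t⁻¹)).submatrix id τ = 1 := by
      rw [← coe_evalRingHom, Matrix.submatrix_map, hN]; simp
    have hMt := submatrix_add_vecMulVec hM u hw t
    have h1 := congr_fun (hF.trans σ τ _ _ G hMt hN' hG) i
    rw [Matrix.mulVec, dotProduct, hp, ← Equiv.sum_comp e.symm] at h1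
    have h2 : ∀ m, (M + t • Matrix.vecMulVec u w) i (σ m) = (1 : Matrix _ _ _) i m :=
      fun m => congr_fun (congr_fun hMt i) m
    have h3 : ∀ m, (M + t • Matrix.vecMulVec u w) i (Function.update σ a b m) =
        if m = a then M i b + t * u i else if i = m then 1 else 0 := by
      intro m
      by_cases hm : m = a
      · subst hm
        simp [Matrix.vecMulVec_apply, hb]
      · rw [Function.update_of_ne hm, h2, if_neg hm, Matrix.one_apply]
    have h4 : ∀ m, (if m = a then M i b + t * u i else if i = m then 1 else 0) *
        (q (e.symm m)).eval t⁻¹ = (if m = a then (M i b + t * u i) * (q (e.symm a)).eval t⁻¹ else 0)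
          + if i = m then (if i = a then 0 else (q (e.symm i)).eval t⁻¹) else 0 := by
      intro m
      by_cases hm : m = a
      · subst hm
        by_cases hi : i = m <;> simp [hi]
      · by_cases hi : i = m
        · subst hi; simp [hm]
        · simp [hm, hi]
    simp only [Matrix.submatrix_apply, id, hτ, Equiv.apply_symm_apply, hq, h3, h4,
      Finset.sum_add_distrib, Finset.sum_ite_eq, Finset.sum_ite_eq', Finset.mem_univ, if_true] at h1
    rw [h1]
    by_cases hi : i = a
    · simp [hi]
      field_simp
    · simp [hi]
      field_simp
  choose A hA using key
  refine ⟨A, (q (e.symm a)).eval 0, fun t i => ?_⟩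
  rw [hp, hA]
  simp only [eval_add, eval_mul, eval_X, eval_C, zero_mul, zero_add, add_zero, mul_comm (u i)]

lemma line (hF : SubDualSystem F) {σ : Fin k ↪o Fin n} {M : Matrix (Fin k) (Fin n) ℂ}
    (hM : M.submatrix id σ = 1) {u : Fin k → ℂ} {w : Fin n → ℂ} (hw : ∀ i, w (σ i) = 0)
    (hu0 : u ≠ 0) (hw0 : w ≠ 0) :
    ∃ (A : Fin k → ℂ) (L : ℂ), ∀ t i,
      F σ (M + t • Matrix.vecMulVec u w) i = A i + t * (L * u i) := by
  obtain ⟨M₀, u', w', a, b, c, d, e, hM₀, hw', ha, hb, hab, hu, hd, ht⟩ :=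
    exists_line_normal σ hM hw hu0 hw0
  obtain ⟨A, L, hAL⟩ := hF.line_normal hM₀ hw' ha hb hab
  refine ⟨fun j => A j + e * (L * u' j), u a * w b * (L * c), fun t j => ?_⟩
  rw [ht, hAL, hu]
  simp only [Pi.smul_apply, smul_eq_mul]
  ring

/-- Now the slope is along `u` instead of `w`, so `exists_affine_of_rank_one` is applied to the
transpose. The linear form is the constant part on `σ` and the linear part outside of it. -/
lemma exists_vec_chart (hF : SubDualSystem F) (σ : Fin k ↪o Fin n) :
    ∃ v : Fin n → ℂ, ∀ M, M.submatrix id σ = 1 → F σ M = Matrix.mulVec M v := by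
  classical
  obtain ⟨c, l, hcl⟩ := exists_affine_of_rank_one
    (fun (x : Matrix {j : Fin n // j ∉ Set.range σ} (Fin k) ℂ) (i : Fin k) =>
      F σ (fillMatrix σ x.transpose) i) (by
    intro x w u hw hu
    obtain ⟨A, L, hAL⟩ := hF.line (fillMatrix_submatrix σ x.transpose) (extendZero_range σ w) hu
      (extendZero_ne_zero σ hw)
    refine ⟨A, L, fun t i => ?_⟩
    rw [Matrix.transpose_add, Matrix.transpose_smul, Matrix.transpose_vecMulVec, fillMatrix_add,
      hAL])
  cases isEmpty_or_nonempty (Fin k) with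
  | inl hk => exact ⟨0, fun M hM => funext fun i => hk.elim i⟩
  | inr hk =>
    have hinv : ∀ i, Function.invFun σ (σ i) = i := Function.leftInverse_invFun σ.injective
    refine ⟨fun j => if h : j ∈ Set.range σ then c (Function.invFun σ j) else l ⟨j, h⟩,
      fun M hM => ?_⟩
    ext i
    have := hcl (M.submatrix id Subtype.val).transpose i
    rw [Matrix.transpose_transpose, fillMatrix_eq hM] at this
    rw [this, Matrix.mulVec, dotProduct,
      ← Fintype.sum_subtype_add_sum_subtype (fun j => j ∈ Set.range σ)]
    congr 1
    · have h1 : ∀ m, M i (σ m) = (1 : Matrix _ _ _) i m := fun m => congr_fun (congr_fun hM i) m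
      let e : Fin k ≃ {j : Fin n // j ∈ Set.range σ} := Equiv.ofInjective σ σ.injective
      refine Eq.trans ?_ (Finset.sum_equiv (s := Finset.univ) (f := fun m => M i (σ m) * c m) e
        (by simp) fun m _ => ?_)
      · simp [h1, Matrix.one_apply]
      · have he : (e m).1 = σ m := rfl
        rw [dif_pos (e m).2, he, hinv]
    · refine Finset.sum_congr rfl fun j _ => ?_
      rw [dif_neg j.2]
      simp [mul_comm]

open Polynomial in
/-- Sections of the dual of the tautological subbundle are given by linear forms. -/
theorem exists_vec (hF : SubDualSystem F) : ∃ v : Fin n → ℂ, ∀ (σ : Fin k ↪o Fin n) M,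
    M.submatrix id σ = 1 → F σ M = Matrix.mulVec M v := by
  cases isEmpty_or_nonempty (Fin k ↪o Fin n) with
  | inl h => exact ⟨0, fun σ => h.elim σ⟩
  | inr h =>
    obtain ⟨σ₀⟩ := h
    obtain ⟨v, hv⟩ := hF.exists_vec_chart σ₀
    refine ⟨v, fun σ M hM => ?_⟩
    obtain ⟨N, q, hq, hN, hN0, hline⟩ := exists_line σ σ₀ hM
    ext i
    obtain ⟨p, hp⟩ := hF.poly σ N hN i
    have h0 : p - ∑ j, N i j * C (v j) = 0 := by
      refine polynomial_eq_zero_of_eval hq fun t ht => ?_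
      obtain ⟨M', G, hM', hG⟩ := hline t ht
      have hNt : (N.map (eval t)).submatrix id σ = 1 := by
        rw [← coe_evalRingHom, Matrix.submatrix_map, hN]; simp
      have h1 := hF.trans σ σ₀ _ _ G hNt hM' hG
      have hG1 : (N.map (eval t)).submatrix id σ₀ * G = 1 := by
        rw [mul_eq_one_comm, ← submatrix_mul_right, ← hG, hM']
      rw [hv M' hM', Matrix.mulVec_mulVec, hG, ← Matrix.mul_assoc, hG1, Matrix.one_mul] at h1
      have h2 := congr_fun h1 i
      rw [hp] at h2
      rw [eval_sub, h2]
      simp [eval_finsetSum, Matrix.mulVec, dotProduct]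
    have h3 := hp 0
    rw [sub_eq_zero.1 h0, hN0] at h3
    rw [h3, ← hN0]
    simp [eval_finsetSum, Matrix.mulVec, dotProduct]

end SubDualSystem

/-! ### Systems that transform like the external tensor product. -/

lemma mul_projMatrix_eq_self {k n : ℕ} {p B : Type} [CommRing B] (σ : Fin k ↪o Fin n)
    (M : Matrix (Fin k) (Fin n) B) {A : Matrix p (Fin n) B} (hA : ∀ i l, A i (σ l) = 0) :
    A * projMatrix σ M = A := by
  ext i j
  have := vecMul_projMatrix_apply σ M (A i) j
  simp only [hA, zero_mul, Finset.sum_const_zero, sub_zero] at this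
  exact this

/-- Functions on pairs of matrices in normal form that transform like the coordinates of a section
of the external tensor product of the quotient bundle and the dual of the subbundle. -/
structure BoxSystem {k m n : ℕ} (F : (Fin k ↪o Fin m) → (Fin k ↪o Fin n) →
    Matrix (Fin k) (Fin m) ℂ → Matrix (Fin k) (Fin n) ℂ → Matrix (Fin k) (Fin m) ℂ) : Prop where
  apply_of_mem : ∀ (σ : Fin k ↪o Fin m) σ' M N i l, F σ σ' M N i (σ l) = 0
  poly : ∀ (σ : Fin k ↪o Fin m) (σ' : Fin k ↪o Fin n) (P : Matrix (Fin k) (Fin m) (Polynomial ℂ))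
    (Q : Matrix (Fin k) (Fin n) (Polynomial ℂ)), P.submatrix id σ = 1 → Q.submatrix id σ' = 1 →
    ∀ i j, ∃ p : Polynomial ℂ,
      ∀ t, F σ σ' (P.map (Polynomial.eval t)) (Q.map (Polynomial.eval t)) i j = p.eval t
  trans : ∀ (σ τ : Fin k ↪o Fin m) (σ' τ' : Fin k ↪o Fin n) (M M' : Matrix (Fin k) (Fin m) ℂ)
    (N N' : Matrix (Fin k) (Fin n) ℂ) (G G' : Matrix (Fin k) (Fin k) ℂ), M.submatrix id σ = 1 →
    M'.submatrix id τ = 1 → N.submatrix id σ' = 1 → N'.submatrix id τ' = 1 → M' = G * M →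
    N' = G' * N → F σ σ' M N = N.submatrix id τ' * F τ τ' M' N' * projMatrix σ M

lemma exists_orderEmb_apply {k n : ℕ} (hk : 1 ≤ k) (hkn : k ≤ n) (q : Fin n) :
    ∃ (σ : Fin k ↪o Fin n) (i : Fin k), σ i = q := by
  let c : Fin k → Fin n := fun i => Equiv.swap (Fin.castLE hkn ⟨0, hk⟩) q (Fin.castLE hkn i)
  have hc : Function.Injective c :=
    (Equiv.injective _).comp (Fin.castLE_injective hkn)
  obtain ⟨σ, e, h⟩ := exists_orderEmb_range c hc
  exact ⟨σ, e.symm ⟨0, hk⟩, by rw [h]; simp [c]⟩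

lemma submatrix_map_C {k n : ℕ} {σ : Fin k ↪o Fin n} {M : Matrix (Fin k) (Fin n) ℂ}
    (hM : M.submatrix id σ = 1) : (M.map Polynomial.C).submatrix id σ = 1 := by
  rw [Matrix.submatrix_map, hM]; simp

lemma map_C_map_eval {k n : ℕ} (M : Matrix (Fin k) (Fin n) ℂ) (t : ℂ) :
    (M.map Polynomial.C).map (Polynomial.eval t) = M := by
  ext; simp

/-- Sections of the external tensor product are given by matrices. -/
theorem BoxSystem.exists_matrix {k m n : ℕ} (hk : 1 ≤ k) (hkn : k ≤ n)
    {F : (Fin k ↪o Fin m) → (Fin k ↪o Fin n) →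
      Matrix (Fin k) (Fin m) ℂ → Matrix (Fin k) (Fin n) ℂ → Matrix (Fin k) (Fin m) ℂ}
    (hF : BoxSystem F) : ∃ φ : Matrix (Fin n) (Fin m) ℂ,
      ∀ (σ : Fin k ↪o Fin m) (σ' : Fin k ↪o Fin n) M N, M.submatrix id σ = 1 →
        N.submatrix id σ' = 1 → F σ σ' M N = N * φ * projMatrix σ M := by
  have hsub : ∀ (σ : Fin k ↪o Fin m) (M : Matrix (Fin k) (Fin m) ℂ), M.submatrix id σ = 1 → ∀ j,
      SubDualSystem fun σ' N i => F σ σ' M N i j := by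
    intro σ M hM j
    constructor
    · intro σ' N hN i
      obtain ⟨p, hp⟩ := hF.poly σ σ' _ N (submatrix_map_C hM) hN i j
      simp only [map_C_map_eval] at hp
      exact ⟨p, hp⟩
    · intro σ' τ' N N' G hN hN' hG
      have h1 := hF.trans σ σ σ' τ' M M N N' 1 G hM hM hN hN' (Matrix.one_mul M).symm hG
      rw [Matrix.mul_assoc, mul_projMatrix_eq_self σ M (hF.apply_of_mem σ τ' M N')] at h1
      ext i
      exact congr_fun (congr_fun h1 i) j
  -- For each `q` a coordinate subspace `N₀ q` containing the basis vector `e_q` is fixed. Its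
  -- component along `e_q` is a system of quotient type in `M`, and the resulting vector is row `q`
  -- of the matrix sought.
  choose σ₀ i₀ hq using exists_orderEmb_apply hk hkn
  let N₀ : Fin n → Matrix (Fin k) (Fin n) ℂ := fun q =>
    (1 : Matrix (Fin n) (Fin n) ℂ).submatrix (σ₀ q) id
  have hN₀ : ∀ q, (N₀ q).submatrix id (σ₀ q) = 1 := by
    intro q
    ext i l
    simp [N₀, Matrix.one_apply]
  have hquot : ∀ q, QuotSystem fun σ M j => F σ (σ₀ q) M (N₀ q) (i₀ q) j := by
    intro q
    constructor
    · intro σ M l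
      exact hF.apply_of_mem _ _ _ _ _ _
    · intro σ M hM j
      obtain ⟨p, hp⟩ := hF.poly σ (σ₀ q) M _ hM (submatrix_map_C (hN₀ q)) (i₀ q) j
      simp only [map_C_map_eval] at hp
      exact ⟨p, hp⟩
    · intro σ τ M M' G hM hM' hG
      have h1 := hF.trans σ τ (σ₀ q) (σ₀ q) M M' (N₀ q) (N₀ q) G 1 hM hM' (hN₀ q) (hN₀ q) hG
        (Matrix.one_mul _).symm
      rw [hN₀, Matrix.one_mul] at h1
      exact congr_fun h1 (i₀ q)
  choose φ hφ using fun q => (hquot q).exists_vec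
  refine ⟨Matrix.of φ, fun σ σ' M N hM hN => ?_⟩
  ext i j
  -- With `M` and `j` fixed, the dependence on `N` is a linear form. Evaluation at the subspaces `N₀
  -- q` shows that its coefficients are those predicted by `φ`.
  obtain ⟨v, hv⟩ := (hsub σ M hM j).exists_vec
  have h1 : ∀ q, v q = Matrix.vecMul (φ q) (projMatrix σ M) j := by
    intro q
    have h2 := congr_fun (hv (σ₀ q) (N₀ q) (hN₀ q)) (i₀ q)
    have h3 := congr_fun (hφ q σ M hM) j
    rw [← h3, h2]
    simp [N₀, Matrix.mulVec, dotProduct, Matrix.one_apply, hq]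
  have h4 := congr_fun (hv σ' N hN) i
  rw [Matrix.mul_assoc]
  refine h4.trans ?_
  simp only [Matrix.mulVec, dotProduct, h1]
  rfl

/-! ### Values of functions at points -/

lemma comp_appLE_top {X T T' : Scheme.{0}} (g : T' ⟶ T) (f : T ⟶ X) {U : X.Opens}
    (h : ⊤ ≤ f ⁻¹ᵁ U) (h' : ⊤ ≤ (g ≫ f) ⁻¹ᵁ U) :
    (g ≫ f).appLE U ⊤ h' = f.appLE U ⊤ h ≫ g.appTop := by
  have h1 : (g ≫ f).appLE U ⊤ h' = f.appLE U ⊤ h ≫ g.appLE ⊤ ⊤ (g.preimage_top).ge :=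
    (Scheme.Hom.appLE_comp_appLE _ _ _ _ _ _ _).symm
  have h2 : g.appLE ⊤ ⊤ (g.preimage_top).ge = g.appTop := Scheme.Hom.appLE_eq_app _
  rw [h1, h2]

/-- The value of a function at a point with coordinates in `B`. -/
def val {X : Scheme.{0}} {B : Type} [CommRing B] (f : Spec (.of B) ⟶ X) {U : X.Opens}
    (h : ⊤ ≤ f ⁻¹ᵁ U) : Γ(X, U) →+* B :=
  (Scheme.ΓSpecIso (.of B)).hom.hom.comp (f.appLE U ⊤ h).hom

lemma val_res {X : Scheme.{0}} {B : Type} [CommRing B] (f : Spec (.of B) ⟶ X) {U V : X.Opens}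
    (h : ⊤ ≤ f ⁻¹ᵁ V) (hV : V ≤ U) (a : Γ(X, U)) :
    val f h (res hV a) = val f (h.trans (f.preimage_mono hV)) a :=
  congr_arg (Scheme.ΓSpecIso (.of B)).hom.hom (appLE_res_apply f h hV a)

lemma val_appLE {X Y : Scheme.{0}} {B : Type} [CommRing B] (f : Spec (.of B) ⟶ X) (p : X ⟶ Y)
    {U : X.Opens} {V : Y.Opens} (h : ⊤ ≤ f ⁻¹ᵁ U) (hU : U ≤ p ⁻¹ᵁ V)
    (h' : ⊤ ≤ (f ≫ p) ⁻¹ᵁ V) (a : Γ(Y, V)) :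
    val f h ((p.appLE V U hU).hom a) = val (f ≫ p) h' a := by
  have : (f.appLE U ⊤ h).hom.comp (p.appLE V U hU).hom = ((f ≫ p).appLE V ⊤ h').hom :=
    congr($(Scheme.Hom.appLE_comp_appLE f p _ _ _ _ _).hom)
  exact congr_arg (Scheme.ΓSpecIso (.of B)).hom.hom congr($this a)

lemma ΓSpecIso_hom_appTop {B B' : Type} [CommRing B] [CommRing B'] (φ : B →+* B')
    (b : Γ(Spec (.of B), ⊤)) :
    (Scheme.ΓSpecIso (.of B')).hom.hom ((Spec.map (CommRingCat.ofHom φ)).appTop.hom b) =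
      φ ((Scheme.ΓSpecIso (.of B)).hom.hom b) :=
  congr($(Scheme.ΓSpecIso_naturality (CommRingCat.ofHom φ)).hom b)

lemma map_val {X : Scheme.{0}} {B B' : Type} [CommRing B] [CommRing B'] (φ : B →+* B')
    (f : Spec (.of B) ⟶ X) {U : X.Opens} (h : ⊤ ≤ f ⁻¹ᵁ U)
    (h' : ⊤ ≤ (Spec.map (CommRingCat.ofHom φ) ≫ f) ⁻¹ᵁ U) (a : Γ(X, U)) :
    φ (val f h a) = val (Spec.map (CommRingCat.ofHom φ) ≫ f) h' a := by
  have h1 := comp_appLE_top (Spec.map (CommRingCat.ofHom φ)) f h h'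
  refine (ΓSpecIso_hom_appTop φ _).symm.trans
    (congr_arg (Scheme.ΓSpecIso (.of B')).hom.hom ?_)
  exact congr($(h1).hom a).symm

/-- A function that vanishes at a point through which every point of `U` factors is zero. -/
lemma eq_zero_of_val_eq_zero {X : Scheme.{0}} {B : Type} [CommRing B] (f : Spec (.of B) ⟶ X)
    {U : X.Opens} (h : ⊤ ≤ f ⁻¹ᵁ U) (ψ : U.toScheme ⟶ Spec (.of B)) (hψ : ψ ≫ f = U.ι)
    (a : Γ(X, U)) (ha : val f h a = 0) : a = 0 := by
  have h0 : (f.appLE U ⊤ h).hom a = 0 := by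
    have hi : Function.Injective (Scheme.ΓSpecIso (.of B)).hom.hom :=
      ((ConcreteCategory.isIso_iff_bijective (Scheme.ΓSpecIso (.of B)).hom).1 inferInstance).1
    exact hi (ha.trans (map_zero _).symm)
  have h1 : U.ι.appLE U ⊤ (by simp) = f.appLE U ⊤ h ≫ ψ.appTop := by
    rw [← comp_appLE_top ψ f h (by rw [hψ]; simp)]
    congr 1
    exact hψ.symm
  have h2 : (U.ι.appLE U ⊤ (by simp)).hom a = 0 := by
    rw [h1]
    exact (congr_arg ψ.appTop.hom h0).trans (map_zero _)
  have hiso : IsIso (U.ι.appLE U ⊤ (by simp)) := by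
    have : IsIso (U.ι.app U) := U.ι.isIso_app _ (by simp)
    rw [Scheme.Hom.appLE]
    have : IsIso (homOfLE (by simp : ⊤ ≤ U.ι ⁻¹ᵁ U)) := ⟨homOfLE le_top, rfl, rfl⟩
    infer_instance
  exact ((ConcreteCategory.isIso_iff_bijective _).1 hiso).1 (h2.trans (map_zero _).symm)

lemma pt_specMap {B B' : Type} [CommRing B] [CommRing B'] (φ : B →+* B') (b : B) :
    (Scheme.ΓSpecIso (.of B')).hom.hom (pt (Spec.map (CommRingCat.ofHom φ)) b) = φ b := by
  have h := ΓSpecIso_hom_appTop φ ((Scheme.ΓSpecIso (.of B)).inv.hom b)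
  refine h.trans (congr_arg φ ?_)
  exact congr($((Scheme.ΓSpecIso (.of B)).inv_hom_id).hom b)

/-- The point of the Grassmannian given by a matrix in normal form with respect to `σ`. -/
def grPt {k n : ℕ} (σ : Fin k ↪o Fin n) {B : Type} [CommRing B] (c : ℂ →+* B)
    (M : Matrix (Fin k) (Fin n) B) : Spec (.of B) ⟶ (Gr k n).left :=
  Spec.map (CommRingCat.ofHom (chartEval σ c M)) ≫ grι σ

section GrPt

variable {k n : ℕ} (σ : Fin k ↪o Fin n) {B B' : Type} [CommRing B] [CommRing B'] (c : ℂ →+* B)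
  (M : Matrix (Fin k) (Fin n) B)

lemma specMap_grPt (φ : B →+* B') :
    Spec.map (CommRingCat.ofHom φ) ≫ grPt σ c M = grPt σ (φ.comp c) (M.map φ) := by
  have : φ.comp (chartEval σ c M) = chartEval σ (φ.comp c) (M.map φ) := by
    refine MvPolynomial.ringHom_ext (fun r => ?_) fun p => ?_ <;> simp [chartEval]
  rw [grPt, grPt, ← this, ← Category.assoc, ← Spec.map_comp]
  rfl

lemma grPt_hom : grPt σ c M ≫ (Gr k n).hom = Spec.map (CommRingCat.ofHom c) := by
  rw [grPt, Category.assoc, grι_hom, ← Spec.map_comp]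
  exact congr(Spec.map (CommRingCat.ofHom $(chartEval_C σ c M)))

lemma le_preimage_grPt : ⊤ ≤ grPt σ c M ⁻¹ᵁ grOpen σ := le_preimage_grOpen σ _

lemma val_grMatrix (hM : M.submatrix id σ = 1) (h : ⊤ ≤ grPt σ c M ⁻¹ᵁ grOpen σ) :
    (grMatrix σ).map (val (grPt σ c M) h) = M := by
  conv_rhs => rw [← chartEval_matrix σ c M hM]
  rw [grMatrix, Matrix.map_map]
  ext i j
  have h1 := appLE_grSec σ (Spec.map (CommRingCat.ofHom (chartEval σ c M))) rfl h
  have h2 := pt_specMap (chartEval σ c M) (chartMatrix σ i j)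
  rw [← h1] at h2
  exact h2

lemma isRowSpace_grPt (hM : M.submatrix id σ = 1) :
    IsRowSpace (grPt σ c M) (M.map (Scheme.ΓSpecIso (.of B)).inv.hom) := by
  have h := (IsRowSpace.of_chart σ (Spec.map (CommRingCat.ofHom (chartEval σ c M)))).1
  have e : (chartMatrix σ).map (pt (Spec.map (CommRingCat.ofHom (chartEval σ c M)))) =
      M.map (Scheme.ΓSpecIso (.of B)).inv.hom := by
    conv_rhs => rw [← chartEval_matrix σ c M hM]
    rw [Matrix.map_map]
    congr 1
    have := Scheme.ΓSpecIso_inv_naturality (CommRingCat.ofHom (chartEval σ c M))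
    exact (congr(⇑$(this).hom)).symm
  rwa [e] at h

lemma grPt_eq {σ τ : Fin k ↪o Fin n} {M M' : Matrix (Fin k) (Fin n) B}
    (hM : M.submatrix id σ = 1) (hM' : M'.submatrix id τ = 1) (G : Matrix (Fin k) (Fin k) B)
    (h : M' = G * M) : grPt τ c M' = grPt σ c M := by
  refine (isRowSpace_grPt τ c M' hM').ext (isRowSpace_grPt σ c M hM)
    (G.map (Scheme.ΓSpecIso (.of B)).inv.hom) ?_ ?_
  · rw [h, Matrix.map_mul]
  · rw [grPt_hom, grPt_hom]

lemma val_comp_algebraMap {X : CScheme} (f : Spec (.of B) ⟶ X.left)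
    (hf : f ≫ X.hom = Spec.map (CommRingCat.ofHom c)) {U : X.left.Opens} (h : ⊤ ≤ f ⁻¹ᵁ U) :
    (val f h).comp (algebraMap ℂ Γ(X.left, U)) = c := by
  have h1 := appLE_top_algebraMap X f U h
  rw [hf] at h1
  rw [val, RingHom.comp_assoc, h1]
  exact RingHom.ext (pt_specMap c)

lemma val_quotCoord (v : Fin n → ℂ) (hM : M.submatrix id σ = 1)
    (h : ⊤ ≤ grPt σ c M ⁻¹ᵁ grOpen σ) (j : {j : Fin n // j ∉ Set.range σ}) :
    val (grPt σ c M) h (quotCoord k n v σ j) = (constRow c v * projMatrix σ M) 0 j.1 := by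
  rw [map_quotCoord, val_grMatrix σ c M hM, val_comp_algebraMap (X := Gr k n) c _ (grPt_hom σ c M) h]

end GrPt

/-- A function on a chart of the Grassmannian that vanishes at all points is zero. -/
lemma eq_zero_of_forall_grPt {k n : ℕ} (σ : Fin k ↪o Fin n) (a : Γ((Gr k n).left, grOpen σ))
    (ha : ∀ M : Matrix (Fin k) (Fin n) ℂ, M.submatrix id σ = 1 →
      val (grPt σ (RingHom.id ℂ) M) (le_preimage_grPt σ _ M) a = 0) : a = 0 := by
  obtain ⟨w, hw⟩ := exists_chart_of_le (grOpen σ).ι σ fun x => x.2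
  have hg : ⊤ ≤ (grι σ) ⁻¹ᵁ grOpen σ := fun x _ => ⟨x, trivial, rfl⟩
  refine eq_zero_of_val_eq_zero (grι σ) hg w hw a ?_
  -- The chart is an affine space over an infinite field, so a function on it is determined by its
  -- values at complex points.
  refine MvPolynomial.funext fun x => ?_
  classical
  let M : Matrix (Fin k) (Fin n) ℂ := (chartMatrix σ).map (MvPolynomial.eval x)
  have hM : M.submatrix id σ = 1 := by
    rw [Matrix.submatrix_map, chartMatrix_submatrix]; simp
  have e : Spec.map (CommRingCat.ofHom (MvPolynomial.eval x)) ≫ grι σ =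
      grPt σ (RingHom.id ℂ) M := by
    rw [grPt]
    congr 3
    refine MvPolynomial.ringHom_ext (fun r => ?_) fun p => ?_
    · simp [chartEval]
    · obtain ⟨i, j, hj⟩ := p
      have hj' : ¬ ∃ y, σ y = j := hj
      simp [chartEval, M, chartMatrix, hj']
  have h1 := map_val (MvPolynomial.eval x) (grι σ) hg (by rw [e]; exact le_preimage_grPt σ _ M) a
  rw [h1, map_zero, ← ha M hM]
  congr 2

lemma val_congr {X : Scheme.{0}} {B : Type} [CommRing B] {f f' : Spec (.of B) ⟶ X} (e : f = f')
    {U : X.Opens} (h : ⊤ ≤ f ⁻¹ᵁ U) (h' : ⊤ ≤ f' ⁻¹ᵁ U) (a : Γ(X, U)) :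
    val f h a = val f' h' a := by
  subst e; rfl

lemma sum_eq_sum_subtype {α B : Type} [Fintype α] [AddCommMonoid B] {p : α → Prop}
    [Fintype {x // p x}] (a : α → B) (h : ∀ x, ¬ p x → a x = 0) :
    ∑ x, a x = ∑ x : {x // p x}, a x := by
  classical
  rw [← Fintype.sum_subtype_add_sum_subtype p, Finset.sum_eq_zero (fun x : {x // ¬ p x} => ?_),
    add_zero]
  · exact Finset.sum_congr (by ext; simp) fun x _ => rfl
  · exact fun _ => h x.1 x.2

/-! ### All sections of the quotient bundle are given by vectors -/

/-- The coordinates of a section of the quotient bundle on a chart. -/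
def quotComp {k n : ℕ} (s : (tautQuot k n).H0) (σ : Fin k ↪o Fin n)
    (j : {j : Fin n // j ∉ Set.range σ}) : Γ((Gr k n).left, grOpen σ) := s.1 σ j

lemma quotComp_eq_sum {k n : ℕ} (s : (tautQuot k n).H0) (σ τ : Fin k ↪o Fin n)
    (W : (Gr k n).left.Opens) (hW : W = grOpen σ ⊓ grOpen τ) (hσ : W ≤ grOpen σ)
    (hτ : W ≤ grOpen τ) [Fintype {j : Fin n // j ∉ Set.range τ}]
    (j : {j : Fin n // j ∉ Set.range σ}) :
    res hσ (quotComp s σ j) = ∑ l : {j : Fin n // j ∉ Set.range τ},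
      res hσ (projMatrix σ (grMatrix σ) l j) * res hτ (quotComp s τ l) := by
  subst hW
  have e : ‹Fintype {j : Fin n // j ∉ Set.range τ}› = (tautQuot k n).fintype τ :=
    Subsingleton.elim _ _
  subst e
  exact congr_fun (s.2 σ τ) j

open Classical in
/-- The coordinates of a section of the quotient bundle at a point. -/
def quotVal {k n : ℕ} (s : (tautQuot k n).H0) (σ : Fin k ↪o Fin n) {B : Type} [CommRing B]
    (c : ℂ →+* B) (M : Matrix (Fin k) (Fin n) B) (j : Fin n) : B :=
  if h : j ∈ Set.range σ then 0 else
    val (grPt σ c M) (le_preimage_grPt σ c M) (quotComp s σ ⟨j, h⟩)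

lemma quotVal_of_mem {k n : ℕ} (s : (tautQuot k n).H0) {σ : Fin k ↪o Fin n} {B : Type} [CommRing B]
    (c : ℂ →+* B) (M : Matrix (Fin k) (Fin n) B) {j : Fin n} (hj : j ∈ Set.range σ) :
    quotVal s σ c M j = 0 := dif_pos hj

lemma quotVal_of_notMem {k n : ℕ} (s : (tautQuot k n).H0) {σ : Fin k ↪o Fin n} {B : Type}
    [CommRing B] (c : ℂ →+* B) (M : Matrix (Fin k) (Fin n) B) {j : Fin n}
    (hj : j ∉ Set.range σ) : quotVal s σ c M j =
      val (grPt σ c M) (le_preimage_grPt σ c M) (quotComp s σ ⟨j, hj⟩) := dif_neg hj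

lemma map_quotVal {k n : ℕ} (s : (tautQuot k n).H0) (σ : Fin k ↪o Fin n) {B B' : Type}
    [CommRing B] [CommRing B'] (c : ℂ →+* B) (φ : B →+* B') (M : Matrix (Fin k) (Fin n) B)
    (j : Fin n) : φ (quotVal s σ c M j) = quotVal s σ (φ.comp c) (M.map φ) j := by
  by_cases hj : j ∈ Set.range σ
  · rw [quotVal_of_mem s c M hj, quotVal_of_mem s _ _ hj, map_zero]
  · rw [quotVal_of_notMem s c M hj, quotVal_of_notMem s _ _ hj]
    have h : ⊤ ≤ (Spec.map (CommRingCat.ofHom φ) ≫ grPt σ c M) ⁻¹ᵁ grOpen σ := by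
      rw [specMap_grPt]; exact le_preimage_grPt σ _ _
    exact (map_val φ (grPt σ c M) _ h (quotComp s σ ⟨j, hj⟩)).trans
      (val_congr (specMap_grPt σ c M φ) _ _ _)

/-- Two matrices with the same row space give the same `B`-valued point, so this is the gluing
condition of the section evaluated there. -/
lemma quotVal_trans {k n : ℕ} (s : (tautQuot k n).H0) (σ τ : Fin k ↪o Fin n) {B : Type}
    [CommRing B] (c : ℂ →+* B) (M M' : Matrix (Fin k) (Fin n) B) (G : Matrix (Fin k) (Fin k) B)
    (hM : M.submatrix id σ = 1) (hM' : M'.submatrix id τ = 1) (h : M' = G * M) :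
    quotVal s σ c M = Matrix.vecMul (quotVal s τ c M') (projMatrix σ M) := by
  funext j
  let _ : Fintype {j : Fin n // j ∉ Set.range τ} := (tautQuot k n).fintype τ
  have e : Matrix.vecMul (quotVal s τ c M') (projMatrix σ M) j =
      ∑ l : {j : Fin n // j ∉ Set.range τ},
        quotVal s τ c M' l * projMatrix σ M l j :=
    sum_eq_sum_subtype (p := fun l => l ∉ Set.range τ)
      (fun l => quotVal s τ c M' l * projMatrix σ M l j) fun l hl => by rw [quotVal_of_mem s c M' (not_not.1 hl), zero_mul]
  rw [e]
  by_cases hj : j ∈ Set.range σ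
  · rw [quotVal_of_mem s c M hj]
    exact (Finset.sum_eq_zero fun l _ => by
      rw [projMatrix_apply_of_mem σ M hM _ _ hj, mul_zero]).symm
  · rw [quotVal_of_notMem s c M hj]
    have hf := grPt_eq c hM hM' G h
    have h1 : ⊤ ≤ grPt σ c M ⁻¹ᵁ grOpen σ := le_preimage_grPt σ c M
    have h2 : ⊤ ≤ grPt σ c M ⁻¹ᵁ grOpen τ := by rw [← hf]; exact le_preimage_grPt τ c M'
    have h3 : ⊤ ≤ grPt σ c M ⁻¹ᵁ (grOpen σ ⊓ grOpen τ) := le_inf h1 h2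
    have hs := congr_arg (val (grPt σ c M) h3)
      (quotComp_eq_sum s σ τ _ rfl inf_le_left inf_le_right ⟨j, hj⟩)
    rw [val_res, map_sum] at hs
    refine hs.trans (Finset.sum_congr rfl fun l _ => ?_)
    rw [map_mul, mul_comm]
    refine congr_arg₂ (· * ·) ?_ ?_
    · rw [quotVal_of_notMem s c M' l.2]
      exact (val_res (grPt σ c M) h3 inf_le_right (quotComp s τ l)).trans (val_congr hf.symm _ _ _)
    · refine (val_res (grPt σ c M) h3 inf_le_left (projMatrix σ (grMatrix σ) l.1 j)).trans ?_
      have h4 := map_projMatrix σ (val (grPt σ c M) h1) (grMatrix σ)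
      rw [val_grMatrix σ c M hM] at h4
      exact congr_fun (congr_fun h4 l.1) j

lemma quotSystem_quotVal {k n : ℕ} (s : (tautQuot k n).H0) :
    QuotSystem fun σ M => quotVal s σ (RingHom.id ℂ) M where
  apply_of_mem σ M i := quotVal_of_mem s _ M ⟨i, rfl⟩
  poly σ N _ j := by
    -- A polynomial matrix is a point with values in `ℂ[X]`; the value of the section there is the
    -- polynomial, and specializing the point evaluates it at `t`.
    refine ⟨quotVal s σ Polynomial.C N j, fun t => ?_⟩
    have h := map_quotVal s σ Polynomial.C (Polynomial.evalRingHom t) N j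
    have e : (Polynomial.evalRingHom t).comp Polynomial.C = RingHom.id ℂ := by ext; simp
    rw [e] at h
    exact h.symm
  trans σ τ M M' G hM hM' h := quotVal_trans s σ τ _ M M' G hM hM' h

lemma quotVal_quotSection {k n : ℕ} (v : Fin n → ℂ) (σ : Fin k ↪o Fin n)
    (M : Matrix (Fin k) (Fin n) ℂ) (hM : M.submatrix id σ = 1) :
    quotVal (quotSection k n v) σ (RingHom.id ℂ) M = Matrix.vecMul v (projMatrix σ M) := by
  funext j
  have hc : (constRow (RingHom.id ℂ) v * projMatrix σ M) 0 j = Matrix.vecMul v (projMatrix σ M) j :=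
    rfl
  rw [← hc]
  by_cases hj : j ∈ Set.range σ
  · rw [quotVal_of_mem _ _ M hj, mul_projMatrix_apply_of_mem σ M hM _ _ _ hj]
  · rw [quotVal_of_notMem _ _ M hj]
    exact val_quotCoord σ (RingHom.id ℂ) M v hM (le_preimage_grPt σ _ M) ⟨j, hj⟩

/-- The values at complex points form a system of quotient type, hence come from a vector, and
functions on a chart are determined by such values. -/
lemma quotSection_surjective (k n : ℕ) : Function.Surjective (quotSection k n) := by
  intro s
  obtain ⟨v, hv⟩ := (quotSystem_quotVal s).exists_vec
  refine ⟨v, Subtype.ext (funext fun (σ : Fin k ↪o Fin n) => funext fun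
    (j : {j : Fin n // j ∉ Set.range σ}) => sub_eq_zero.1 ?_)⟩
  refine eq_zero_of_forall_grPt σ _ fun M hM => ?_
  have h := congr_fun ((quotVal_quotSection v σ M hM).trans (hv σ M hM).symm) j.1
  rw [quotVal_of_notMem _ _ M j.2, quotVal_of_notMem _ _ M j.2] at h
  exact (map_sub (val (grPt σ (RingHom.id ℂ) M) (le_preimage_grPt σ _ M)) _ _).trans
    (sub_eq_zero.2 h)

lemma one_submatrix_submatrix {k n : ℕ} (σ : Fin k ↪o Fin n) :
    ((1 : Matrix (Fin n) (Fin n) ℂ).submatrix σ id).submatrix id σ = 1 := by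
  ext i l
  simp [Matrix.one_apply]

lemma exists_orderEmb_notMem {k n : ℕ} (hkn : k < n) (q : Fin n) :
    ∃ σ : Fin k ↪o Fin n, q ∉ Set.range σ := by
  obtain ⟨n, rfl⟩ := Nat.exists_eq_succ_of_ne_zero (by omega : n ≠ 0)
  refine ⟨(Fin.castLEOrderEmb (by omega)).trans q.succAboveOrderEmb, ?_⟩
  rintro ⟨i, hi⟩
  exact Fin.succAbove_ne q _ hi

lemma vecMul_projMatrix_one_submatrix {k n : ℕ} (σ : Fin k ↪o Fin n) (v : Fin n → ℂ) (q : Fin n)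
    (hq : q ∉ Set.range σ) :
    Matrix.vecMul v (projMatrix σ ((1 : Matrix (Fin n) (Fin n) ℂ).submatrix σ id)) q = v q := by
  rw [vecMul_projMatrix_apply, Finset.sum_eq_zero, sub_zero]
  intro i _
  have : σ i ≠ q := fun e => hq ⟨i, e⟩
  simp [this]

/-- The entry `v q` is a coordinate of the section at a coordinate subspace that does not contain
the basis vector `e_q`; such a subspace exists because `k < n`. -/
lemma quotSection_injective {k n : ℕ} (hkn : k < n) : Function.Injective (quotSection k n) := by
  rw [injective_iff_map_eq_zero]
  intro v hv
  funext q
  obtain ⟨σ, hσ⟩ := exists_orderEmb_notMem hkn q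
  have h := quotVal_quotSection v σ _ (one_submatrix_submatrix σ)
  rw [hv, ← map_zero (quotSection k n), quotVal_quotSection 0 σ _ (one_submatrix_submatrix σ),
    Matrix.zero_vecMul] at h
  rw [← vecMul_projMatrix_one_submatrix σ v q hσ, ← h]

/-! ### All sections of `𝒬 ⊠ 𝒰^∨` are given by matrices -/

/-- The coordinates of a section of `𝒬 ⊠ 𝒰^∨` on a product of charts. -/
def boxComp {k m n : ℕ} (s : (quotBoxSubDual k m n).H0) (σ : Fin k ↪o Fin m) (σ' : Fin k ↪o Fin n)
    (j : {j : Fin m // j ∉ Set.range σ}) (i : Fin k) :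
    Γ((prodC (Gr k m) (Gr k n)).left, boxOpen σ σ') := s.1 (σ, σ') (j, i)

lemma boxComp_eq_sum {k m n : ℕ} (s : (quotBoxSubDual k m n).H0) (σ τ : Fin k ↪o Fin m)
    (σ' τ' : Fin k ↪o Fin n) (W : (prodC (Gr k m) (Gr k n)).left.Opens)
    (hW : W = boxOpen σ σ' ⊓ boxOpen τ τ') (h₁ : W ≤ boxOpen σ σ') (h₂ : W ≤ boxOpen τ τ')
    [Fintype {j : Fin m // j ∉ Set.range τ}] (j : {j : Fin m // j ∉ Set.range σ}) (i : Fin k) :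
    res h₁ (boxComp s σ σ' j i) = ∑ b : {j : Fin m // j ∉ Set.range τ} × Fin k,
      (((fstC (Gr k m) (Gr k n)).left.appLE (grOpen σ) W (h₁.trans inf_le_left)).hom
          (projMatrix σ (grMatrix σ) b.1 j) *
        ((sndC (Gr k m) (Gr k n)).left.appLE (grOpen σ') W (h₁.trans inf_le_right)).hom
          (grMatrix σ' i (τ' b.2))) * res h₂ (boxComp s τ τ' b.1 b.2) := by
  subst hW
  have e : ‹Fintype {j : Fin m // j ∉ Set.range τ}› = (tautQuot k m).fintype τ :=
    Subsingleton.elim _ _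
  subst e
  refine (congr_fun (s.2 (σ, σ') (τ, τ')) (j, i)).trans
    (Finset.sum_congr rfl fun b _ => Eq.symm ?_)
  refine congr_arg₂ (· * ·) (congr_arg₂ (· * ·) ?_ ?_) rfl
  · exact (res_appLE_res (fstC (Gr k m) (Gr k n)).left _ _ _ (h₁.trans inf_le_left)
      (projMatrix σ (grMatrix σ) b.1.1 j.1)).symm
  · refine Eq.trans ?_ (congr_arg (fun c => res _
      (((sndC (Gr k m) (Gr k n)).left.appLE (grOpen σ' ⊓ grOpen τ') _ _).hom c))
      (res_res _ _ (grMatrix σ' i (τ' b.2))).symm)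
    exact (res_appLE_res (sndC (Gr k m) (Gr k n)).left _ _ _ (h₁.trans inf_le_right)
      (grMatrix σ' i (τ' b.2))).symm

/-- The point of the product of two Grassmannians given by two matrices in normal form. -/
def boxPt {k m n : ℕ} (σ : Fin k ↪o Fin m) (σ' : Fin k ↪o Fin n) {B : Type} [CommRing B]
    (c : ℂ →+* B) (M : Matrix (Fin k) (Fin m) B) (N : Matrix (Fin k) (Fin n) B) :
    Spec (.of B) ⟶ (prodC (Gr k m) (Gr k n)).left :=
  pullback.lift (grPt σ c M) (grPt σ' c N) (by rw [grPt_hom, grPt_hom])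

section BoxPt

variable {k m n : ℕ} (σ : Fin k ↪o Fin m) (σ' : Fin k ↪o Fin n) {B B' : Type} [CommRing B]
  [CommRing B'] (c : ℂ →+* B) (M : Matrix (Fin k) (Fin m) B) (N : Matrix (Fin k) (Fin n) B)

lemma boxPt_fst : boxPt σ σ' c M N ≫ (fstC (Gr k m) (Gr k n)).left = grPt σ c M :=
  pullback.lift_fst _ _ _

lemma boxPt_snd : boxPt σ σ' c M N ≫ (sndC (Gr k m) (Gr k n)).left = grPt σ' c N :=
  pullback.lift_snd _ _ _

lemma prodC_hom_ext {T : Scheme.{0}} {X Y : CScheme} {f g : T ⟶ (prodC X Y).left}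
    (h₁ : f ≫ (fstC X Y).left = g ≫ (fstC X Y).left)
    (h₂ : f ≫ (sndC X Y).left = g ≫ (sndC X Y).left) : f = g :=
  pullback.hom_ext h₁ h₂

lemma boxPt_hom :
    boxPt σ σ' c M N ≫ (prodC (Gr k m) (Gr k n)).hom = Spec.map (CommRingCat.ofHom c) := by
  rw [comp_prodC_hom, boxPt_snd, grPt_hom]

lemma specMap_boxPt (φ : B →+* B') :
    Spec.map (CommRingCat.ofHom φ) ≫ boxPt σ σ' c M N =
      boxPt σ σ' (φ.comp c) (M.map φ) (N.map φ) := by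
  refine prodC_hom_ext ?_ ?_
  · rw [Category.assoc, boxPt_fst, boxPt_fst, specMap_grPt]
  · rw [Category.assoc, boxPt_snd, boxPt_snd, specMap_grPt]

lemma le_preimage_boxPt : ⊤ ≤ boxPt σ σ' c M N ⁻¹ᵁ boxOpen σ σ' := by
  have h1 : ⊤ ≤ (boxPt σ σ' c M N ≫ (fstC (Gr k m) (Gr k n)).left) ⁻¹ᵁ grOpen σ := by
    rw [boxPt_fst]; exact le_preimage_grPt σ c M
  have h2 : ⊤ ≤ (boxPt σ σ' c M N ≫ (sndC (Gr k m) (Gr k n)).left) ⁻¹ᵁ grOpen σ' := by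
    rw [boxPt_snd]; exact le_preimage_grPt σ' c N
  exact le_inf h1 h2

lemma val_fst_grMatrix (hM : M.submatrix id σ = 1) {W : (prodC (Gr k m) (Gr k n)).left.Opens}
    (hW : W ≤ (fstC (Gr k m) (Gr k n)).left ⁻¹ᵁ grOpen σ)
    (h : ⊤ ≤ boxPt σ σ' c M N ⁻¹ᵁ W) :
    (grMatrix σ).map ((val (boxPt σ σ' c M N) h).comp
      ((fstC (Gr k m) (Gr k n)).left.appLE (grOpen σ) W hW).hom) = M := by
  conv_rhs => rw [← val_grMatrix σ c M hM (le_preimage_grPt σ c M)]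
  ext i j
  have h' : ⊤ ≤ (boxPt σ σ' c M N ≫ (fstC (Gr k m) (Gr k n)).left) ⁻¹ᵁ grOpen σ := by
    rw [boxPt_fst]; exact le_preimage_grPt σ c M
  exact (val_appLE _ _ h hW h' _).trans (val_congr (boxPt_fst σ σ' c M N) _ _ _)

lemma val_snd_grMatrix (hN : N.submatrix id σ' = 1) {W : (prodC (Gr k m) (Gr k n)).left.Opens}
    (hW : W ≤ (sndC (Gr k m) (Gr k n)).left ⁻¹ᵁ grOpen σ')
    (h : ⊤ ≤ boxPt σ σ' c M N ⁻¹ᵁ W) :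
    (grMatrix σ').map ((val (boxPt σ σ' c M N) h).comp
      ((sndC (Gr k m) (Gr k n)).left.appLE (grOpen σ') W hW).hom) = N := by
  conv_rhs => rw [← val_grMatrix σ' c N hN (le_preimage_grPt σ' c N)]
  ext i j
  have h' : ⊤ ≤ (boxPt σ σ' c M N ≫ (sndC (Gr k m) (Gr k n)).left) ⁻¹ᵁ grOpen σ' := by
    rw [boxPt_snd]; exact le_preimage_grPt σ' c N
  exact (val_appLE _ _ h hW h' _).trans (val_congr (boxPt_snd σ σ' c M N) _ _ _)

lemma val_boxCoord (φ : Matrix (Fin n) (Fin m) ℂ) (hM : M.submatrix id σ = 1)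
    (hN : N.submatrix id σ' = 1) (h : ⊤ ≤ boxPt σ σ' c M N ⁻¹ᵁ boxOpen σ σ')
    (a : {j : Fin m // j ∉ Set.range σ} × Fin k) :
    val (boxPt σ σ' c M N) h (boxCoord k m n φ (σ, σ') a) =
      boxMat σ N (φ.map c) M a.2 a.1.1 := by
  refine (map_boxCoord k m n φ (σ, σ') a (val (boxPt σ σ' c M N) h)).trans ?_
  rw [val_fst_grMatrix σ σ' c M N hM, val_snd_grMatrix σ σ' c M N hN,
    val_comp_algebraMap (X := prodC (Gr k m) (Gr k n)) c _ (boxPt_hom σ σ' c M N) h]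

end BoxPt

open Classical in
/-- The coordinates of a section of `𝒬 ⊠ 𝒰^∨` at a point. -/
def boxVal {k m n : ℕ} (s : (quotBoxSubDual k m n).H0) (σ : Fin k ↪o Fin m)
    (σ' : Fin k ↪o Fin n) {B : Type} [CommRing B] (c : ℂ →+* B) (M : Matrix (Fin k) (Fin m) B)
    (N : Matrix (Fin k) (Fin n) B) : Matrix (Fin k) (Fin m) B :=
  Matrix.of fun i j => if h : j ∈ Set.range σ then 0 else
    val (boxPt σ σ' c M N) (le_preimage_boxPt σ σ' c M N) (boxComp s σ σ' ⟨j, h⟩ i)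

section BoxVal

variable {k m n : ℕ} (s : (quotBoxSubDual k m n).H0) {σ : Fin k ↪o Fin m} (σ' : Fin k ↪o Fin n)
  {B B' : Type} [CommRing B] [CommRing B'] (c : ℂ →+* B) (M : Matrix (Fin k) (Fin m) B)
  (N : Matrix (Fin k) (Fin n) B)

lemma boxVal_of_mem (i : Fin k) {j : Fin m} (hj : j ∈ Set.range σ) :
    boxVal s σ σ' c M N i j = 0 := dif_pos hj

lemma boxVal_of_notMem (i : Fin k) {j : Fin m} (hj : j ∉ Set.range σ) :
    boxVal s σ σ' c M N i j =
      val (boxPt σ σ' c M N) (le_preimage_boxPt σ σ' c M N) (boxComp s σ σ' ⟨j, hj⟩ i) :=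
  dif_neg hj

lemma map_boxVal (φ : B →+* B') (i : Fin k) (j : Fin m) :
    φ (boxVal s σ σ' c M N i j) = boxVal s σ σ' (φ.comp c) (M.map φ) (N.map φ) i j := by
  by_cases hj : j ∈ Set.range σ
  · rw [boxVal_of_mem s σ' c M N i hj, boxVal_of_mem s σ' _ _ _ i hj, map_zero]
  · rw [boxVal_of_notMem s σ' c M N i hj, boxVal_of_notMem s σ' _ _ _ i hj]
    have h : ⊤ ≤ (Spec.map (CommRingCat.ofHom φ) ≫ boxPt σ σ' c M N) ⁻¹ᵁ boxOpen σ σ' := by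
      rw [specMap_boxPt]; exact le_preimage_boxPt σ σ' _ _ _
    exact (map_val φ (boxPt σ σ' c M N) _ h _).trans
      (val_congr (specMap_boxPt σ σ' c M N φ) _ _ _)

lemma boxVal_trans {τ : Fin k ↪o Fin m} {τ' : Fin k ↪o Fin n} {M' : Matrix (Fin k) (Fin m) B}
    {N' : Matrix (Fin k) (Fin n) B} (G G' : Matrix (Fin k) (Fin k) B)
    (hM : M.submatrix id σ = 1) (hM' : M'.submatrix id τ = 1) (hN : N.submatrix id σ' = 1)
    (hN' : N'.submatrix id τ' = 1) (hG : M' = G * M) (hG' : N' = G' * N) :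
    boxVal s σ σ' c M N = N.submatrix id τ' * boxVal s τ τ' c M' N' * projMatrix σ M := by
  ext i j
  let _ : Fintype {j : Fin m // j ∉ Set.range τ} := (tautQuot k m).fintype τ
  by_cases hj : j ∈ Set.range σ
  · rw [boxVal_of_mem s σ' c M N i hj, mul_projMatrix_apply_of_mem σ M hM _ _ _ hj]
  · rw [boxVal_of_notMem s σ' c M N i hj]
    have hf : boxPt τ τ' c M' N' = boxPt σ σ' c M N := by
      refine prodC_hom_ext ?_ ?_
      · rw [boxPt_fst, boxPt_fst, grPt_eq c hM hM' G hG]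
      · rw [boxPt_snd, boxPt_snd, grPt_eq c hN hN' G' hG']
    have h1 := le_preimage_boxPt σ σ' c M N
    have h2 : ⊤ ≤ boxPt σ σ' c M N ⁻¹ᵁ boxOpen τ τ' := by
      rw [← hf]; exact le_preimage_boxPt τ τ' c M' N'
    have h3 : ⊤ ≤ boxPt σ σ' c M N ⁻¹ᵁ (boxOpen σ σ' ⊓ boxOpen τ τ') := le_inf h1 h2
    have hs := congr_arg (val (boxPt σ σ' c M N) h3)
      (boxComp_eq_sum s σ τ σ' τ' _ rfl inf_le_left inf_le_right ⟨j, hj⟩ i)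
    rw [val_res, map_sum] at hs
    have e : (N.submatrix id τ' * boxVal s τ τ' c M' N' * projMatrix σ M) i j =
        ∑ b : {j : Fin m // j ∉ Set.range τ} × Fin k,
          (projMatrix σ M b.1 j * N i (τ' b.2)) * boxVal s τ τ' c M' N' b.2 b.1 := by
      rw [Matrix.mul_assoc, Matrix.mul_apply, Fintype.sum_prod_type_right]
      refine Finset.sum_congr rfl fun i' _ => ?_
      rw [Matrix.mul_apply, sum_eq_sum_subtype (p := fun l => l ∉ Set.range τ) _ fun l hl => by
        rw [boxVal_of_mem s τ' c M' N' i' (not_not.1 hl), zero_mul], Finset.mul_sum]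
      refine Finset.sum_congr rfl fun l _ => ?_
      simp only [Matrix.submatrix_apply, id]
      ring
    rw [e]
    refine hs.trans (Finset.sum_congr rfl fun b _ => ?_)
    rw [map_mul, map_mul]
    refine congr_arg₂ (· * ·) (congr_arg₂ (· * ·) ?_ ?_) ?_
    · have h4 := congr_arg (fun P => projMatrix σ P b.1 j)
        (val_fst_grMatrix σ σ' c M N hM (inf_le_left.trans inf_le_left) h3)
      rw [← h4]
      rw [← map_projMatrix]
      rfl
    · exact congr_fun (congr_fun
        (val_snd_grMatrix σ σ' c M N hN (inf_le_left.trans inf_le_right) h3) i) (τ' b.2)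
    · rw [boxVal_of_notMem s τ' c M' N' b.2 b.1.2]
      exact (val_res (boxPt σ σ' c M N) h3 inf_le_right (boxComp s τ τ' b.1 b.2)).trans
        (val_congr hf.symm _ _ _)

end BoxVal

lemma boxSystem_boxVal {k m n : ℕ} (s : (quotBoxSubDual k m n).H0) :
    BoxSystem fun σ σ' M N => boxVal s σ σ' (RingHom.id ℂ) M N where
  apply_of_mem σ σ' M N i l := boxVal_of_mem s σ' _ M N i ⟨l, rfl⟩
  poly σ σ' P Q _ _ i j := by
    refine ⟨boxVal s σ σ' Polynomial.C P Q i j, fun t => ?_⟩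
    have h := map_boxVal s (σ := σ) σ' Polynomial.C P Q (Polynomial.evalRingHom t) i j
    have e : (Polynomial.evalRingHom t).comp Polynomial.C = RingHom.id ℂ := by ext; simp
    rw [e] at h
    exact h.symm
  trans σ τ σ' τ' M M' N N' G G' hM hM' hN hN' hG hG' :=
    boxVal_trans s σ' _ M N G G' hM hM' hN hN' hG hG'

lemma boxVal_boxSection {k m n : ℕ} (φ : Matrix (Fin n) (Fin m) ℂ) (σ : Fin k ↪o Fin m)
    (σ' : Fin k ↪o Fin n) (M : Matrix (Fin k) (Fin m) ℂ) (N : Matrix (Fin k) (Fin n) ℂ)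
    (hM : M.submatrix id σ = 1) (hN : N.submatrix id σ' = 1) :
    boxVal (boxSection k m n φ) σ σ' (RingHom.id ℂ) M N = N * φ * projMatrix σ M := by
  ext i j
  by_cases hj : j ∈ Set.range σ
  · rw [boxVal_of_mem _ _ _ M N i hj, mul_projMatrix_apply_of_mem σ M hM _ _ _ hj]
  · rw [boxVal_of_notMem _ _ _ M N i hj]
    exact val_boxCoord σ σ' (RingHom.id ℂ) M N φ hM hN (le_preimage_boxPt σ σ' _ M N) (⟨j, hj⟩, i)

/-- A function on a product of charts that vanishes at all points is zero. -/
lemma eq_zero_of_forall_boxPt {k m n : ℕ} (σ : Fin k ↪o Fin m) (σ' : Fin k ↪o Fin n)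
    (a : Γ((prodC (Gr k m) (Gr k n)).left, boxOpen σ σ'))
    (ha : ∀ (M : Matrix (Fin k) (Fin m) ℂ) (N : Matrix (Fin k) (Fin n) ℂ),
      M.submatrix id σ = 1 → N.submatrix id σ' = 1 →
      val (boxPt σ σ' (RingHom.id ℂ) M N) (le_preimage_boxPt σ σ' _ M N) a = 0) : a = 0 := by
  let O := boxOpen (m := m) (n := n) σ σ'
  obtain ⟨w, hw⟩ := exists_chart_of_le (O.ι ≫ (fstC (Gr k m) (Gr k n)).left) σ fun x => x.2.1
  obtain ⟨w', hw'⟩ := exists_chart_of_le (O.ι ≫ (sndC (Gr k m) (Gr k n)).left) σ' fun x => x.2.2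
  let I := Fin k × {j : Fin m // j ∉ Set.range σ}
  let I' := Fin k × {j : Fin n // j ∉ Set.range σ'}
  let r : ChartRing σ →+* MvPolynomial (I ⊕ I') ℂ := (MvPolynomial.rename Sum.inl).toRingHom
  let r' : ChartRing σ' →+* MvPolynomial (I ⊕ I') ℂ := (MvPolynomial.rename Sum.inr).toRingHom
  let P := (chartMatrix σ).map r
  let P' := (chartMatrix σ').map r'
  have hP : P.submatrix id σ = 1 := by
    rw [Matrix.submatrix_map, chartMatrix_submatrix]; simp
  have hP' : P'.submatrix id σ' = 1 := by
    rw [Matrix.submatrix_map, chartMatrix_submatrix]; simp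
  have er : chartEval σ MvPolynomial.C P = r := by
    refine chartRing_hom_ext ?_ (chartEval_matrix σ _ P hP)
    rw [chartEval_C]; ext; simp [r]
  have er' : chartEval σ' MvPolynomial.C P' = r' := by
    refine chartRing_hom_ext ?_ (chartEval_matrix σ' _ P' hP')
    rw [chartEval_C]; ext; simp [r']
  -- The product of the charts is the affine space on both sets of coordinates. The morphism given
  -- by `θ` recovers a point from its two projections, which agree on constants by `hC`.
  let θ : MvPolynomial (I ⊕ I') ℂ →+* Γ(O.toScheme, ⊤) :=
    MvPolynomial.eval₂Hom ((pt w).comp MvPolynomial.C)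
      (Sum.elim (fun p => pt w (MvPolynomial.X p)) (fun p => pt w' (MvPolynomial.X p)))
  have hC : (pt w).comp MvPolynomial.C = (pt w').comp MvPolynomial.C := by
    rw [IsRowSpace.pt_C, IsRowSpace.pt_C, hw, hw', Category.assoc, Category.assoc, Over.w, Over.w]
  have h1 : toSpec θ ≫ Spec.map (CommRingCat.ofHom r) = w := by
    apply pt_injective
    rw [pt_comp_map, pt_toSpec]
    refine MvPolynomial.ringHom_ext (fun z => ?_) fun p => ?_ <;> simp [θ, r]
  have h2 : toSpec θ ≫ Spec.map (CommRingCat.ofHom r') = w' := by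
    apply pt_injective
    rw [pt_comp_map, pt_toSpec]
    refine MvPolynomial.ringHom_ext (fun z => ?_) fun p => ?_
    · simpa [θ, r'] using congr($hC z)
    · simp [θ, r']
  refine eq_zero_of_val_eq_zero (boxPt σ σ' MvPolynomial.C P P')
    (le_preimage_boxPt σ σ' _ P P') (toSpec θ) ?_ a ?_
  · refine prodC_hom_ext ?_ ?_
    · rw [Category.assoc, boxPt_fst, grPt, er, ← Category.assoc, h1, hw]
    · rw [Category.assoc, boxPt_snd, grPt, er', ← Category.assoc, h2, hw']
  · refine MvPolynomial.funext fun x => ?_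
    have e : (MvPolynomial.eval x).comp MvPolynomial.C = RingHom.id ℂ := by ext; simp
    have h3 := specMap_boxPt σ σ' MvPolynomial.C P P' (MvPolynomial.eval x)
    rw [e] at h3
    have h4 : ⊤ ≤ (Spec.map (CommRingCat.ofHom (MvPolynomial.eval x)) ≫
        boxPt σ σ' MvPolynomial.C P P') ⁻¹ᵁ boxOpen σ σ' := by
      rw [h3]; exact le_preimage_boxPt σ σ' _ _ _
    have hQ : (P.map (MvPolynomial.eval x)).submatrix id σ = 1 := by
      rw [Matrix.submatrix_map, hP]; simp
    have hQ' : (P'.map (MvPolynomial.eval x)).submatrix id σ' = 1 := by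
      rw [Matrix.submatrix_map, hP']; simp
    rw [map_val _ _ _ h4, map_zero, ← ha _ _ hQ hQ']
    exact val_congr h3 _ _ _

lemma boxSection_surjective {k m n : ℕ} (hk : 1 ≤ k) (hkn : k ≤ n) :
    Function.Surjective (boxSection k m n) := by
  intro s
  obtain ⟨φ, hφ⟩ := (boxSystem_boxVal s).exists_matrix hk hkn
  refine ⟨φ, Subtype.ext (funext fun (p : (Fin k ↪o Fin m) × (Fin k ↪o Fin n)) => funext fun
    (a : {j : Fin m // j ∉ Set.range p.1} × Fin k) => sub_eq_zero.1 ?_)⟩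
  obtain ⟨σ, σ'⟩ := p
  obtain ⟨j, i⟩ := a
  refine eq_zero_of_forall_boxPt σ σ' _ fun M N hM hN => ?_
  have h := congr_fun (congr_fun
    ((boxVal_boxSection φ σ σ' M N hM hN).trans (hφ σ σ' M N hM hN).symm) i) j.1
  rw [boxVal_of_notMem _ _ _ M N i j.2, boxVal_of_notMem _ _ _ M N i j.2] at h
  exact (map_sub (val (boxPt σ σ' (RingHom.id ℂ) M N) (le_preimage_boxPt σ σ' _ M N)) _ _).trans
    (sub_eq_zero.2 h)

/-- The entry `(p, q)` of the matrix is seen at coordinate subspaces, the second containing `e_p`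
and the first avoiding `e_q`. For the latter `k < m` is needed: if `k = m`, the quotient bundle is
zero. -/
lemma boxSection_injective {k m n : ℕ} (hk : 1 ≤ k) (hkn : k ≤ n) (hkm : k < m) :
    Function.Injective (boxSection k m n) := by
  rw [injective_iff_map_eq_zero]
  intro φ hφ
  ext p q
  obtain ⟨σ, hσ⟩ := exists_orderEmb_notMem hkm q
  obtain ⟨σ', i, hi⟩ := exists_orderEmb_apply hk hkn p
  have h := boxVal_boxSection φ σ σ' _ _ (one_submatrix_submatrix σ) (one_submatrix_submatrix σ')
  rw [hφ, ← map_zero (boxSection k m n), boxVal_boxSection 0 σ σ' _ _ (one_submatrix_submatrix σ)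
    (one_submatrix_submatrix σ'), Matrix.mul_zero, Matrix.zero_mul] at h
  have h1 := congr_fun (congr_fun h i) q
  have h2 := vecMul_projMatrix_one_submatrix σ (φ p) q hσ
  refine h2.symm.trans (Eq.trans ?_ h1.symm)
  have e : ((1 : Matrix (Fin n) (Fin n) ℂ).submatrix σ' id * φ) i = φ p := by
    funext l
    simp [Matrix.mul_apply, Matrix.one_apply, hi]
  exact congr_arg (fun v => Matrix.vecMul v
    (projMatrix σ ((1 : Matrix (Fin m) (Fin m) ℂ).submatrix σ id)) q) e.symm

/-! ### Zero loci of general sections as incidence varieties -/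

/-- Morphisms into the closed subscheme are morphisms to the product killing `I`, that is, pairs
satisfying the incidence condition. -/
lemma isIncidenceVariety_subscheme {k m n : ℕ} {φ : Matrix (Fin n) (Fin m) ℂ}
    (I : (prodC (Gr k m) (Gr k n)).left.IdealSheafData)
    (hI : ∀ (T : Scheme.{0}) (h : T ⟶ (prodC (Gr k m) (Gr k n)).left), I ≤ h.ker ↔
      Incid φ (h ≫ (fstC (Gr k m) (Gr k n)).left) (h ≫ (sndC (Gr k m) (Gr k n)).left)) :
    IsIncidenceVariety φ (I.subschemeι ≫ (fstC (Gr k m) (Gr k n)).left)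
      (I.subschemeι ≫ (sndC (Gr k m) (Gr k n)).left) where
  w := by rw [Category.assoc, Category.assoc, Over.w, Over.w]
  incid := (hI _ _).1 I.ker_subschemeι.ge
  exists_lift T f₁ f₂ hw h := by
    let g : T ⟶ (prodC (Gr k m) (Gr k n)).left := pullback.lift f₁ f₂ hw
    have hg₁ : g ≫ (fstC (Gr k m) (Gr k n)).left = f₁ := pullback.lift_fst _ _ _
    have hg₂ : g ≫ (sndC (Gr k m) (Gr k n)).left = f₂ := pullback.lift_snd _ _ _
    have hle : I.subschemeι.ker ≤ g.ker := by
      rw [I.ker_subschemeι, hI, hg₁, hg₂]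
      exact h
    refine ⟨IsClosedImmersion.lift I.subschemeι g hle, ?_, ?_⟩
    · rw [IsClosedImmersion.lift_fac_assoc, hg₁]
    · rw [IsClosedImmersion.lift_fac_assoc, hg₂]
  ext T h h' h₁ h₂ := by
    refine (cancel_mono I.subschemeι).1 (prodC_hom_ext ?_ ?_)
    · rw [Category.assoc, h₁, Category.assoc]
    · rw [Category.assoc, h₂, Category.assoc]

/-- The zero locus of the section of `𝒬 ⊠ 𝒰^∨` given by `φ` is the variety of the pairs of subspaces
such that `φ` sends the second to the first. -/
lemma isIncidenceVariety_zeroLocus {k m n : ℕ} (φ : Matrix (Fin n) (Fin m) ℂ) :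
    IsIncidenceVariety φ
      ((quotBoxSubDual k m n).zeroLocusι (boxSection k m n φ) ≫ fstC (Gr k m) (Gr k n)).left
      ((quotBoxSubDual k m n).zeroLocusι (boxSection k m n φ) ≫ sndC (Gr k m) (Gr k n)).left :=
  isIncidenceVariety_subscheme _ fun _ h => zeroIdeal_boxSection_le_ker_iff φ h

/-- Precomposition of the linear map with an automorphism. -/
lemma IsIncidenceVariety.comp_aut {k m n : ℕ} {φ : Matrix (Fin n) (Fin m) ℂ}
    {g : Matrix (Fin n) (Fin n) ℂ} {α : Gr k n ≅ Gr k n} (hα : ActsAs α.hom g) {Y : Scheme.{0}}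
    {p₁ : Y ⟶ (Gr k m).left} {p₂ : Y ⟶ (Gr k n).left} (hY : IsIncidenceVariety (g * φ) p₁ p₂) :
    IsIncidenceVariety φ p₁ (p₂ ≫ α.hom.left) where
  w := by rw [Category.assoc, Over.w]; exact hY.w
  incid := (hα.incid_iff p₁ p₂ φ).1 hY.incid
  exists_lift T f₁ f₂ hw hI := by
    have hinv : α.inv.left ≫ α.hom.left = 𝟙 _ := by
      rw [← Over.comp_left, α.inv_hom_id, Over.id_left]
    obtain ⟨h, h₁, h₂⟩ := hY.exists_lift T f₁ (f₂ ≫ α.inv.left)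
      (by rw [Category.assoc, Over.w]; exact hw) (by
        rw [hα.incid_iff, Category.assoc, hinv, Category.comp_id]; exact hI)
    exact ⟨h, h₁, by rw [← Category.assoc, h₂, Category.assoc, hinv, Category.comp_id]⟩
  ext T h h' h₁ h₂ := by
    refine hY.ext T h h' h₁ ?_
    rw [← Category.assoc, ← Category.assoc] at h₂
    exact (cancel_mono α.hom.left).1 h₂

/-- An injective linear map whose image is a hyperplane is the standard one, up to an
automorphism. -/
lemma exists_eq_mul_dropMatrix {m : ℕ} {φ : Matrix (Fin (m + 1)) (Fin m) ℂ}
    {ψ : Matrix (Fin m) (Fin (m + 1)) ℂ} (h : ψ * φ = 1) :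
    ∃ g g' : Matrix (Fin (m + 1)) (Fin (m + 1)) ℂ, g * g' = 1 ∧ φ = g * dropMatrix m := by
  -- The independent columns of `φ` are completed by one of the columns of `M` to an invertible
  -- matrix `g`, whose columns after the first are those of `φ`.
  let M : Matrix (Fin (m + 1)) (Fin (m + 1) ⊕ Fin m) ℂ := Matrix.fromCols 1 φ
  have hR : M * Matrix.fromRows (1 : Matrix (Fin (m + 1)) (Fin (m + 1)) ℂ)
      (0 : Matrix (Fin m) (Fin (m + 1)) ℂ) = 1 := by
    simp [M, Matrix.fromCols_mul_fromRows]
  have hA : (ψ * M).submatrix id Sum.inr = 1 := by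
    rw [← h]; rfl
  obtain ⟨b, hb⟩ := exists_det_ne_zero hR hA
  refine ⟨M.submatrix id (Fin.cons b Sum.inr : Fin (m + 1) → _), _,
    Matrix.mul_nonsing_inv _ hb.isUnit, ?_⟩
  ext i j
  simp [dropMatrix, Matrix.mul_apply, Matrix.one_apply, M]

/-- The projection of the zero locus of a general section of `𝒬 ⊠ 𝒰^∨` is a blow-up. -/
lemma exists_isBlowup_zeroLocus {k m : ℕ} {φ : Matrix (Fin (m + 1)) (Fin m) ℂ}
    {ψ : Matrix (Fin m) (Fin (m + 1)) ℂ} (h : ψ * φ = 1) :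
    ∃ v : Fin (m + 1) → ℂ, v ≠ 0 ∧ IsBlowup
      ((quotBoxSubDual (k + 1) m (m + 1)).zeroLocusι (boxSection (k + 1) m (m + 1) φ) ≫
        sndC (Gr (k + 1) m) (Gr (k + 1) (m + 1))).left
      ((tautQuot (k + 1) (m + 1)).zeroIdeal (quotSection (k + 1) (m + 1) v).2) := by
  obtain ⟨g, g', hg, rfl⟩ := exists_eq_mul_dropMatrix h
  obtain ⟨α, hα⟩ := exists_aut (k + 1) g g' hg
  have hv : Matrix.vecMul (Matrix.vecMul (stdVec m) g') g = stdVec m := by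
    rw [Matrix.vecMul_vecMul, mul_eq_one_comm.1 hg, Matrix.vecMul_one]
  -- The vector taken by `g` to `e₀`; it spans the kernel of `g * dropMatrix m`.
  refine ⟨Matrix.vecMul (stdVec m) g', fun h0 => ?_, ?_⟩
  · rw [h0, Matrix.zero_vecMul] at hv
    exact stdVec_ne_zero m hv.symm
  · have : IsIso α.hom.left := inferInstanceAs (IsIso ((Over.forget _).map α.hom))
    rw [← hα.comap_zeroIdeal hg, hv]
    exact (isBlowup_comp_iff _ α.hom.left _).1
      ((isIncidenceVariety_zeroLocus (g * dropMatrix m)).comp_aut hα).isBlowup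

/-- A blow-up of the zero locus of one section of the quotient bundle is, up to an automorphism, a
blow-up of the zero locus of any other one. -/
lemma exists_isBlowup_of_ne_zero {k n : ℕ} {Y : CScheme} {π : Y ⟶ Gr k n} {v w : Fin n → ℂ}
    (hv : v ≠ 0) (hw : w ≠ 0)
    (h : IsBlowup π.left ((tautQuot k n).zeroIdeal (quotSection k n v).2)) :
    ∃ π' : Y ⟶ Gr k n, IsBlowup π'.left ((tautQuot k n).zeroIdeal (quotSection k n w).2) := by
  obtain ⟨g, g', hg, rfl⟩ := exists_matrix_vecMul_eq hv hw
  obtain ⟨α, hα⟩ := exists_aut k g g' hg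
  have : IsIso α.hom.left := inferInstanceAs (IsIso ((Over.forget _).map α.hom))
  refine ⟨π ≫ α.hom, (isBlowup_comp_iff π.left α.hom.left _).2 ?_⟩
  rwa [hα.comap_zeroIdeal hg]

/-! ### Zariski open sets of sections -/

section Zariski

variable {V : Type} [AddCommGroup V] [Module ℂ V]

lemma isZariskiOpen_univ : IsZariskiOpen (Set.univ : Set V) :=
  ⟨{1}, by simp [one_mem], by ext; simp⟩

lemma isZariskiOpen_ne_zero {p : Type} (e : V ≃ₗ[ℂ] (p → ℂ)) : IsZariskiOpen {v : V | v ≠ 0} := by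
  refine ⟨Set.range fun j v => e v j, ?_, ?_⟩
  · rintro _ ⟨j, rfl⟩
    exact Algebra.subset_adjoin ⟨LinearMap.proj j ∘ₗ e.toLinearMap, rfl⟩
  · ext v
    simp only [Set.mem_ofPred_eq, Set.exists_range_iff]
    rw [← e.map_ne_zero_iff, Function.ne_iff]
    rfl

/-- Determinants are polynomials in the entries, which are linear forms. Choices `ρ` with repeated
rows contribute the zero polynomial and do no harm. -/
lemma isZariskiOpen_exists_det_ne_zero {p q : Type} [Fintype q] [DecidableEq q]
    (e : V ≃ₗ[ℂ] Matrix p q ℂ) :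
    IsZariskiOpen {v : V | ∃ ρ : q → p, ((e v).submatrix ρ id).det ≠ 0} := by
  refine ⟨Set.range fun (ρ : q → p) v => ((e v).submatrix ρ id).det, ?_, ?_⟩
  · rintro _ ⟨ρ, rfl⟩
    have h : (fun v => ((e v).submatrix ρ id).det) = ∑ π : Equiv.Perm q,
        ((Equiv.Perm.sign π : ℤ) : ℂ) • ∏ i, fun v => e v (ρ (π i)) i := by
      funext v
      simp [Matrix.det_apply', Finset.sum_apply]
    beta_reduce
    rw [h]
    refine sum_mem fun π _ => Subalgebra.smul_mem _ (Subalgebra.prod_mem _ fun i _ => ?_) _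
    exact Algebra.subset_adjoin ⟨Matrix.entryLinearMap ℂ ℂ (ρ (π i)) i ∘ₗ e.toLinearMap, rfl⟩
  · ext v
    simp

end Zariski

lemma exists_leftInv_of_det_ne_zero {m : ℕ} {φ : Matrix (Fin (m + 1)) (Fin m) ℂ}
    {ρ : Fin m → Fin (m + 1)} (h : (φ.submatrix ρ id).det ≠ 0) :
    ∃ ψ : Matrix (Fin m) (Fin (m + 1)) ℂ, ψ * φ = 1 := by
  refine ⟨(φ.submatrix ρ id)⁻¹ * (1 : Matrix (Fin (m + 1)) (Fin (m + 1)) ℂ).submatrix ρ id, ?_⟩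
  rw [Matrix.mul_assoc]
  have : (1 : Matrix (Fin (m + 1)) (Fin (m + 1)) ℂ).submatrix ρ id * φ = φ.submatrix ρ id := by
    ext i j
    simp [Matrix.mul_apply, Matrix.one_apply]
  rw [this, Matrix.nonsing_inv_mul _ h.isUnit]

lemma dropMatrix_submatrix_succ (m : ℕ) : (dropMatrix m).submatrix Fin.succ id = 1 := by
  ext i j
  simp [dropMatrix, Matrix.one_apply]

/-- If the quotient bundle on the first factor is zero, so are all sections of `𝒬 ⊠ 𝒰^∨`. -/
lemma subsingleton_H0_quotBoxSubDual (k n : ℕ) : Subsingleton (quotBoxSubDual k k n).H0 := by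
  refine ⟨fun s t => Subtype.ext (funext fun (p : (Fin k ↪o Fin k) × (Fin k ↪o Fin n)) => funext fun
    (a : {j : Fin k // j ∉ Set.range p.1} × Fin k) => ?_)⟩
  exact absurd (Finite.surjective_of_injective p.1.injective a.1.1) a.1.2

/-- A general section of `𝒬 ⊠ 𝒰^∨` is given by an injective linear map. -/
lemma exists_isZariskiOpen_boxSection {k m : ℕ} (hk : 1 ≤ k) (hkm : k ≤ m) :
    ∃ A : Set (quotBoxSubDual k m (m + 1)).H0, IsZariskiOpen A ∧ A.Nonempty ∧
      ∀ s ∈ A, ∃ (φ : Matrix (Fin (m + 1)) (Fin m) ℂ) (ψ : Matrix (Fin m) (Fin (m + 1)) ℂ),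
        ψ * φ = 1 ∧ boxSection k m (m + 1) φ = s := by
  have hdrop : ((dropMatrix m).submatrix Fin.succ id).det ≠ 0 := by
    rw [dropMatrix_submatrix_succ, Matrix.det_one]; exact one_ne_zero
  -- For `k = m` the matrix is not determined by the section, but the zero section is the only one
  -- and `dropMatrix` represents it.
  rcases hkm.eq_or_lt with rfl | hkm
  · obtain ⟨ψ, hψ⟩ := exists_leftInv_of_det_ne_zero hdrop
    have := subsingleton_H0_quotBoxSubDual k (k + 1)
    exact ⟨Set.univ, isZariskiOpen_univ, ⟨0, trivial⟩,
      fun s _ => ⟨dropMatrix k, ψ, hψ, Subsingleton.elim _ _⟩⟩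
  · let e := LinearEquiv.ofBijective (boxSection k m (m + 1))
      ⟨boxSection_injective hk (by omega) hkm, boxSection_surjective hk (by omega)⟩
    refine ⟨_, isZariskiOpen_exists_det_ne_zero e.symm, ⟨e (dropMatrix m), Fin.succ, ?_⟩, ?_⟩
    · rwa [e.symm_apply_apply]
    · rintro s ⟨ρ, hρ⟩
      obtain ⟨ψ, hψ⟩ := exists_leftInv_of_det_ne_zero hρ
      exact ⟨e.symm s, ψ, hψ, e.apply_symm_apply s⟩

/-- For `s` given by `φ` of full rank, the projection is the blow-up along the subspaces containing
a kernel vector of `φ`. Any other nonzero `t` is reached by composing the projection with an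
automorphism of the Grassmannian. -/
theorem exists_isZariskiOpen_isBlowup {k m : ℕ} (hkm : k + 1 ≤ m) :
    ∃ (A : Set (quotBoxSubDual (k + 1) m (m + 1)).H0) (B : Set (tautQuot (k + 1) (m + 1)).H0),
      IsZariskiOpen A ∧ A.Nonempty ∧ IsZariskiOpen B ∧ B.Nonempty ∧
      (∀ t ∈ B, Nonempty ((tautQuot (k + 1) (m + 1)).zeroLocus t ≅ Gr k m)) ∧
      ∀ s ∈ A,
        (∃ t ∈ B, IsBlowup
          ((quotBoxSubDual (k + 1) m (m + 1)).zeroLocusι s ≫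
            sndC (Gr (k + 1) m) (Gr (k + 1) (m + 1))).left
          ((tautQuot (k + 1) (m + 1)).zeroIdeal t.2)) ∧
        ∀ t ∈ B, ∃ π : (quotBoxSubDual (k + 1) m (m + 1)).zeroLocus s ⟶ Gr (k + 1) (m + 1),
          IsBlowup π.left ((tautQuot (k + 1) (m + 1)).zeroIdeal t.2) := by
  obtain ⟨A, hA, hA', hA''⟩ := exists_isZariskiOpen_boxSection (Nat.succ_pos k) hkm
  let e := LinearEquiv.ofBijective (quotSection (k + 1) (m + 1))
    ⟨quotSection_injective (by omega), quotSection_surjective _ _⟩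
  have hB : ∀ t ∈ {t : (tautQuot (k + 1) (m + 1)).H0 | t ≠ 0}, ∃ v ≠ 0,
      quotSection (k + 1) (m + 1) v = t := fun t ht =>
    ⟨e.symm t, (e.symm.map_ne_zero_iff).2 ht, e.apply_symm_apply t⟩
  refine ⟨A, {t | t ≠ 0}, hA, hA', isZariskiOpen_ne_zero e.symm,
    ⟨e (stdVec m), (e.map_ne_zero_iff).2 (stdVec_ne_zero m)⟩, ?_, ?_⟩
  · intro t ht
    obtain ⟨v, hv, rfl⟩ := hB t ht
    exact nonempty_zeroLocus_quotSection_iso hv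
  · intro s hs
    obtain ⟨φ, ψ, h, rfl⟩ := hA'' s hs
    obtain ⟨v, hv, hbl⟩ := exists_isBlowup_zeroLocus (k := k) h
    refine ⟨⟨quotSection (k + 1) (m + 1) v, (e.map_ne_zero_iff).2 hv, hbl⟩, fun t ht => ?_⟩
    obtain ⟨w, hw, rfl⟩ := hB t ht
    exact exists_isBlowup_of_ne_zero hv hw hbl

end GrBlow
end

theorem lemma2p2 (k n : ℕ) (hk : 1 ≤ k) (hkn : k < n) :
    ∃ (A : Set (GrBlow.quotBoxSubDual k (n - 1) n).H0) (B : Set (GrBlow.tautQuot k n).H0),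
      GrBlow.IsZariskiOpen A ∧ A.Nonempty ∧ GrBlow.IsZariskiOpen B ∧ B.Nonempty ∧
      (∀ t ∈ B, Nonempty ((GrBlow.tautQuot k n).zeroLocus t ≅ GrBlow.Gr (k - 1) (n - 1))) ∧
      ∀ s ∈ A,
        (∃ t ∈ B, GrBlow.IsBlowup
          ((GrBlow.quotBoxSubDual k (n - 1) n).zeroLocusι s ≫
            GrBlow.sndC (GrBlow.Gr k (n - 1)) (GrBlow.Gr k n)).left
          ((GrBlow.tautQuot k n).zeroIdeal t.2)) ∧
        ∀ t ∈ B, ∃ π : (GrBlow.quotBoxSubDual k (n - 1) n).zeroLocus s ⟶ GrBlow.Gr k n,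
          GrBlow.IsBlowup π.left ((GrBlow.tautQuot k n).zeroIdeal t.2) := by
  obtain ⟨k, rfl⟩ := Nat.exists_eq_add_of_le' hk
  obtain ⟨n, rfl⟩ := Nat.exists_eq_add_of_lt hkn
  exact GrBlow.exists_isZariskiOpen_isBlowup (by omega)
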